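/- Let $(\omega_n)_{n\in\mathbb Z}$ be i.i.d. real random variables whose common law has a bounded, compactly supported density. Let $(a(n))_{n\in\mathbb Z}$ be a deterministic real sequence with $1/M\le |a(n)|\le M$ for all $n$ and some $M>0$. Let $(d_n)_{n\in\mathbb Z}$ be a real sequence, not identically zero, with $|d_n|\le K e^{-\lambda |n|}$ for some $K,\lambda>0$, and put $V_\omega(m)=\sum_{n\in\mathbb Z} d_n\,\omega_{n+m}$. For $L\in\mathbb N$ let $H_\omega(\Lambda_L)$ be the restriction of the Jacobi operator $$(H_\omega u)(n)=a(n+1)u(n+1)+a(n)u(n-1)+V_\omega(n)u(n)$$ to $\ell^2(\{1,\dots,L\})$, with either Dirichlet conditions ($u(0)=u(L+1)=0$) or periodic conditions (the sites $L$ and $1$ are neighbours, joined by a bond of weight $a(1)$); the choice of boundary condition is fixed throughout. Assume (H1) $d_n\ge 0$ for all $n$, or $d_n\le 0$ for all $n$; and at least one of (H2) $d_n=0$ for all but finitely many $n$, (H2') $\sum_{n} d_n e^{in\theta}\ne 0$ for all $\theta\in[0,2\pi)$. Let $\mathcal I\subset\mathbb R$ be an open set on which the operators $H_\omega(\Lambda_L)$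 are localized, in the following sense: for every $\xi\in(0,1)$, $$\sup_{L\ge 1}\ \sup_{1\le x\le L}\ \sup_{f}\ \mathbb E\Big(\sum_{y=1}^{L} e^{\mathrm{dist}(x,y)^{\xi}}\,\big\|\mathbf 1_{\{x\}} f(H_\omega(\Lambda_L))\mathbf 1_{\{y\}}\big\|_2\Big)<\infty ,$$ where $f$ runs over the real Borel functions with $|f|\le1$ and $\operatorname{supp} f\subset\mathcal I$, $\|\cdot\|_2$ is the Hilbert--Schmidt norm, and $\mathrm{dist}(x,y)$ is $|x-y|$ for Dirichlet conditions and $\min(|x-y|,L-|x-y|)$ for periodic conditions. Let $\beta\in(1/2,1)$, $\alpha\in(0,1)$, and $E,E'\in\mathcal I$ with $E\ne E'$. Then for every $k>1$ there exists $C>0$ such that, for all sufficiently large $L\in\mathbb N$ and all $l\in\mathbb N$ with $L^\alpha/k\le l\le kL^\alpha$, $$\mathbb P\left(\begin{aligned}&\operatorname{tr}\mathbf 1_{[E-L^{-1},E+L^{-1}]}(H_\omega(\Lambda_l))\ne0,\\ &\operatorname{tr}\mathbf 1_{[E'-L^{-1},E'+L^{-1}]}(H_\omega(\Lambda_l))\ne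 0\end{aligned}\right)\le C\,\frac{l^2}{L^{4/3}}\,e^{(\log L)^\beta}.$$ -/

import Mathlib

open MeasureTheory ProbabilityTheory Filter

noncomputable section

/-- The two boundary conditions for the restriction of a Jacobi operator to a box. -/
inductive BoundaryCondition where
  | dirichlet
  | periodic

/-- The restriction of the Jacobi operator
`(H u)(n) = a (n + 1) * u (n + 1) + a n * u (n - 1) + V n * u n` to the box `{1, …, L}`, as a
matrix in the canonical basis. The index `i : Fin L` stands for the site `i + 1`.
For Dirichlet conditions `u 0 = u (L + 1) = 0`; for periodic conditions the sites `L` and `1` are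
neighbours, and the bond between them carries the weight `a 1`. -/
def boxOperator (bc : BoundaryCondition) (a V : ℤ → ℝ) (L : ℕ) : Matrix (Fin L) (Fin L) ℝ :=
  fun i j =>
    (if i = j then V ((i : ℤ) + 1) else 0)
    + (if (j : ℕ) = (i : ℕ) + 1 then a ((i : ℤ) + 2) else 0)
    + (if (i : ℕ) = (j : ℕ) + 1 then a ((i : ℤ) + 1) else 0)
    + match bc with
      | .dirichlet => 0
      | .periodic =>
        (if (i : ℕ) + 1 = L ∧ (j : ℕ) = 0 then a 1 else 0)
        + (if (i : ℕ) = 0 ∧ (j : ℕ) + 1 = L then a 1 else 0)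

/-- The box operator is symmetric, so that functions of it are given by the spectral theorem. -/
theorem boxOperator_isSelfAdjoint (bc : BoundaryCondition) (a V : ℤ → ℝ) (L : ℕ) :
    IsSelfAdjoint (boxOperator bc a V L) := by
  have key : ∀ i j : Fin L, boxOperator bc a V L j i = boxOperator bc a V L i j := by
    intro i j
    have h1 : (if j = i then V ((j : ℤ) + 1) else 0) = if i = j then V ((i : ℤ) + 1) else 0 := by
      by_cases h : i = j
      · subst h; rfl
      · rw [if_neg h, if_neg (fun h' => h h'.symm)]
    have h2 : (if (i : ℕ) = (j : ℕ) + 1 then a ((j : ℤ) + 2) else 0)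
        = if (i : ℕ) = (j : ℕ) + 1 then a ((i : ℤ) + 1) else 0 := by
      split_ifs with h
      · congr 1; omega
      · rfl
    have h3 : (if (j : ℕ) = (i : ℕ) + 1 then a ((j : ℤ) + 1) else 0)
        = if (j : ℕ) = (i : ℕ) + 1 then a ((i : ℤ) + 2) else 0 := by
      split_ifs with h
      · congr 1; omega
      · rfl
    cases bc
    · simp only [boxOperator, h1, h2, h3]
      ring
    · simp only [boxOperator, h1, h2, h3, and_comm]
      ring
  ext i j
  simp [Matrix.star_apply, key]

/-- The distance between two sites of the box `{1, …, L}`: the usual one for Dirichlet conditions,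
the distance on the cycle of length `L` for periodic conditions. -/
def boxDist (bc : BoundaryCondition) (L : ℕ) (x y : Fin L) : ℝ :=
  match bc with
  | .dirichlet => |(x : ℝ) - (y : ℝ)|
  | .periodic => min |(x : ℝ) - (y : ℝ)| ((L : ℝ) - |(x : ℝ) - (y : ℝ)|)

/-- The alloy-type potential `V m = ∑ₙ d n * w (n + m)` with single-site potential `d`, for a
realization `w` of the random couplings. -/
def alloyPotential (d w : ℤ → ℝ) (m : ℤ) : ℝ :=
  ∑' n : ℤ, d n * w (n + m)

/-- The trace of the spectral projection `1_J(A)` of a symmetric matrix `A`. -/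
def spectralTrace {L : ℕ} (J : Set ℝ) (A : Matrix (Fin L) (Fin L) ℝ) : ℝ :=
  (cfc (J.indicator fun _ => (1 : ℝ)) A).trace

/-- Localization on `I` for the random operators `H ω L` on the boxes `{1, …, L}`: for every
`ξ ∈ (0, 1)`, the expectations `𝔼 ∑_y exp (dist x y ^ ξ) * ‖1_x f(H) 1_y‖₂` are bounded uniformly
in the box, in its site `x` and in the Borel functions `f` with `|f| ≤ 1` and support in `I`.
The Hilbert–Schmidt norm of `1_x f(H) 1_y` is the absolute value of the matrix entry. -/
def IsLocalizedOn {Ω : Type*} [MeasurableSpace Ω] (P : Measure Ω) (bc : BoundaryCondition)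
    (H : Ω → (L : ℕ) → Matrix (Fin L) (Fin L) ℝ) (I : Set ℝ) : Prop :=
  ∀ ξ : ℝ, 0 < ξ → ξ < 1 → ∃ K : ℝ, ∀ (L : ℕ) (x : Fin L) (f : ℝ → ℝ),
    Measurable f → (∀ t, |f t| ≤ 1) → tsupport f ⊆ I →
      ∫⁻ ω, ∑ y : Fin L,
        ENNReal.ofReal (Real.exp (boxDist bc L x y ^ ξ) * |cfc f (H ω L) x y|) ∂P
      ≤ ENNReal.ofReal K

end

/-! Put `h = 1/L` and `K = ⌈(log L)^b⌉` with `1/2 < b < β`. By localization, an eigenvalue of the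
box near `E` is already seen, up to a factor in `h`, by the restriction of the operator to a
neighbourhood of one centre (`exists_center`). Two eigenvalues near `E` and `E'` are therefore seen
by a matrix on at most `6r + 2` sites, `r ~ (log L)^3`: the neighbourhoods of two centres and of the
ends of the box. There are `l^2` choices of the centres, so the task is to bound the probability
that such a small matrix is resonant at both energies by about `L^(-2) e^(O(K))`.

To first order, the coupling `ω_i` moves a simple eigenvalue with unit eigenvector `u` by `∑ d(i -
x) u(x)^2`, the convolution of `d` with `u^2`. Let `u`, `v` be eigenvectors of the small matrix for
energies `e`, `e'` near `E`, `E'`, and let `η = e^(-qK)` for a large constant `q`.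

If `u^2` and `v^2` differ by more than `η^2` at some site, the two gradients differ, because (H2) or
(H2') bounds the convolution with `d` from below with at most a polynomial loss
(`exists_abs_le_convOn`). By (H1) the gradients are non-negative, and they have the same total mass,
so they are not parallel either: some minor in two couplings `i`, `j` is at least `δ`, where `δ` is
`η^2` up to powers of `r` (`exists_le_abs_det_of_not_close`). The correspondence from `(ω_i, ω_j)`
to pairs of eigenvalues then has Jacobian at least `δ`, and for almost every pair of energies at
most `n^3` parameters realize it, where `n` is the number of sites. The area formula bounds the
resonant parameters by a constant times `n^3 h^2 / δ` (`volume_resonantPair_le`).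

If `u^2` and `v^2` agree up to `η^2`, then `v` is close to `u` up to a sign at each site, so that
`u` nearly solves a second recurrence with energy `e'` and with the signs of some bonds reversed.
Comparing both recurrences where `u` is not small forces `V(n)` close to `c`, or `(V(n) - c)(V(n+1)
- c)` close to `a(n+1)^2`, at or next to that site, with `c = (E + E')/2` (`pairNear_of_large`).
Transfer matrices keep `u` above `e^(-O(K))` on a window of length `O(K)`, so this happens at `K`
separated places. The potential at these places depends in a uniformly invertible way on `2K`
couplings, so the probability for a given window is at most `(C e^(-K))^K`, which is below `L^(-2)`
because `b > 1/2`.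

Altogether the bound is of order `l^2 L^(-2) e^((log L)^β)`, which is stronger than the stated one.
-/

noncomputable section

/-! ### Lower bounds for the convolution with `d` -/

open Polynomial in
/-- The right shift of complex sequences indexed by `ℤ`. -/
def seqShift : Module.End ℂ (ℤ → ℂ) where
  toFun f := fun i => f (i - 1)
  map_add' _ _ := rfl
  map_smul' _ _ := rfl

theorem seqShift_pow_apply (k : ℕ) (f : ℤ → ℂ) (i : ℤ) : (seqShift ^ k) f i = f (i - k) := by
  induction k generalizing f i with
  | zero => simp
  | succ k ih =>
    rw [pow_succ, Module.End.mul_apply, ih]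
    simp only [seqShift, LinearMap.coe_mk, AddHom.coe_mk]
    congr 1; push_cast; ring

/-- Iterate the step until `i - n * s` has left the finite support; the errors collected on the way
are distinct terms of the series. -/
theorem enorm_le_tsum_of_step (f h : ℤ → ℂ) (s : ℤ) (hs : s = 1 ∨ s = -1)
    (hstep : ∀ i, ‖f i‖ₑ ≤ ‖f (i - s)‖ₑ + ‖h i‖ₑ)
    (S : Finset ℤ) (hS : ∀ m ∉ S, f m = 0) (i : ℤ) : ‖f i‖ₑ ≤ ∑' j, ‖h j‖ₑ := by
  have key : ∀ n : ℕ, ‖f i‖ₑ ≤ ‖f (i - n * s)‖ₑ + ∑ k ∈ Finset.range n, ‖h (i - k * s)‖ₑ := by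
    intro n
    induction n with
    | zero => simp
    | succ n ih =>
      refine ih.trans ?_
      rw [Finset.sum_range_succ]
      have := hstep (i - n * s)
      rw [show i - (n : ℤ) * s - s = i - ((n + 1 : ℕ) : ℤ) * s by push_cast; ring] at this
      calc _ ≤ _ := add_le_add this le_rfl
        _ = _ := by ring
  have hinj : Function.Injective fun n : ℕ => i - n * s := by
    intro p q hpq
    rcases hs with rfl | rfl <;> simp at hpq <;> omega
  obtain ⟨n, hn⟩ : ∃ n : ℕ, (i - n * s) ∉ S := by
    by_contra hcon
    push Not at hcon
    exact (Set.infinite_range_of_injective hinj) (S.finite_toSet.subset (by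
      rintro _ ⟨n, rfl⟩; exact hcon n))
  have h1 := key n
  rw [hS _ hn, enorm_zero, zero_add] at h1
  refine h1.trans ?_
  calc ∑ k ∈ Finset.range n, ‖h (i - k * s)‖ₑ ≤ ∑' k : ℕ, ‖h (i - k * s)‖ₑ :=
        ENNReal.sum_le_tsum _
    _ ≤ _ := ENNReal.tsum_comp_le_tsum_of_injective hinj (fun j => ‖h j‖ₑ)

-- A linear factor `X - z` is inverted in the direction that does not expand: solve for `f j` if `1
-- ≤ ‖z‖` and for `f (j - 1)` if `‖z‖ ≤ 1`. Roots on the unit circle cost nothing, because an `ℓ¹`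
-- norm bounds a supremum.
open Polynomial in
theorem enorm_le_tsum_shift_sub (z : ℂ) (S : Finset ℤ) (f : ℤ → ℂ) (hS : ∀ m ∉ S, f m = 0)
    (m : ℤ) : ‖f m‖ₑ ≤ ∑' j, ‖aeval seqShift (X - C z) f j‖ₑ := by
  have hap : ∀ j, aeval seqShift (X - C z) f j = f (j - 1) - z * f j := by
    intro j
    simp [seqShift]
  simp only [hap]
  rcases le_total 1 ‖z‖ with hz | hz
  · refine enorm_le_tsum_of_step f (fun j => f (j - 1) - z * f j) 1 (Or.inl rfl) (fun i => ?_) S hS m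
    have : ‖f i‖ ≤ ‖f (i - 1)‖ + ‖f (i - 1) - z * f i‖ := by
      have h1 : ‖z * f i‖ ≤ ‖f (i - 1)‖ + ‖f (i - 1) - z * f i‖ := by
        have := norm_sub_le (f (i - 1)) (f (i - 1) - z * f i)
        simpa using this
      rw [norm_mul] at h1
      nlinarith [norm_nonneg (f i)]
    rw [← ofReal_norm, ← ofReal_norm, ← ofReal_norm, ← ENNReal.ofReal_add (norm_nonneg _)
      (norm_nonneg _)]
    exact ENNReal.ofReal_le_ofReal this
  · have h2 := enorm_le_tsum_of_step f (fun j => f j - z * f (j + 1)) (-1) (Or.inr rfl)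
      (fun i => ?_) S hS m
    · refine h2.trans (le_of_eq ?_)
      rw [← (Equiv.subRight (1 : ℤ)).tsum_eq fun j => ‖f j - z * f (j + 1)‖ₑ]
      simp
    have : ‖f i‖ ≤ ‖f (i - -1)‖ + ‖f i - z * f (i + 1)‖ := by
      have h1 : ‖f i‖ ≤ ‖z * f (i + 1)‖ + ‖f i - z * f (i + 1)‖ := by
        have := norm_add_le (z * f (i + 1)) (f i - z * f (i + 1))
        simpa using this
      rw [norm_mul] at h1
      rw [sub_neg_eq_add]
      nlinarith [norm_nonneg (f (i + 1))]
    rw [← ofReal_norm, ← ofReal_norm, ← ofReal_norm, ← ENNReal.ofReal_add (norm_nonneg _)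
      (norm_nonneg _)]
    exact ENNReal.ofReal_le_ofReal this

open Polynomial in
/-- A nonzero polynomial in the shift is bounded below on finitely supported sequences, with a
loss that is polynomial in the size of the support. -/
theorem exists_enorm_le_tsum_aeval_shift (p : ℂ[X]) (hp : p ≠ 0) :
    ∃ (c : ENNReal) (N : ℕ), c ≠ ⊤ ∧ ∀ (S : Finset ℤ) (f : ℤ → ℂ), (∀ m ∉ S, f m = 0) →
      ∀ m, ‖f m‖ₑ ≤ c * (S.card : ENNReal) ^ N * ∑' j, ‖aeval seqShift p f j‖ₑ := by
  have hprod : ∀ s : Multiset ℂ, ∃ (c : ENNReal) (N : ℕ), c ≠ ⊤ ∧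
      ∀ (S : Finset ℤ) (f : ℤ → ℂ), (∀ m ∉ S, f m = 0) → ∀ m, ‖f m‖ₑ ≤ c * (S.card : ENNReal) ^ N *
        ∑' j, ‖aeval seqShift (s.map fun a => X - C a).prod f j‖ₑ := by
    intro s
    induction s using Multiset.induction_on with
    | empty =>
      refine ⟨1, 0, by simp, fun S f _ m => ?_⟩
      simpa using ENNReal.le_tsum (f := fun j => ‖f j‖ₑ) m
    | cons z s ih =>
      obtain ⟨c, N, hc, h⟩ := ih
      refine ⟨c * 2 ^ (N + 1), N + 1, ENNReal.mul_ne_top hc (by simp), fun S f hS m => ?_⟩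
      set g := aeval seqShift (X - C z) f with hg
      have hgj : ∀ j, g j = f (j - 1) - z * f j := by
        intro j
        simp [hg, seqShift]
      set S' := S ∪ S.image (fun j => j + 1) with hS'
      have hgS : ∀ m ∉ S', g m = 0 := by
        intro j hj
        rw [hS', Finset.mem_union, not_or] at hj
        rw [hgj, hS j hj.1, hS (j - 1)]
        · simp
        · intro hcon
          exact hj.2 (Finset.mem_image.2 ⟨j - 1, hcon, by ring⟩)
      have hcard : (S'.card : ENNReal) ≤ 2 * S.card := by
        have h1 : S'.card ≤ 2 * S.card := by
          refine (Finset.card_union_le _ _).trans ?_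
          have := Finset.card_image_le (s := S) (f := fun j : ℤ => j + 1)
          omega
        exact_mod_cast h1
      set T := ∑' j, ‖aeval seqShift ((z ::ₘ s).map fun a => X - C a).prod f j‖ₑ with hT
      have hT' : ∑' j, ‖aeval seqShift (s.map fun a => X - C a).prod g j‖ₑ = T := by
        rw [hT, hg]
        congr 1
        funext j
        rw [Multiset.map_cons, Multiset.prod_cons, mul_comm, map_mul, Module.End.mul_apply]
      have h1 := enorm_le_tsum_shift_sub z S f hS m
      -- The induction hypothesis bounds only the supremum of `g`. Passing to its `ℓ¹` norm costs
      -- the size of the support, which one factor at most doubles: hence one more power of the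
      -- cardinality for each root.
      calc ‖f m‖ₑ ≤ ∑' j, ‖g j‖ₑ := h1
        _ = ∑ j ∈ S', ‖g j‖ₑ := tsum_eq_sum (fun j hj => by rw [hgS j hj, enorm_zero])
        _ ≤ ∑ j ∈ S', c * (S'.card : ENNReal) ^ N * T :=
            Finset.sum_le_sum fun j _ => hT' ▸ h S' g hgS j
        _ = (S'.card : ENNReal) ^ (N + 1) * c * T := by
            rw [Finset.sum_const, nsmul_eq_mul]; ring
        _ ≤ (2 * S.card : ENNReal) ^ (N + 1) * c * T := by gcongr
        _ = _ := by rw [mul_pow]; ring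
  obtain ⟨c, N, hc, h⟩ := hprod p.roots
  have hlc : p.leadingCoeff ≠ 0 := leadingCoeff_ne_zero.2 hp
  have hlc' : ‖p.leadingCoeff‖ₑ ≠ 0 := by simpa using hlc
  refine ⟨c * ‖p.leadingCoeff‖ₑ⁻¹, N, ENNReal.mul_ne_top hc (ENNReal.inv_ne_top.2 hlc'),
    fun S f hS m => ?_⟩
  have hsplit : p = C p.leadingCoeff * (p.roots.map fun a => X - C a).prod :=
    (IsAlgClosed.splits p).eq_prod_roots
  have hval : ∑' j, ‖aeval seqShift p f j‖ₑ = ‖p.leadingCoeff‖ₑ *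
      ∑' j, ‖aeval seqShift (p.roots.map fun a => X - C a).prod f j‖ₑ := by
    rw [← ENNReal.tsum_mul_left]
    congr 1
    funext j
    conv_lhs => rw [hsplit]
    rw [map_mul, aeval_C, Module.End.mul_apply]
    simp [enorm_mul]
  rw [hval]
  refine (h S f hS m).trans (le_of_eq ?_)
  have := ENNReal.inv_mul_cancel hlc' (by simp)
  calc _ = c * (S.card : ENNReal) ^ N * (‖p.leadingCoeff‖ₑ⁻¹ * ‖p.leadingCoeff‖ₑ) *
        ∑' j, ‖aeval seqShift (p.roots.map fun a => X - C a).prod f j‖ₑ := by rw [this, mul_one]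
    _ = _ := by ring

/-- The convolution of `d` with a sequence supported in the finite set `S`. -/
def convOn (d : ℤ → ℝ) (S : Finset ℤ) (f : ℤ → ℝ) (i : ℤ) : ℝ :=
  ∑ m ∈ S, d (i - m) * f m

-- With `n₀` a lower bound of the support, the convolution with `d` is the polynomial `∑ d n X ^ (n
-- - n₀)` in the shift, up to a translation by `n₀`, so that the bound for polynomials applies.
open Polynomial in
theorem exists_abs_le_convOn_of_finite (d : ℤ → ℝ) (hd : ∃ n, d n ≠ 0)
    (hfin : (Function.support d).Finite) :
    ∃ (c : ENNReal) (N : ℕ), c ≠ ⊤ ∧ ∀ (S : Finset ℤ) (f : ℤ → ℝ), (∀ m ∉ S, f m = 0) →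
      ∀ m, ‖f m‖ₑ ≤ c * (S.card : ENNReal) ^ N * ∑' j, ‖convOn d S f j‖ₑ := by
  set T := hfin.toFinset with hT
  have hTd : ∀ n ∉ T, d n = 0 := fun n hn => by simpa [hT] using hn
  obtain ⟨n₀, hn₀⟩ : ∃ n₀ : ℤ, ∀ n ∈ T, n₀ ≤ n := by
    obtain ⟨b, hb⟩ := T.bddBelow
    exact ⟨b, fun n hn => hb hn⟩
  set p : ℂ[X] := ∑ n ∈ T, monomial (n - n₀).toNat (d n : ℂ) with hp
  have hp0 : p ≠ 0 := by
    obtain ⟨n, hn⟩ := hd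
    have hnT : n ∈ T := by by_contra h; exact hn (hTd n h)
    intro h0
    have hc : p.coeff (n - n₀).toNat = d n := by
      rw [hp, finsetSum_coeff, Finset.sum_eq_single n]
      · simp
      · intro k hk hkn
        rw [coeff_monomial, if_neg]
        have := hn₀ k hk
        have := hn₀ n hnT
        omega
      · intro h; exact absurd hnT h
    rw [h0] at hc
    simp at hc
    exact hn (by exact_mod_cast hc.symm)
  obtain ⟨c, N, hc, h⟩ := exists_enorm_le_tsum_aeval_shift p hp0
  refine ⟨c, N, hc, fun S f hS m => ?_⟩
  have h1 := h S (fun i => (f i : ℂ)) (fun m hm => by simp [hS m hm]) m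
  have hconv : ∀ i, aeval seqShift p (fun i => (f i : ℂ)) i = (convOn d S f (i + n₀) : ℂ) := by
    intro i
    have e1 : aeval seqShift p (fun i => (f i : ℂ)) i
        = ((∑ n ∈ T, d n * f (i + n₀ - n) : ℝ) : ℂ) := by
      rw [hp, map_sum, LinearMap.sum_apply, Finset.sum_apply]
      push_cast
      refine Finset.sum_congr rfl fun n hn => ?_
      rw [aeval_monomial, Module.End.mul_apply]
      have := hn₀ n hn
      simp [seqShift_pow_apply]
      left
      congr 1
      rw [max_eq_left (by omega)]; ring
    rw [e1]
    congr 1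
    have e2 : ∑ n ∈ T, d n * f (i + n₀ - n) = ∑' n, d n * f (i + n₀ - n) :=
      (tsum_eq_sum fun n hn => by rw [hTd n hn, zero_mul]).symm
    have e3 : convOn d S f (i + n₀) = ∑' m, d (i + n₀ - m) * f m :=
      (tsum_eq_sum fun n hn => by rw [hS n hn, mul_zero]).symm
    rw [e2, e3, ← (Equiv.subLeft (i + n₀)).tsum_eq]
    simp
  have h2 : ∑' j, ‖aeval seqShift p (fun i => (f i : ℂ)) j‖ₑ = ∑' j, ‖convOn d S f j‖ₑ := by
    rw [← (Equiv.addRight n₀).tsum_eq fun j => ‖convOn d S f j‖ₑ]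
    congr 1
    funext j
    rw [hconv]
    simp [← ofReal_norm]
  rw [h2] at h1
  refine le_trans (le_of_eq ?_) h1
  simp [← ofReal_norm]

theorem two_pi_mul_eq_integral (S : Finset ℤ) (f : ℤ → ℝ) (m : ℤ) (hm : m ∈ S) :
    (2 * Real.pi : ℂ) * f m = ∫ θ in (0 : ℝ)..(2 * Real.pi),
      (∑ k ∈ S, (f k : ℂ) * Complex.exp (Complex.I * k * θ)) * Complex.exp (-(Complex.I * m * θ)) := by
  have h1 : ∀ θ : ℝ, (∑ k ∈ S, (f k : ℂ) * Complex.exp (Complex.I * k * θ)) *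
      Complex.exp (-(Complex.I * m * θ))
      = ∑ k ∈ S, (f k : ℂ) * Complex.exp ((Complex.I * (k - m)) * θ) := by
    intro θ
    rw [Finset.sum_mul]
    refine Finset.sum_congr rfl fun k _ => ?_
    rw [mul_assoc, ← Complex.exp_add]
    congr 2; ring
  simp only [h1]
  rw [intervalIntegral.integral_finsetSum]
  · rw [Finset.sum_eq_single m]
    · simp [mul_comm]
    · intro k _ hkm
      have hne : Complex.I * ((k : ℂ) - m) ≠ 0 := by
        refine mul_ne_zero Complex.I_ne_zero (sub_ne_zero.2 ?_)
        exact_mod_cast hkm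
      rw [intervalIntegral.integral_const_mul, integral_exp_mul_complex hne]
      have : Complex.exp (Complex.I * ((k : ℂ) - m) * ((2 * Real.pi : ℝ) : ℂ)) = 1 := by
        rw [Complex.exp_eq_one_iff]
        exact ⟨k - m, by push_cast; ring⟩
      rw [this]
      simp
    · intro h; exact absurd hm h
  · intro k _
    apply Continuous.intervalIntegrable
    fun_prop

/-- The symbol `D` is continuous and periodic without zeros, hence `‖D‖` has a positive minimum `κ`.
The Fourier series of the convolution is `D * F`, with `F` that of `f`; so the `ℓ¹` norm of the
convolution bounds `κ ‖F‖` uniformly, and the values of `f` are Fourier coefficients of `F`. -/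
theorem exists_abs_le_convOn_of_symbol_ne_zero (d : ℤ → ℝ) (hd : Summable fun n => |d n|)
    (hsym : ∀ θ ∈ Set.Ico (0 : ℝ) (2 * Real.pi),
        ∑' n : ℤ, (d n : ℂ) * Complex.exp (Complex.I * (n : ℂ) * (θ : ℂ)) ≠ 0) :
    ∃ c : ENNReal, c ≠ ⊤ ∧ ∀ (S : Finset ℤ) (f : ℤ → ℝ), (∀ m ∉ S, f m = 0) →
      ∀ m, ‖f m‖ₑ ≤ c * ∑' j, ‖convOn d S f j‖ₑ := by
  set D : ℝ → ℂ := fun θ => ∑' n : ℤ, (d n : ℂ) * Complex.exp (Complex.I * n * θ) with hD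
  have hnorm : ∀ (n : ℤ) (θ : ℝ), ‖Complex.exp (Complex.I * n * θ)‖ = 1 := by
    intro n θ
    rw [Complex.norm_exp]
    simp
  have hDsum : ∀ θ : ℝ, Summable fun n : ℤ => (d n : ℂ) * Complex.exp (Complex.I * n * θ) := by
    intro θ
    refine Summable.of_norm ?_
    simpa [hnorm] using hd
  have hDc : Continuous D := by
    refine continuous_tsum (u := fun n => |d n|) (fun n => by fun_prop) hd fun n θ => ?_
    simp [hnorm]
  have hper : D (2 * Real.pi) = D 0 := by
    simp only [hD]
    congr 1
    funext n
    congr 1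
    have : Complex.exp (Complex.I * n * ((2 * Real.pi : ℝ) : ℂ)) = 1 := by
      rw [Complex.exp_eq_one_iff]
      exact ⟨n, by push_cast; ring⟩
    rw [this]; simp
  have hne : ∀ θ ∈ Set.Icc (0 : ℝ) (2 * Real.pi), D θ ≠ 0 := by
    intro θ hθ
    rcases hθ.2.lt_or_eq with h | h
    · exact hsym θ ⟨hθ.1, h⟩
    · rw [h, hper]
      exact hsym 0 ⟨le_rfl, by positivity⟩
  obtain ⟨θ₀, hθ₀, hmin⟩ := isCompact_Icc.exists_isMinOn (s := Set.Icc (0 : ℝ) (2 * Real.pi))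
    ⟨0, le_rfl, by positivity⟩ (hDc.norm.continuousOn)
  set κ := ‖D θ₀‖ with hκ
  have hκ0 : 0 < κ := norm_pos_iff.2 (hne θ₀ hθ₀)
  refine ⟨ENNReal.ofReal κ⁻¹, by simp, fun S f hS m => ?_⟩
  by_cases hm : m ∈ S
  swap
  · simp [hS m hm]
  by_cases htop : ∑' j, ‖convOn d S f j‖ₑ = ⊤
  · rw [htop, ENNReal.mul_top]
    · exact le_top
    · simpa using hκ0
  have hgs : Summable fun j => ‖convOn d S f j‖ := by
    have := ENNReal.summable_toReal htop
    simpa using this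
  set F : ℝ → ℂ := fun θ => ∑ k ∈ S, (f k : ℂ) * Complex.exp (Complex.I * k * θ) with hF
  have hprod : ∀ θ : ℝ, D θ * F θ
      = ∑' i : ℤ, (convOn d S f i : ℂ) * Complex.exp (Complex.I * i * θ) := by
    intro θ
    have e1 : ∀ i : ℤ, (convOn d S f i : ℂ) * Complex.exp (Complex.I * i * θ)
        = ∑ k ∈ S, ((d (i - k) : ℂ) * Complex.exp (Complex.I * ((i - k : ℤ) : ℂ) * θ)) *
          ((f k : ℂ) * Complex.exp (Complex.I * k * θ)) := by
      intro i
      rw [convOn]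
      push_cast
      rw [Finset.sum_mul]
      refine Finset.sum_congr rfl fun k _ => ?_
      have : Complex.exp (Complex.I * i * θ)
          = Complex.exp (Complex.I * ((i : ℂ) - k) * θ) * Complex.exp (Complex.I * k * θ) := by
        rw [← Complex.exp_add]; congr 1; ring
      rw [this]; ring
    simp only [e1]
    have hs : ∀ k : ℤ, Summable fun i : ℤ =>
        (d (i - k) : ℂ) * Complex.exp (Complex.I * ((i - k : ℤ) : ℂ) * θ) := fun k =>
      ((Equiv.subRight k).summable_iff (f := fun n : ℤ =>
        (d n : ℂ) * Complex.exp (Complex.I * n * θ))).2 (hDsum θ)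
    rw [Summable.tsum_finsetSum fun k _ => (hs k).mul_right _]
    simp only [hF, Finset.mul_sum]
    refine Finset.sum_congr rfl fun k _ => ?_
    rw [tsum_mul_right]
    congr 1
    exact ((Equiv.subRight k).tsum_eq fun n : ℤ =>
        (d n : ℂ) * Complex.exp (Complex.I * n * θ)).symm
  have hFle : ∀ θ ∈ Set.Icc (0 : ℝ) (2 * Real.pi), ‖F θ‖ ≤ κ⁻¹ * ∑' j, ‖convOn d S f j‖ := by
    intro θ hθ
    have h1 : κ * ‖F θ‖ ≤ ∑' j, ‖convOn d S f j‖ := by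
      calc κ * ‖F θ‖ ≤ ‖D θ‖ * ‖F θ‖ := by
            gcongr
            exact hmin hθ
        _ = ‖∑' i : ℤ, (convOn d S f i : ℂ) * Complex.exp (Complex.I * i * θ)‖ := by
            rw [← norm_mul, hprod]
        _ ≤ ∑' i : ℤ, ‖(convOn d S f i : ℂ) * Complex.exp (Complex.I * i * θ)‖ := by
            apply norm_tsum_le_tsum_norm
            simpa [hnorm] using hgs
        _ = _ := by simp [hnorm]
    rw [inv_mul_eq_div, le_div_iff₀ hκ0]
    linarith
  have hfm : |f m| ≤ κ⁻¹ * ∑' j, ‖convOn d S f j‖ := by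
    have h1 := two_pi_mul_eq_integral S f m hm
    have h2 : ‖(2 * Real.pi : ℂ) * f m‖ ≤ (κ⁻¹ * ∑' j, ‖convOn d S f j‖) * |2 * Real.pi - 0| := by
      rw [h1]
      refine intervalIntegral.norm_integral_le_of_norm_le_const fun θ hθ => ?_
      rw [Set.uIoc_of_le (by positivity)] at hθ
      have hexp : ‖Complex.exp (-(Complex.I * m * θ))‖ = 1 := by
        rw [Complex.norm_exp]; simp
      rw [norm_mul, hexp, mul_one]
      exact hFle θ ⟨hθ.1.le, hθ.2⟩
    have hpi := Real.pi_pos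
    rw [norm_mul, sub_zero, abs_of_pos (by positivity)] at h2
    have h3 : ‖(2 * Real.pi : ℂ)‖ = 2 * Real.pi := by
      simp [abs_of_pos hpi]
    rw [h3, Complex.norm_real, Real.norm_eq_abs] at h2
    nlinarith
  have e : ∑' j, ‖convOn d S f j‖ₑ = ENNReal.ofReal (∑' j, ‖convOn d S f j‖) := by
    rw [ENNReal.ofReal_tsum_of_nonneg (fun _ => norm_nonneg _) hgs]
    simp only [ofReal_norm]
  rw [e, ← ENNReal.ofReal_mul (by positivity), ← ofReal_norm, Real.norm_eq_abs]
  exact ENNReal.ofReal_le_ofReal hfm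

/-- Convolution with `d` is bounded below on sequences of finite support, with a loss that is
polynomial in the size of the support. -/
theorem exists_abs_le_convOn (d : ℤ → ℝ) (hd : ∃ n, d n ≠ 0) (hds : Summable fun n => |d n|)
    (hH2 : (Function.support d).Finite ∨
      ∀ θ ∈ Set.Ico (0 : ℝ) (2 * Real.pi),
        ∑' n : ℤ, (d n : ℂ) * Complex.exp (Complex.I * (n : ℂ) * (θ : ℂ)) ≠ 0) :
    ∃ (c : ℝ) (N : ℕ), 0 < c ∧ ∀ (S : Finset ℤ) (f : ℤ → ℝ), (∀ m ∉ S, f m = 0) →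
      ∀ B : ℝ, (∀ F : Finset ℤ, ∑ i ∈ F, |convOn d S f i| ≤ B) →
        ∀ m, |f m| ≤ c * (S.card : ℝ) ^ N * B := by
  have key : ∃ (c : ENNReal) (N : ℕ), c ≠ ⊤ ∧ ∀ (S : Finset ℤ) (f : ℤ → ℝ), (∀ m ∉ S, f m = 0) →
      ∀ m, ‖f m‖ₑ ≤ c * (S.card : ENNReal) ^ N * ∑' j, ‖convOn d S f j‖ₑ := by
    rcases hH2 with h | h
    · exact exists_abs_le_convOn_of_finite d hd h
    · obtain ⟨c, hc, h'⟩ := exists_abs_le_convOn_of_symbol_ne_zero d hds h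
      exact ⟨c, 0, hc, fun S f hS m => by simpa using h' S f hS m⟩
  obtain ⟨c, N, hc, h⟩ := key
  refine ⟨c.toReal + 1, N, by positivity, fun S f hS B hB m => ?_⟩
  have hB0 : 0 ≤ B := by simpa using hB ∅
  have h1 : ∑' j, ‖convOn d S f j‖ₑ ≤ ENNReal.ofReal B := by
    rw [ENNReal.tsum_eq_iSup_sum]
    refine iSup_le fun F => ?_
    have : ∑ i ∈ F, ‖convOn d S f i‖ₑ = ENNReal.ofReal (∑ i ∈ F, |convOn d S f i|) := by
      rw [ENNReal.ofReal_sum_of_nonneg fun _ _ => abs_nonneg _]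
      simp [← ofReal_norm]
    rw [this]
    exact ENNReal.ofReal_le_ofReal (hB F)
  have h2 : ‖f m‖ₑ ≤ ENNReal.ofReal (c.toReal * (S.card : ℝ) ^ N * B) := by
    refine (h S f hS m).trans ?_
    rw [ENNReal.ofReal_mul (by positivity), ENNReal.ofReal_mul (by positivity),
      ENNReal.ofReal_toReal hc, ENNReal.ofReal_pow (by positivity), ENNReal.ofReal_natCast]
    gcongr
  rw [← ofReal_norm, Real.norm_eq_abs, ENNReal.ofReal_le_ofReal_iff (by positivity)] at h2
  refine h2.trans ?_
  gcongr
  linarith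

/-! ### Spectral decomposition of symmetric matrices -/

/-- An orthonormal eigenbasis of a real symmetric matrix, in coordinates. -/
structure EigenData {n : Type*} [Fintype n] [DecidableEq n] (M : Matrix n n ℝ) where
  val : n → ℝ
  vec : n → n → ℝ
  orth : ∀ j k, ∑ x, vec j x * vec k x = if j = k then 1 else 0
  complete : ∀ x y, ∑ j, vec j x * vec j y = if x = y then 1 else 0
  cfc_apply : ∀ (f : ℝ → ℝ) x y, cfc f M x y = ∑ j, f (val j) * vec j x * vec j y
  mulVec_vec : ∀ j, M.mulVec (vec j) = val j • vec j
  mem_spectrum : ∀ t, t ∈ spectrum ℝ M ↔ ∃ j, val j = t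

theorem exists_eigenData {n : Type*} [Fintype n] [DecidableEq n] (M : Matrix n n ℝ)
    (hM : IsSelfAdjoint M) : Nonempty (EigenData M) := by
  have hH : M.IsHermitian := hM
  refine ⟨⟨hH.eigenvalues, fun j x => hH.eigenvectorBasis j x, ?_, ?_, ?_, ?_, ?_⟩⟩
  · intro j k
    have := orthonormal_iff_ite.1 hH.eigenvectorBasis.orthonormal j k
    rw [← this, PiLp.inner_apply]
    simp [mul_comm]
  · intro x y
    have h1 : (hH.eigenvectorUnitary : Matrix n n ℝ) * star (hH.eigenvectorUnitary : Matrix n n ℝ)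
        = 1 := by simp
    have h2 := congrFun (congrFun h1 x) y
    rw [Matrix.mul_apply, Matrix.one_apply] at h2
    rw [← h2]
    simp [Matrix.star_apply, Matrix.IsHermitian.eigenvectorUnitary_apply]
  · intro f x y
    rw [hH.cfc_eq, Matrix.IsHermitian.cfc, Unitary.conjStarAlgAut_apply, Matrix.mul_apply]
    refine Finset.sum_congr rfl fun j _ => ?_
    rw [Matrix.mul_diagonal]
    simp [Matrix.star_apply, Matrix.IsHermitian.eigenvectorUnitary_apply]
    left; ring
  · intro j
    exact hH.mulVec_eigenvectorBasis j
  · intro t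
    rw [hH.spectrum_real_eq_range_eigenvalues]
    rfl

namespace EigenData

variable {n : Type*} [Fintype n] [DecidableEq n] {M : Matrix n n ℝ}

/-- Parseval's identity for functions of a symmetric matrix given by their spectral sums. -/
theorem sum_sq (d : EigenData M) (c : n → ℝ) :
    ∑ x, (∑ j, c j * d.vec j x) ^ 2 = ∑ j, c j ^ 2 := by
  have h1 : ∀ x, (∑ j, c j * d.vec j x) ^ 2
      = ∑ j, ∑ k, c j * c k * (d.vec j x * d.vec k x) := by
    intro x
    rw [sq, Finset.sum_mul_sum]
    refine Finset.sum_congr rfl fun j _ => Finset.sum_congr rfl fun k _ => by ring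
  simp only [h1]
  rw [Finset.sum_comm]
  refine Finset.sum_congr rfl fun j _ => ?_
  rw [Finset.sum_comm]
  simp only [← Finset.mul_sum, d.orth]
  simp [sq]

theorem eq_sum (d : EigenData M) (u : n → ℝ) (x : n) :
    u x = ∑ j, (∑ y, d.vec j y * u y) * d.vec j x := by
  simp only [Finset.sum_mul]
  rw [Finset.sum_comm]
  have : ∀ y, ∑ j, d.vec j y * u y * d.vec j x = u y * if y = x then 1 else 0 := by
    intro y
    rw [← d.complete, Finset.mul_sum]
    refine Finset.sum_congr rfl fun j _ => by ring
  simp [this]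

/-- If every eigenvalue of `M` is at distance at least `κ` from `β`, then `M - β` expands by `κ`. -/
theorem sq_mul_le (d : EigenData M) (β κ : ℝ) (hκ : ∀ j, κ ^ 2 ≤ (d.val j - β) ^ 2)
    (u : n → ℝ) : κ ^ 2 * ∑ x, u x ^ 2 ≤ ∑ x, ((M.mulVec u) x - β * u x) ^ 2 := by
  set c : n → ℝ := fun j => ∑ y, d.vec j y * u y with hc
  have hu : ∀ x, u x = ∑ j, c j * d.vec j x := d.eq_sum u
  have hu' : u = ∑ j, c j • d.vec j := by
    funext x; rw [hu x]; simp
  have h1 : ∀ x, (M.mulVec u) x - β * u x = ∑ j, ((d.val j - β) * c j) * d.vec j x := by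
    intro x
    have e1 : (M.mulVec u) x = ∑ j, d.val j * c j * d.vec j x := by
      rw [hu', Matrix.mulVec_sum, Finset.sum_apply]
      refine Finset.sum_congr rfl fun j _ => ?_
      rw [Matrix.mulVec_smul, d.mulVec_vec]
      simp; ring
    rw [e1, hu x, Finset.mul_sum, ← Finset.sum_sub_distrib]
    refine Finset.sum_congr rfl fun j _ => by ring
  simp only [h1]
  rw [d.sum_sq]
  have h2 : ∑ x, u x ^ 2 = ∑ j, c j ^ 2 := by
    rw [← d.sum_sq c]
    exact Finset.sum_congr rfl fun x _ => by rw [hu x]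
  rw [h2, Finset.mul_sum]
  refine Finset.sum_le_sum fun j _ => ?_
  rw [mul_pow]
  exact mul_le_mul_of_nonneg_right (hκ j) (sq_nonneg _)

end EigenData

/-! ### The distance from an energy to the spectrum, along a two-parameter family -/

section Area

variable {n : Type*} [Fintype n] [DecidableEq n]

set_option linter.unusedSectionVars false

theorem mem_spectrum_iff_det (M : Matrix n n ℝ) (t : ℝ) :
    t ∈ spectrum ℝ M ↔ (M - t • (1 : Matrix n n ℝ)).det = 0 := by
  rw [spectrum.mem_iff, Matrix.isUnit_iff_isUnit_det, isUnit_iff_ne_zero, not_not,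
    Algebra.algebraMap_eq_smul_one, ← neg_sub M, Matrix.det_neg]
  simp

theorem mem_spectrum_of_mulVec (M : Matrix n n ℝ) (t : ℝ) (u : n → ℝ) (hu : ∑ x, u x ^ 2 = 1)
    (h : M.mulVec u = t • u) : t ∈ spectrum ℝ M := by
  rw [mem_spectrum_iff_det, ← Matrix.exists_mulVec_eq_zero_iff]
  refine ⟨u, ?_, ?_⟩
  · rintro rfl; simp at hu
  · rw [Matrix.sub_mulVec, h, Matrix.smul_mulVec, Matrix.one_mulVec, sub_self]

/-- Together with the case of equality in `exists_infDist_spectrum_eq`, this characterizes the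
distance to the spectrum variationally. The distance then serves as a substitute for an eigenvalue
branch, with no need to follow eigenvalues through crossings. -/
theorem infDist_spectrum_sq_le [Nonempty n] (M : Matrix n n ℝ) (hM : IsSelfAdjoint M) (β : ℝ)
    (u : n → ℝ) : Metric.infDist β (spectrum ℝ M) ^ 2 * ∑ x, u x ^ 2
      ≤ ∑ x, ((M.mulVec u) x - β * u x) ^ 2 := by
  obtain ⟨d⟩ := exists_eigenData M hM
  refine d.sq_mul_le β _ (fun j => ?_) u
  have h1 : Metric.infDist β (spectrum ℝ M) ≤ dist β (d.val j) :=
    Metric.infDist_le_dist_of_mem ((d.mem_spectrum _).2 ⟨j, rfl⟩)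
  rw [Real.dist_eq, abs_sub_comm] at h1
  rw [← sq_abs (d.val j - β)]
  have := Metric.infDist_nonneg (x := β) (s := spectrum ℝ M)
  gcongr

theorem exists_infDist_spectrum_eq [Nonempty n] (M : Matrix n n ℝ) (hM : IsSelfAdjoint M) (β : ℝ) :
    ∃ (t : ℝ) (u : n → ℝ), ∑ x, u x ^ 2 = 1 ∧ M.mulVec u = t • u ∧
      |t - β| = Metric.infDist β (spectrum ℝ M) := by
  obtain ⟨d⟩ := exists_eigenData M hM
  have hr : spectrum ℝ M = Set.range d.val := by
    ext t; rw [d.mem_spectrum]; rfl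
  have hfin : (spectrum ℝ M).Finite := by rw [hr]; exact Set.finite_range _
  obtain ⟨t, ht, h⟩ := hfin.isCompact.exists_infDist_eq_dist
    (by rw [hr]; exact Set.range_nonempty _) β
  obtain ⟨j, rfl⟩ := (d.mem_spectrum t).1 ht
  refine ⟨d.val j, d.vec j, ?_, d.mulVec_vec j, ?_⟩
  · have := d.orth j j
    simpa [sq] using this
  · rw [h, Real.dist_eq, abs_sub_comm]

/-- The affine two-parameter family of matrices with diagonal perturbations. -/
def diagFamily (H : Matrix n n ℝ) (α b : n → ℝ) (p : Fin 2 → ℝ) : Matrix n n ℝ :=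
  H + p 0 • Matrix.diagonal α + p 1 • Matrix.diagonal b

theorem diagFamily_isSelfAdjoint (H : Matrix n n ℝ) (hH : IsSelfAdjoint H) (α b : n → ℝ)
    (p : Fin 2 → ℝ) : IsSelfAdjoint (diagFamily H α b p) := by
  have hd : ∀ c : n → ℝ, IsSelfAdjoint (Matrix.diagonal c) := fun c =>
    Matrix.isHermitian_diagonal c
  exact (hH.add ((IsSelfAdjoint.all (p 0)).smul (hd α))).add ((IsSelfAdjoint.all (p 1)).smul (hd b))

theorem diagFamily_mulVec_apply (H : Matrix n n ℝ) (α b : n → ℝ) (p : Fin 2 → ℝ) (u : n → ℝ)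
    (x : n) : (diagFamily H α b p).mulVec u x = H.mulVec u x + (p 0 * α x + p 1 * b x) * u x := by
  simp [diagFamily, Matrix.add_mulVec, Matrix.smul_mulVec, Matrix.mulVec_diagonal]
  ring

/-- Test the matrix at `p` with the optimal eigenvector at `q`. The Lipschitz bound is what gives
differentiability almost everywhere, by Rademacher's theorem. -/
theorem lipschitz_infDist_diagFamily [Nonempty n] (H : Matrix n n ℝ) (hH : IsSelfAdjoint H)
    (α b : n → ℝ) (β : ℝ) :
    ∃ C, LipschitzWith C fun p => Metric.infDist β (spectrum ℝ (diagFamily H α b p)) := by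
  set c : ℝ := ∑ x, (|α x| + |b x|) with hc
  have hc0 : 0 ≤ c := Finset.sum_nonneg fun x _ => by positivity
  refine ⟨⟨c, hc0⟩, LipschitzWith.of_le_add_mul _ fun p q => ?_⟩
  obtain ⟨t, u, hu, hev, ht⟩ := exists_infDist_spectrum_eq _ (diagFamily_isSelfAdjoint H hH α b q) β
  rw [← ht]
  have h1 := infDist_spectrum_sq_le _ (diagFamily_isSelfAdjoint H hH α b p) β u
  rw [hu, mul_one] at h1
  set v : n → ℝ := fun x => ((p 0 - q 0) * α x + (p 1 - q 1) * b x) with hv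
  have h2 : ∀ x, (diagFamily H α b p).mulVec u x - β * u x = (t - β) * u x + v x * u x := by
    intro x
    have e := congrFun hev x
    rw [diagFamily_mulVec_apply] at e ⊢
    simp only [Pi.smul_apply, smul_eq_mul] at e
    simp only [hv]
    linear_combination e
  have hvx : ∀ x, |v x| ≤ c * dist p q := by
    intro x
    have d0 : |p 0 - q 0| ≤ dist p q := by rw [← Real.dist_eq]; exact dist_le_pi_dist p q 0
    have d1 : |p 1 - q 1| ≤ dist p q := by rw [← Real.dist_eq]; exact dist_le_pi_dist p q 1
    have hx : |α x| + |b x| ≤ c :=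
      Finset.single_le_sum (f := fun x => |α x| + |b x|) (fun x _ => by positivity)
        (Finset.mem_univ x)
    calc |v x| ≤ |p 0 - q 0| * |α x| + |p 1 - q 1| * |b x| := by
          rw [← abs_mul, ← abs_mul]; exact abs_add_le _ _
      _ ≤ dist p q * |α x| + dist p q * |b x| := by gcongr
      _ = (|α x| + |b x|) * dist p q := by ring
      _ ≤ _ := by gcongr
  have h3 : Metric.infDist β (spectrum ℝ (diagFamily H α b p)) ^ 2
      ≤ (|t - β| + c * dist p q) ^ 2 := by
    refine h1.trans ?_
    calc _ ≤ ∑ x, (|t - β| + c * dist p q) ^ 2 * u x ^ 2 := by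
          refine Finset.sum_le_sum fun x _ => ?_
          rw [h2, ← add_mul, mul_pow]
          refine mul_le_mul_of_nonneg_right ?_ (sq_nonneg _)
          rw [← sq_abs (t - β + v x)]
          have := abs_add_le (t - β) (v x)
          gcongr
          exact this.trans (by linarith [hvx x])
      _ = _ := by rw [← Finset.mul_sum, hu, mul_one]
  exact abs_le_of_sq_le_sq' h3 (by positivity) |>.2

/-- The first-order perturbation formula for the distance from `β` to the spectrum, at a point of
differentiability where the distance is realized by an eigenvalue above `β`. -/
theorem fderiv_infDist_diagFamily [Nonempty n] (H : Matrix n n ℝ) (hH : IsSelfAdjoint H)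
    (α b : n → ℝ) (β : ℝ) (p : Fin 2 → ℝ)
    (hdiff : DifferentiableAt ℝ (fun p => Metric.infDist β (spectrum ℝ (diagFamily H α b p))) p)
    (e : ℝ) (u : n → ℝ) (hu : ∑ x, u x ^ 2 = 1) (hev : (diagFamily H α b p).mulVec u = e • u)
    (hβ : β < e) (he : Metric.infDist β (spectrum ℝ (diagFamily H α b p)) = e - β)
    (w : Fin 2 → ℝ) :
    fderiv ℝ (fun p => Metric.infDist β (spectrum ℝ (diagFamily H α b p))) p w
      = w 0 * ∑ x, α x * u x ^ 2 + w 1 * ∑ x, b x * u x ^ 2 := by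
  set D := fun p => Metric.infDist β (spectrum ℝ (diagFamily H α b p)) with hD
  -- The sum is the squared length of `(M - β) u` for the matrix `M` at `p + t w`, with the
  -- eigenvector `u` frozen at `t = 0`. By the variational inequality `φ` is non-negative, and it
  -- vanishes at `0`; so its derivative there is zero. This is the first-order formula, without
  -- assuming the eigenvalue simple.
  set φ : ℝ → ℝ := fun t => ∑ x, ((e - β) * u x + t * ((w 0 * α x + w 1 * b x) * u x)) ^ 2
    - D (p + t • w) ^ 2 with hφ
  have hφ0 : φ 0 = 0 := by
    simp only [hφ, zero_mul, add_zero, zero_smul, hD, he, mul_pow, ← Finset.mul_sum, hu]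
    ring
  have hφnn : ∀ t, 0 ≤ φ t := by
    intro t
    have h1 := infDist_spectrum_sq_le _ (diagFamily_isSelfAdjoint H hH α b (p + t • w)) β u
    rw [hu, mul_one] at h1
    refine sub_nonneg.2 (h1.trans (le_of_eq (Finset.sum_congr rfl fun x _ => ?_)))
    congr 1
    have e1 := congrFun hev x
    rw [diagFamily_mulVec_apply] at e1 ⊢
    simp only [Pi.smul_apply, smul_eq_mul, Pi.add_apply] at e1 ⊢
    linear_combination e1
  have hDd : HasDerivAt (fun t : ℝ => D (p + t • w)) (fderiv ℝ D p w) 0 := by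
    have h1 : HasDerivAt (fun t : ℝ => p + t • w) w 0 := by
      simpa using ((hasDerivAt_id (0 : ℝ)).smul_const w).const_add p
    have h2 : HasFDerivAt D (fderiv ℝ D p) (p + (0 : ℝ) • w) := by
      simpa using hdiff.hasFDerivAt
    exact h2.comp_hasDerivAt (0 : ℝ) h1
  have hsum : HasDerivAt (fun t : ℝ => ∑ x, ((e - β) * u x + t * ((w 0 * α x + w 1 * b x) * u x)) ^ 2)
      (∑ x, 2 * ((e - β) * u x) * ((w 0 * α x + w 1 * b x) * u x)) 0 := by
    refine HasDerivAt.fun_sum fun x _ => ?_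
    have h1 : HasDerivAt (fun t : ℝ => (e - β) * u x + t * ((w 0 * α x + w 1 * b x) * u x))
        ((w 0 * α x + w 1 * b x) * u x) 0 := by
      simpa using ((hasDerivAt_id (0 : ℝ)).mul_const ((w 0 * α x + w 1 * b x) * u x)).const_add
        ((e - β) * u x)
    simpa using h1.fun_pow 2
  have hφd : HasDerivAt φ (∑ x, 2 * ((e - β) * u x) * ((w 0 * α x + w 1 * b x) * u x)
      - 2 * (e - β) * fderiv ℝ D p w) 0 := by
    have h2 := hDd.fun_pow 2
    have h3 : D (p + (0 : ℝ) • w) = e - β := by simp [hD, he]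
    rw [h3] at h2
    have h4 := hsum.fun_sub h2
    simpa using h4
  have hmin : IsLocalMin φ 0 := Filter.Eventually.of_forall fun t => by rw [hφ0]; exact hφnn t
  have h0 := hmin.hasDerivAt_eq_zero hφd
  have hpos : 0 < e - β := sub_pos.2 hβ
  have h5 : ∑ x, 2 * ((e - β) * u x) * ((w 0 * α x + w 1 * b x) * u x)
      = 2 * (e - β) * (w 0 * ∑ x, α x * u x ^ 2 + w 1 * ∑ x, b x * u x ^ 2) := by
    rw [Finset.mul_sum, Finset.mul_sum, ← Finset.sum_add_distrib, Finset.mul_sum]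
    refine Finset.sum_congr rfl fun x _ => by ring
  rw [h5, ← mul_sub] at h0
  rcases mul_eq_zero.1 h0 with h | h
  · linarith
  · linarith

end Area

/-! ### The area formula with multiplicity -/

section Multiplicity

variable {E : Type*} [NormedAddCommGroup E] [NormedSpace ℝ E] [FiniteDimensional ℝ E]
  [MeasurableSpace E] [BorelSpace E] (μ : Measure E) [μ.IsAddHaarMeasure]

/-- The area formula with multiplicity, for pieces on which the maps are injective. -/
theorem measure_iUnion_le_of_injOn (Q : ℕ → Set E) (hQ : ∀ k, MeasurableSet (Q k))
    (G : ℕ → E → E) (G' : ℕ → E → E →L[ℝ] E)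
    (hG : ∀ k, ∀ p ∈ Q k, HasFDerivAt (G k) (G' k p) p) (hinj : ∀ k, Set.InjOn (G k) (Q k))
    (δ : ENNReal) (hδ : ∀ k, ∀ p ∈ Q k, δ ≤ ENNReal.ofReal |(G' k p).det|)
    (T : Set E) (hT : MeasurableSet T) (hGT : ∀ k, ∀ p ∈ Q k, G k p ∈ T) (N : ℕ)
    (hfib : ∀ᵐ t ∂μ, ∃ s : Finset E, s.card ≤ N ∧ ∀ k, ∀ p ∈ Q k, G k p = t → p ∈ s) :
    δ * μ (⋃ k, Q k) ≤ N * μ T := by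
  -- On disjoint pieces, the number of images that cover a point `t` is at most the number of points
  -- in the fibre over `t`.
  set R := disjointed Q with hR
  have hRQ : ∀ k, R k ⊆ Q k := fun k => disjointed_subset Q k
  have hRm : ∀ k, MeasurableSet (R k) := fun k => MeasurableSet.disjointed hQ k
  have hRd : Pairwise (Function.onFun Disjoint R) := disjoint_disjointed Q
  have hmeas : ∀ k, MeasurableSet (G k '' R k) := fun k =>
    measurable_image_of_fderivWithin (hRm k)
      (fun p hp => (hG k p (hRQ k hp)).hasFDerivWithinAt) ((hinj k).mono (hRQ k))
  have h1 : ∀ k, δ * μ (R k) ≤ μ (G k '' R k) := by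
    intro k
    rw [← lintegral_abs_det_fderiv_eq_addHaar_image μ (hRm k)
      (fun p hp => (hG k p (hRQ k hp)).hasFDerivWithinAt) ((hinj k).mono (hRQ k)),
      ← setLIntegral_const]
    exact setLIntegral_mono' (hRm k) fun p hp => hδ k p (hRQ k hp)
  calc δ * μ (⋃ k, Q k) = δ * μ (⋃ k, R k) := by rw [hR, iUnion_disjointed]
    _ = ∑' k, δ * μ (R k) := by rw [measure_iUnion hRd hRm, ENNReal.tsum_mul_left]
    _ ≤ ∑' k, μ (G k '' R k) := ENNReal.tsum_le_tsum h1
    _ = ∑' k, ∫⁻ t, (G k '' R k).indicator 1 t ∂μ := by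
        congr 1; funext k; rw [lintegral_indicator_one (hmeas k)]
    _ = ∫⁻ t, ∑' k, (G k '' R k).indicator 1 t ∂μ := by
        rw [lintegral_tsum fun k => (measurable_one.indicator (hmeas k)).aemeasurable]
    _ ≤ ∫⁻ t, T.indicator (fun _ => (N : ENNReal)) t ∂μ := by
        refine lintegral_mono_ae ?_
        filter_upwards [hfib] with t ht
        obtain ⟨s, hs, hfs⟩ := ht
        by_cases htT : t ∈ T
        · rw [Set.indicator_of_mem htT, ENNReal.tsum_eq_iSup_sum]
          refine iSup_le fun F => ?_
          classical
          rw [Finset.sum_indicator_eq_sum_filter F (fun _ => (1 : E → ENNReal))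
            (fun k => G k '' R k) (fun _ => t)]
          simp only [Pi.one_apply, Finset.sum_const, nsmul_eq_mul, mul_one, Nat.cast_le]
          refine le_trans ?_ hs
          have hex : ∀ k, t ∈ G k '' R k → ∃ p ∈ R k, G k p = t := fun k h => h
          choose! P hP using hex
          -- Each piece whose image contains `t` is sent to a preimage of `t` in it; disjointness
          -- makes this assignment injective.
          refine Finset.card_le_card_of_injOn P (fun k hk => ?_) fun k hk k' hk' hkk => ?_
          · have := hP k (Finset.mem_filter.1 hk).2
            exact hfs k _ (hRQ k this.1) this.2
          · by_contra hne
            have a1 := (hP k (Finset.mem_filter.1 hk).2).1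
            have a2 := (hP k' (Finset.mem_filter.1 hk').2).1
            rw [hkk] at a1
            exact Set.disjoint_left.1 (hRd hne) a1 a2
        · rw [Set.indicator_of_notMem htT]
          refine le_of_eq (ENNReal.tsum_eq_zero.2 fun k => Set.indicator_of_notMem ?_ _)
          rintro ⟨p, hp, rfl⟩
          exact htT (hGT k p (hRQ k hp))
    _ = N * μ T := by rw [lintegral_indicator_const hT]

/-- The area formula with multiplicity. -/
theorem measure_iUnion_le_of_multiplicity {ι : Type*} [Countable ι] [Nonempty ι] (A : ι → Set E)
    (hA : ∀ i, MeasurableSet (A i)) (F : ι → E → E) (F' : ι → E → E →L[ℝ] E)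
    (hF : ∀ i, ∀ p ∈ A i, HasFDerivAt (F i) (F' i p) p)
    (δ : ENNReal) (hδ0 : δ ≠ 0) (hδ : ∀ i, ∀ p ∈ A i, δ ≤ ENNReal.ofReal |(F' i p).det|)
    (T : Set E) (hT : MeasurableSet T) (hFT : ∀ i, ∀ p ∈ A i, F i p ∈ T) (N : ℕ)
    (hfib : ∀ᵐ t ∂μ, ∃ s : Finset E, s.card ≤ N ∧ ∀ i, ∀ p ∈ A i, F i p = t → p ∈ s) :
    δ * μ (⋃ i, A i) ≤ N * μ T := by
  classical
  -- Near an invertible linear map, an approximation to within half of the inverse norm of the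
  -- inverse is injective. The determinants being bounded below, the domain is cut into countably
  -- many such pieces.
  have hex : ∀ B : E →L[ℝ] E, ∃ r : NNReal, r ≠ 0 ∧
      (B.det ≠ 0 → ∀ (f : E → E) (s : Set E), ApproximatesLinearOn f B s r → Set.InjOn f s) := by
    intro B
    by_cases hB : B.det = 0
    · exact ⟨1, one_ne_zero, fun h => absurd hB h⟩
    · set B' : E ≃L[ℝ] E := B.toContinuousLinearEquivOfDetNeZero hB with hB'
      have hBB : (B' : E →L[ℝ] E) = B := by
        rw [hB']; exact B.coe_toContinuousLinearEquivOfDetNeZero hB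
      rcases subsingleton_or_nontrivial E with hE | hE
      · exact ⟨1, one_ne_zero, fun _ f s _ x _ y _ _ => Subsingleton.elim x y⟩
      have hpos : 0 < ‖(B'.symm : E →L[ℝ] E)‖₊ := by
        rw [pos_iff_ne_zero, Ne, nnnorm_eq_zero]
        intro h0
        obtain ⟨x, hx⟩ := exists_ne (0 : E)
        have : B'.symm (B' x) = 0 := by
          have := congrArg (fun L : E →L[ℝ] E => L (B' x)) h0
          simpa using this
        exact hx (by simpa using this)
      refine ⟨‖(B'.symm : E →L[ℝ] E)‖₊⁻¹ / 2, by positivity, fun _ f s hf => ?_⟩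
      rw [← hBB] at hf
      exact hf.injOn (Or.inr (NNReal.half_lt_self (inv_pos.2 hpos).ne'))
  choose r hr0 hr using hex
  have hpart := fun i => exists_partition_approximatesLinearOn_of_hasFDerivWithinAt (F i) (A i)
    (F' i) (fun p hp => (hF i p hp).hasFDerivWithinAt) r hr0
  choose t B htd htm hcov happ hB using hpart
  obtain ⟨e, he⟩ := exists_surjective_nat (ι × ℕ)
  have hinj : ∀ k, Set.InjOn (F (e k).1) (A (e k).1 ∩ t (e k).1 (e k).2) := by
    intro k
    rcases (A (e k).1).eq_empty_or_nonempty with h0 | h0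
    · rw [h0, Set.empty_inter]; exact Set.injOn_empty _
    · refine hr _ ?_ _ _ (happ (e k).1 (e k).2)
      obtain ⟨y, hy, hy'⟩ := hB (e k).1 h0 (e k).2
      rw [hy']
      intro h
      have := hδ _ y hy
      rw [h] at this
      simp at this
      exact hδ0 this
  have := measure_iUnion_le_of_injOn μ (fun k => A (e k).1 ∩ t (e k).1 (e k).2)
    (fun k => (hA _).inter (htm _ _)) (fun k => F (e k).1) (fun k => F' (e k).1)
    (fun k p hp => hF _ p hp.1) hinj δ (fun k p hp => hδ _ p hp.1) T hT
    (fun k p hp => hFT _ p hp.1) N (by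
      filter_upwards [hfib] with t ⟨s, hs, h⟩
      exact ⟨s, hs, fun k p hp => h _ p hp.1⟩)
  refine le_trans ?_ this
  gcongr
  intro p hp
  obtain ⟨i, hi⟩ := Set.mem_iUnion.1 hp
  obtain ⟨m, hm⟩ := Set.mem_iUnion.1 (hcov i hi)
  obtain ⟨k, hk⟩ := he (i, m)
  refine Set.mem_iUnion.2 ⟨k, ?_⟩
  rw [hk]
  exact ⟨hi, hm⟩

end Multiplicity

/-! ### Counting the parameters with two prescribed eigenvalues -/

section Fibre

open Polynomial

theorem exists_polynomial_det {m : Type*} [Fintype m] [DecidableEq m] (A B : Matrix m m ℝ) :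
    ∃ p : ℝ[X], p.natDegree ≤ Fintype.card m ∧ (∀ x, p.eval x = (x • A + B).det) ∧
      p.coeff (Fintype.card m) = A.det := by
  refine ⟨_, natDegree_det_X_add_C_le A B, fun x => ?_, coeff_det_X_add_C_card A B⟩
  rw [← coe_evalRingHom, RingHom.map_det]
  congr 1
  ext i j
  simp
  ring

variable {n : Type*} [Fintype n] [DecidableEq n]

open scoped Kronecker in
/-- The eliminant of the two-parameter eigenvalue problem `(P + y B) u = 0`, `(Q + y B) v = 0`. -/
theorem det_kronecker_eq_zero (P Q B : Matrix n n ℝ) (y : ℝ) (hP : (P + y • B).det = 0)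
    (hQ : (Q + y • B).det = 0) : (P ⊗ₖ B - B ⊗ₖ Q).det = 0 := by
  obtain ⟨u, hu, hu'⟩ := Matrix.exists_mulVec_eq_zero_iff.2 hP
  obtain ⟨v, hv, hv'⟩ := Matrix.exists_mulVec_eq_zero_iff.2 hQ
  have tensor : ∀ (X Y : Matrix n n ℝ) (i j : n),
      (X ⊗ₖ Y).mulVec (fun q => u q.1 * v q.2) (i, j) = X.mulVec u i * Y.mulVec v j := by
    intro X Y i j
    simp only [Matrix.mulVec, dotProduct, Matrix.kroneckerMap_apply, Fintype.sum_prod_type]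
    rw [Finset.sum_mul_sum]
    refine Finset.sum_congr rfl fun a _ => Finset.sum_congr rfl fun b _ => by ring
  rw [← Matrix.exists_mulVec_eq_zero_iff]
  -- On `u ⊗ v` both terms are equal to `-y (B u ⊗ B v)`, so that the unknown `y` is eliminated.
  refine ⟨fun q => u q.1 * v q.2, ?_, ?_⟩
  · obtain ⟨i, hi⟩ := Function.ne_iff.1 hu
    obtain ⟨j, hj⟩ := Function.ne_iff.1 hv
    exact Function.ne_iff.2 ⟨(i, j), mul_ne_zero hi hj⟩
  · funext ⟨i, j⟩
    rw [Matrix.sub_mulVec, Pi.sub_apply, tensor, tensor]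
    have e1 := congrFun hu' i
    have e2 := congrFun hv' j
    simp only [Matrix.add_mulVec, Matrix.smul_mulVec, Pi.add_apply, Pi.smul_apply, smul_eq_mul,
      Pi.zero_apply] at e1 e2 ⊢
    linear_combination (B.mulVec v j) * e1 - (B.mulVec u i) * e2

-- For fixed `t 0` the determinant is a polynomial in `t 1` whose coefficient of top degree is `det
-- (B ⊗ 1)`, a power of `det B`. It has finitely many zeros, and Fubini's theorem concludes.
open scoped Kronecker in
theorem ae_det_kronecker_ne_zero (H B : Matrix n n ℝ) (hB : B.det ≠ 0) :
    ∀ᵐ t : Fin 2 → ℝ, ((H - t 0 • (1 : Matrix n n ℝ)) ⊗ₖ B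
      - B ⊗ₖ (H - t 1 • (1 : Matrix n n ℝ))).det ≠ 0 := by
  set Ψ : ℝ × ℝ → ℝ := fun t => ((H - t.1 • (1 : Matrix n n ℝ)) ⊗ₖ B
      - B ⊗ₖ (H - t.2 • (1 : Matrix n n ℝ))).det with hΨ
  have hc : Continuous Ψ := by
    refine Continuous.matrix_det ?_
    refine continuous_matrix fun i j => ?_
    simp only [Matrix.sub_apply, Matrix.kroneckerMap_apply, Matrix.smul_apply]
    fun_prop
  have hms : MeasurableSet {t | ¬ Ψ t ≠ 0} := by
    have : {t | ¬ Ψ t ≠ 0} = Ψ ⁻¹' {0} := by ext t; simp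
    rw [this]
    exact hc.measurable (measurableSet_singleton 0)
  have h2 : ∀ᵐ t : ℝ × ℝ, Ψ t ≠ 0 := by
    rw [ae_iff]
    change (volume.prod volume) _ = 0
    rw [Measure.measure_prod_null hms]
    refine Filter.Eventually.of_forall fun x => ?_
    obtain ⟨p, -, hp, hcoef⟩ := exists_polynomial_det (B ⊗ₖ (1 : Matrix n n ℝ))
      ((H - x • (1 : Matrix n n ℝ)) ⊗ₖ B - B ⊗ₖ H)
    have hp0 : p ≠ 0 := by
      intro h
      rw [h, coeff_zero, Matrix.det_kronecker] at hcoef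
      have : B.det ^ Fintype.card n ≠ 0 := pow_ne_zero _ hB
      exact this (by simpa using hcoef.symm)
    have hsub : Prod.mk x ⁻¹' {t | ¬ Ψ t ≠ 0} ⊆ (p.roots.toFinset : Set ℝ) := by
      intro y hy
      simp only [Set.mem_preimage, Set.mem_ofPred_eq, not_not] at hy
      simp only [Finset.mem_coe, Multiset.mem_toFinset, mem_roots hp0, IsRoot.def]
      rw [hp, ← hy]
      simp only [hΨ]
      congr 1
      ext i j
      simp [Matrix.kroneckerMap_apply]
      ring
    exact measure_mono_null hsub (Set.Finite.measure_zero (Finset.finite_toSet _) volume)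
  exact (volume_preserving_finTwoArrow ℝ).quasiMeasurePreserving.ae h2

open scoped Kronecker in
/-- For almost every pair of energies, at most `n ^ 3` parameters of the two-parameter family have
both energies as eigenvalues. -/
theorem ae_exists_finset_diagFamily (H : Matrix n n ℝ) (α b : n → ℝ)
    (hb : ∀ x, b x ≠ 0) :
    ∀ᵐ t : Fin 2 → ℝ, ∃ s : Finset (Fin 2 → ℝ), s.card ≤ Fintype.card n ^ 3 ∧
      ∀ p, t 0 ∈ spectrum ℝ (diagFamily H α b p) → t 1 ∈ spectrum ℝ (diagFamily H α b p) →
        p ∈ s := by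
  classical
  set A := Matrix.diagonal α with hA
  set B := Matrix.diagonal b with hB
  have hBd : B.det ≠ 0 := by
    rw [hB, Matrix.det_diagonal]
    exact Finset.prod_ne_zero_iff.2 fun x _ => hb x
  filter_upwards [ae_det_kronecker_ne_zero H B hBd] with t ht
  -- The eliminant `R` in the parameter `p 0` has degree at most `n ^ 2` and `R(0)` is non-zero by
  -- the choice of `t`. Once `p 0` is a root of `R`, the parameter `p 1` is a root of `Y (p 0)`, of
  -- degree at most `n` with leading coefficient `det B`. This gives `n ^ 3`.
  obtain ⟨R, hRdeg, hR, -⟩ := exists_polynomial_det (A ⊗ₖ B - B ⊗ₖ A)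
    ((H - t 0 • (1 : Matrix n n ℝ)) ⊗ₖ B - B ⊗ₖ (H - t 1 • (1 : Matrix n n ℝ)))
  have hR0 : R ≠ 0 := by
    intro h
    have := hR 0
    rw [h, eval_zero, zero_smul, zero_add] at this
    exact ht this.symm
  have hY := fun x : ℝ => exists_polynomial_det B (H - t 0 • (1 : Matrix n n ℝ) + x • A)
  choose Y hYdeg hY hYc using hY
  have hY0 : ∀ x, Y x ≠ 0 := by
    intro x h
    have := hYc x
    rw [h, coeff_zero] at this
    exact hBd this.symm
  refine ⟨R.roots.toFinset.biUnion fun x => (Y x).roots.toFinset.image fun y => ![x, y], ?_, ?_⟩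
  · refine (Finset.card_biUnion_le_card_mul _ _ (Fintype.card n) fun x _ => ?_).trans ?_
    · refine Finset.card_image_le.trans ((Multiset.toFinset_card_le _).trans ?_)
      exact (card_roots' _).trans (hYdeg x)
    · have : R.roots.toFinset.card ≤ Fintype.card n * Fintype.card n := by
        refine (Multiset.toFinset_card_le _).trans ((card_roots' _).trans ?_)
        simpa using hRdeg
      calc _ ≤ (Fintype.card n * Fintype.card n) * Fintype.card n := Nat.mul_le_mul_right _ this
        _ = _ := by ring
  · intro p h0 h1
    rw [mem_spectrum_iff_det] at h0 h1
    have hform : ∀ c : ℝ, diagFamily H α b p - c • (1 : Matrix n n ℝ)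
        = (H - c • (1 : Matrix n n ℝ) + p 0 • A) + p 1 • B := by
      intro c
      rw [diagFamily]; abel
    rw [hform] at h0 h1
    rw [Finset.mem_biUnion]
    refine ⟨p 0, ?_, ?_⟩
    · rw [Multiset.mem_toFinset, mem_roots hR0, IsRoot.def, hR,
        ← det_kronecker_eq_zero _ _ B (p 1) h0 h1]
      congr 1
      ext i j
      simp [Matrix.kroneckerMap_apply]
      ring
    · rw [Finset.mem_image]
      refine ⟨p 1, ?_, ?_⟩
      · rw [Multiset.mem_toFinset, mem_roots (hY0 _), IsRoot.def, hY, ← h0, add_comm]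
      · funext i; fin_cases i <;> rfl

end Fibre

/-! ### Area of the parameters of resonant pairs -/

section Area

variable {n : Type*} [Fintype n] [DecidableEq n]

/-- The symmetric matrix `M` has eigenvalues within `h` of `E` and of `E'`, with unit eigenvectors
whose first-order responses to the diagonal perturbations `α` and `b` have determinant at least
`δ`. -/
def ResonantPair (E E' h δ : ℝ) (α b : n → ℝ) (M : Matrix n n ℝ) : Prop :=
  ∃ (e e' : ℝ) (u v : n → ℝ), ∑ x, u x ^ 2 = 1 ∧ ∑ x, v x ^ 2 = 1 ∧
    M.mulVec u = e • u ∧ M.mulVec v = e' • v ∧ |e - E| ≤ h ∧ |e' - E'| ≤ h ∧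
    δ ≤ |(∑ x, α x * u x ^ 2) * (∑ x, b x * v x ^ 2)
      - (∑ x, b x * u x ^ 2) * (∑ x, α x * v x ^ 2)|

/-- An eigenvalue is the distance from the spectrum to any rational number slightly below it. -/
theorem exists_rat_infDist_spectrum [Nonempty n] (M : Matrix n n ℝ) (e : ℝ)
    (he : e ∈ spectrum ℝ M) :
    ∃ β : ℚ, (β : ℝ) < e ∧ Metric.infDist (β : ℝ) (spectrum ℝ M) = e - β := by
  have hfin : (spectrum ℝ M \ {e}).Finite := (Matrix.finite_real_spectrum).subset Set.sdiff_subset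
  obtain ⟨ε, hε, hball⟩ : ∃ ε > 0, ∀ t ∈ spectrum ℝ M, t ≠ e → ε ≤ |t - e| := by
    have := Metric.mem_nhds_iff.1 (hfin.isClosed.isOpen_compl.mem_nhds (x := e) (by simp))
    obtain ⟨ε, hε, hb⟩ := this
    refine ⟨ε, hε, fun t ht hte => ?_⟩
    by_contra hlt
    push Not at hlt
    exact hb (show t ∈ Metric.ball e ε by rwa [Metric.mem_ball, Real.dist_eq]) ⟨ht, hte⟩
  obtain ⟨β, hβ1, hβ2⟩ := exists_rat_btwn (show e - ε / 2 < e by linarith)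
  refine ⟨β, hβ2, le_antisymm ?_ ?_⟩
  · refine (Metric.infDist_le_dist_of_mem he).trans ?_
    rw [Real.dist_eq, abs_sub_comm, abs_of_pos (by linarith)]
  · refine (Metric.le_infDist ⟨e, he⟩).2 fun t ht => ?_
    rw [Real.dist_eq]
    by_cases hte : t = e
    · rw [hte, abs_sub_comm]; exact le_abs_self _
    · have h1 := hball t ht hte
      have h2 : |t - e| ≤ |(β : ℝ) - t| + |e - β| := by
        rw [abs_sub_comm t e]
        calc |e - t| = |((β : ℝ) - t) + (e - β)| := by ring_nf
          _ ≤ _ := abs_add_le _ _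
      rw [abs_of_pos (show (0 : ℝ) < e - β by linarith)] at h2
      linarith

theorem continuous_diagFamily (H : Matrix n n ℝ) (α b : n → ℝ) : Continuous (diagFamily H α b) := by
  unfold diagFamily
  fun_prop

/-- The area of the parameters for which the two-parameter family has a resonant pair, when one of
the perturbations is invertible. -/
theorem volume_resonantPair_le_of_ne_zero [Nonempty n] (H : Matrix n n ℝ) (hH : IsSelfAdjoint H)
    (α b : n → ℝ) (hb : ∀ x, b x ≠ 0) (E E' h δ : ℝ) (hδ : 0 < δ) :
    ENNReal.ofReal δ * volume {p : Fin 2 → ℝ | ResonantPair E E' h δ α b (diagFamily H α b p)}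
      ≤ (Fintype.card n ^ 3 : ℕ) * ENNReal.ofReal (2 * h) ^ 2 := by
  set D : ℝ → (Fin 2 → ℝ) → ℝ :=
    fun β p => Metric.infDist β (spectrum ℝ (diagFamily H α b p)) with hD
  -- For a rational `β` just below an eigenvalue `e`, one has `e = β + dist(β, spectrum)`. So
  -- countably many Lipschitz maps represent all pairs of eigenvalues, and outside one null set all
  -- of them are differentiable. The sets `A i` keep only the parameters at which both coordinates
  -- of `F i` are eigenvalues, which is what bounds the multiplicity.
  set F : ℚ × ℚ → (Fin 2 → ℝ) → Fin 2 → ℝ :=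
    fun i p => ![(i.1 : ℝ) + D i.1 p, (i.2 : ℝ) + D i.2 p] with hF
  set T : Set (Fin 2 → ℝ) := Set.Icc ![E - h, E' - h] ![E + h, E' + h] with hT
  have hTvol : volume T = ENNReal.ofReal (2 * h) ^ 2 := by
    rw [hT, Real.volume_Icc_pi, Fin.prod_univ_two, sq]
    congr 2 <;> simp <;> ring
  have hDlip : ∀ β, ∃ C, LipschitzWith C (D β) := fun β => lipschitz_infDist_diagFamily H hH α b β
  have hDc : ∀ β, Continuous (D β) := fun β => (hDlip β).choose_spec.continuous
  have hFc : ∀ i, Continuous (F i) := by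
    intro i
    refine continuous_pi fun j => ?_
    fin_cases j
    · exact (hDc _).const_add _
    · exact (hDc _).const_add _
  set A : ℚ × ℚ → Set (Fin 2 → ℝ) := fun i =>
    {p | DifferentiableAt ℝ (F i) p} ∩ ({p | F i p ∈ T} ∩
      ({p | F i p 0 ∈ spectrum ℝ (diagFamily H α b p)} ∩
      ({p | F i p 1 ∈ spectrum ℝ (diagFamily H α b p)} ∩
        {p | ENNReal.ofReal δ ≤ ENNReal.ofReal |(fderiv ℝ (F i) p).det|}))) with hA
  have hspec : ∀ i j, MeasurableSet {p | F i p j ∈ spectrum ℝ (diagFamily H α b p)} := by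
    intro i j
    simp only [mem_spectrum_iff_det]
    refine IsClosed.measurableSet (isClosed_singleton.preimage (f := fun p =>
      (diagFamily H α b p - F i p j • (1 : Matrix n n ℝ)).det) (t := {0}) ?_)
    have h1 := continuous_diagFamily H α b
    have h2 : Continuous fun p => F i p j := (continuous_apply j).comp (hFc i)
    exact Continuous.matrix_det (h1.sub (h2.smul continuous_const))
  have hAm : ∀ i, MeasurableSet (A i) := by
    intro i
    refine (measurableSet_of_differentiableAt ℝ (F i)).inter
      (((hFc i).measurable measurableSet_Icc).inter ((hspec i 0).inter ((hspec i 1).inter ?_)))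
    refine measurableSet_le measurable_const ?_
    exact (ContinuousLinearMap.continuous_det.measurable.comp
      (measurable_fderiv ℝ (F i))).abs.ennreal_ofReal
  have hmain := measure_iUnion_le_of_multiplicity (volume : Measure (Fin 2 → ℝ)) A hAm F
    (fun i => fderiv ℝ (F i)) (fun i p hp => hp.1.hasFDerivAt) (ENNReal.ofReal δ)
    (by simpa using hδ) (fun i p hp => hp.2.2.2.2) T measurableSet_Icc (fun i p hp => hp.2.1)
    (Fintype.card n ^ 3) (by
      filter_upwards [ae_exists_finset_diagFamily H α b hb] with t ⟨s, hs, hps⟩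
      refine ⟨s, hs, fun i p hp hpt => hps p ?_ ?_⟩
      · rw [← hpt]; exact hp.2.2.1
      · rw [← hpt]; exact hp.2.2.2.1)
  rw [hTvol] at hmain
  refine le_trans ?_ hmain
  gcongr ENNReal.ofReal δ * ?_
  have hnull : ∀ᵐ p : Fin 2 → ℝ, ∀ β : ℚ, DifferentiableAt ℝ (D β) p :=
    ae_all_iff.2 fun β => (hDlip β).choose_spec.ae_differentiableAt
  refine measure_mono_ae ?_
  filter_upwards [hnull] with p hp
  rintro ⟨e, e', u, v, hu, hv, hMu, hMv, he, he', hdet⟩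
  obtain ⟨β, hβ, hβe⟩ := exists_rat_infDist_spectrum _ e (mem_spectrum_of_mulVec _ _ u hu hMu)
  obtain ⟨β', hβ', hβe'⟩ := exists_rat_infDist_spectrum _ e' (mem_spectrum_of_mulVec _ _ v hv hMv)
  have hF0 : F (β, β') p = ![e, e'] := by
    simp only [hF, hD, hβe, hβe']
    congr 1
    · ring
    · congr 1; ring
  have hd : HasFDerivAt (F (β, β')) (ContinuousLinearMap.pi
      ![fderiv ℝ (D β) p, fderiv ℝ (D β') p]) p := by
    rw [hasFDerivAt_pi']
    intro j
    fin_cases j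
    · exact (hp β).hasFDerivAt.const_add _
    · exact (hp β').hasFDerivAt.const_add _
  refine Set.mem_iUnion.2 ⟨(β, β'), hd.differentiableAt, ?_, ?_, ?_, ?_⟩
  · change F (β, β') p ∈ T
    rw [hF0, hT, Set.mem_Icc, Pi.le_def, Pi.le_def]
    rw [abs_le] at he he'
    constructor <;> intro j <;> fin_cases j <;> simp <;> linarith
  · change F (β, β') p 0 ∈ spectrum ℝ (diagFamily H α b p)
    rw [hF0]
    exact mem_spectrum_of_mulVec _ _ u hu hMu
  · change F (β, β') p 1 ∈ spectrum ℝ (diagFamily H α b p)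
    rw [hF0]
    exact mem_spectrum_of_mulVec _ _ v hv hMv
  · change ENNReal.ofReal δ ≤ _
    refine ENNReal.ofReal_le_ofReal (hdet.trans (le_of_eq ?_))
    congr 1
    rw [hd.fderiv, ContinuousLinearMap.det, ← LinearMap.det_toMatrix', Matrix.det_fin_two]
    simp only [LinearMap.toMatrix'_apply]
    have f1 := fderiv_infDist_diagFamily H hH α b β p (hp β) e u hu hMu hβ hβe
    have f2 := fderiv_infDist_diagFamily H hH α b β' p (hp β') e' v hv hMv hβ' hβe'
    change _ = fderiv ℝ (D β) p _ * fderiv ℝ (D β') p _ - fderiv ℝ (D β) p _ * fderiv ℝ (D β') p _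
    simp only [hD] at f1 f2 ⊢
    rw [f1, f1, f2, f2]
    simp

/-- The area of the bounded parameters for which the two-parameter family has a resonant pair. -/
theorem volume_resonantPair_le [Nonempty n] (H : Matrix n n ℝ) (hH : IsSelfAdjoint H)
    (α b : n → ℝ) (hb : ∀ x, 0 ≤ b x) (E E' h δ S : ℝ) (hδ : 0 < δ) (hh : 0 < h) :
    volume {p : Fin 2 → ℝ | |p 1| ≤ S ∧ ResonantPair E E' h δ α b (diagFamily H α b p)}
      ≤ ENNReal.ofReal ((Fintype.card n : ℝ) ^ 3 * (32 * h ^ 2 / δ)) := by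
  set a := ∑ x, |α x| with ha
  have ha0 : 0 ≤ a := Finset.sum_nonneg fun x _ => abs_nonneg _
  -- Replacing `b` by `b + ε` makes the perturbation invertible. It shifts the whole spectrum by `ε
  -- * p 1`, at most `h`, and changes the minor by at most `δ / 2`, without changing the
  -- eigenvectors. With `2h` and `δ / 2` the previous bound becomes `n ^ 3 * 32 h ^ 2 / δ`.
  obtain ⟨ε, hε, hε1, hε2⟩ : ∃ ε > 0, ε * (2 * a) ≤ δ / 2 ∧ ε * |S| ≤ h := by
    refine ⟨min (δ / 2 / (2 * a + 1)) (h / (|S| + 1)), by positivity, ?_, ?_⟩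
    · calc _ ≤ δ / 2 / (2 * a + 1) * (2 * a) := by gcongr; exact min_le_left _ _
        _ ≤ δ / 2 / (2 * a + 1) * (2 * a + 1) := by gcongr; linarith
        _ = δ / 2 := by field_simp
    · calc _ ≤ h / (|S| + 1) * |S| := by gcongr; exact min_le_right _ _
        _ ≤ h / (|S| + 1) * (|S| + 1) := by gcongr; linarith
        _ = h := by field_simp
  have hsub : {p : Fin 2 → ℝ | |p 1| ≤ S ∧ ResonantPair E E' h δ α b (diagFamily H α b p)}
      ⊆ {p | ResonantPair E E' (2 * h) (δ / 2) α (fun x => b x + ε)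
        (diagFamily H α (fun x => b x + ε) p)} := by
    rintro p ⟨hp, e, e', u, v, hu, hv, hMu, hMv, he, he', hdet⟩
    have hshift : ∀ (c : ℝ) (z : n → ℝ), (diagFamily H α b p).mulVec z = c • z →
        (diagFamily H α (fun x => b x + ε) p).mulVec z = (c + ε * p 1) • z := by
      intro c z hz
      funext x
      have := congrFun hz x
      rw [diagFamily_mulVec_apply] at this ⊢
      simp only [Pi.smul_apply, smul_eq_mul] at this ⊢
      linear_combination this
    have hsm : |ε * p 1| ≤ h := by
      rw [abs_mul, abs_of_pos hε]
      refine le_trans ?_ hε2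
      exact mul_le_mul_of_nonneg_left (hp.trans (le_abs_self _)) hε.le
    refine ⟨e + ε * p 1, e' + ε * p 1, u, v, hu, hv, hshift _ _ hMu, hshift _ _ hMv, ?_, ?_, ?_⟩
    · rw [abs_le] at he hsm ⊢
      constructor <;> linarith
    · rw [abs_le] at he' hsm ⊢
      constructor <;> linarith
    · have hsum : ∀ z : n → ℝ, ∑ x, z x ^ 2 = 1 →
          ∑ x, (b x + ε) * z x ^ 2 = ∑ x, b x * z x ^ 2 + ε := by
        intro z hz
        simp only [add_mul, Finset.sum_add_distrib, ← Finset.mul_sum, hz, mul_one]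
      rw [hsum u hu, hsum v hv]
      have hbd : ∀ z : n → ℝ, ∑ x, z x ^ 2 = 1 → |∑ x, α x * z x ^ 2| ≤ a := by
        intro z hz
        refine (Finset.abs_sum_le_sum_abs _ _).trans (Finset.sum_le_sum fun x _ => ?_)
        rw [abs_mul, abs_of_nonneg (sq_nonneg (z x))]
        refine mul_le_of_le_one_right (abs_nonneg _) ?_
        rw [← hz]
        exact Finset.single_le_sum (f := fun x => z x ^ 2) (fun _ _ => sq_nonneg _)
          (Finset.mem_univ x)
      set P := ∑ x, α x * u x ^ 2
      set Q := ∑ x, α x * v x ^ 2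
      set P' := ∑ x, b x * u x ^ 2
      set Q' := ∑ x, b x * v x ^ 2
      have h1 : |ε * (P - Q)| ≤ δ / 2 := by
        rw [abs_mul, abs_of_pos hε]
        refine le_trans ?_ hε1
        gcongr
        have := abs_sub P Q
        linarith [hbd u hu, hbd v hv]
      have h2 : P * Q' - P' * Q = (P * (Q' + ε) - (P' + ε) * Q) - ε * (P - Q) := by ring
      rw [h2] at hdet
      have := abs_sub (P * (Q' + ε) - (P' + ε) * Q) (ε * (P - Q))
      linarith
  have h1 := volume_resonantPair_le_of_ne_zero H hH α (fun x => b x + ε)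
    (fun x => by have := hb x; positivity) E E' (2 * h) (δ / 2) (by positivity)
  have hδ2 : ENNReal.ofReal (δ / 2) ≠ 0 := by simpa using hδ
  refine (measure_mono hsub).trans ?_
  rw [mul_comm, ← ENNReal.le_div_iff_mul_le (Or.inl hδ2) (Or.inl ENNReal.ofReal_ne_top)] at h1
  refine h1.trans (le_of_eq ?_)
  rw [← ENNReal.ofReal_natCast, ← ENNReal.ofReal_pow (by positivity),
    ← ENNReal.ofReal_mul (by positivity), ← ENNReal.ofReal_div_of_pos (by positivity)]
  congr 1
  push_cast
  field_simp
  ring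

end Area

/-! ### Conditioning on all but finitely many couplings -/

/-- Independent random variables that are bounded by `S` and whose laws have densities bounded by
`B`. -/
structure BoundedIndep {Ω : Type*} [MeasurableSpace Ω] (P : Measure Ω) (ω : ℤ → Ω → ℝ) (B : NNReal)
    (S : ℝ) : Prop where
  meas : ∀ n, Measurable (ω n)
  indep : iIndepFun ω P
  law_le : ∀ n s, P.map (ω n) s ≤ B * volume s
  bdd : ∀ n w, |ω n w| ≤ S

/-- Comparing on boxes suffices, since `OuterMeasure.pi` is the largest outer measure with the given
bounds on boxes. -/
theorem measure_pi_le_of_le {ι : Type*} [Fintype ι] (μ : ι → Measure ℝ) [∀ i, SigmaFinite (μ i)]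
    (B : NNReal) (h : ∀ i s, μ i s ≤ B * volume s) (s : Set (ι → ℝ)) (hs : MeasurableSet s) :
    Measure.pi μ s ≤ (B : ENNReal) ^ Fintype.card ι * volume s := by
  have hB : ∀ t, (B • (volume : Measure ℝ)) t = B * volume t := fun t => by
    rw [Measure.smul_apply, ENNReal.smul_def, smul_eq_mul]
  have e : Measure.pi (fun _ : ι => B • (volume : Measure ℝ))
      = ((B : ENNReal) ^ Fintype.card ι) • (volume : Measure (ι → ℝ)) := by
    refine Measure.pi_eq fun t _ => ?_
    rw [Measure.smul_apply, volume_pi, Measure.pi_pi]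
    simp only [hB, Finset.prod_mul_distrib, Finset.prod_const, Finset.card_univ, smul_eq_mul]
  have h1 : (Measure.pi μ).toOuterMeasure
      ≤ OuterMeasure.pi fun i : ι => (B • (volume : Measure ℝ)).toOuterMeasure := by
    rw [OuterMeasure.le_pi]
    intro t _
    change Measure.pi μ _ ≤ ∏ i, (B • (volume : Measure ℝ)) (t i)
    rw [Measure.pi_pi]
    refine Finset.prod_le_prod' fun i _ => ?_
    rw [hB]
    exact h i (t i)
  have h2 : Measure.pi (fun _ : ι => B • (volume : Measure ℝ)) s
      = OuterMeasure.pi (fun i : ι => (B • (volume : Measure ℝ)).toOuterMeasure) s := by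
    rw [Measure.pi, toMeasure_apply _ _ hs]
  calc Measure.pi μ s ≤ OuterMeasure.pi (fun i : ι => (B • (volume : Measure ℝ)).toOuterMeasure) s :=
        h1 s
    _ = _ := by rw [← h2, e, Measure.smul_apply, smul_eq_mul]

namespace BoundedIndep

variable {Ω : Type*} [MeasurableSpace Ω] {P : Measure Ω} [IsProbabilityMeasure P]
  {ω : ℤ → Ω → ℝ} {B : NNReal} {S : ℝ}

set_option linter.unusedSectionVars false

open Classical in
/-- The realization with the couplings at the sites of `T` switched off. -/
def restrictCompl (ω : ℤ → Ω → ℝ) (T : Set ℤ) (w : Ω) (n : ℤ) : ℝ :=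
  if n ∈ T then 0 else ω n w

theorem measurable_restrictCompl (hω : BoundedIndep P ω B S) (T : Set ℤ) :
    Measurable (restrictCompl ω T) := by
  refine measurable_pi_iff.2 fun n => ?_
  unfold restrictCompl
  split_ifs
  · exact measurable_const
  · exact hω.meas n

theorem indepFun_restrictCompl (hω : BoundedIndep P ω B S) {ι : Type*} (s : ι → ℤ) :
    IndepFun (fun w k => ω (s k) w) (restrictCompl ω (Set.range s)) P := by
  have h1 := indep_iSup_of_disjoint (m := fun n => MeasurableSpace.comap (ω n) inferInstance)
    (fun n => (hω.meas n).comap_le) hω.indep.iIndep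
    (S := Set.range s) (T := (Set.range s)ᶜ) disjoint_compl_right
  have hle : ∀ (T : Set ℤ) (n : ℤ), n ∈ T → Measurable[⨆ n ∈ T,
      MeasurableSpace.comap (ω n) inferInstance] (ω n) := by
    intro T n hn
    rw [measurable_iff_comap_le]
    exact le_iSup₂ (f := fun (n : ℤ) (_ : n ∈ T) => MeasurableSpace.comap (ω n) inferInstance) n hn
  have h2 : MeasurableSpace.comap (fun w k => ω (s k) w) inferInstance
      ≤ ⨆ n ∈ Set.range s, MeasurableSpace.comap (ω n) inferInstance := by
    rw [← measurable_iff_comap_le]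
    refine @measurable_pi_lambda _ _ _ (_) _ _ fun k => hle _ _ ⟨k, rfl⟩
  have h3 : MeasurableSpace.comap (restrictCompl ω (Set.range s)) inferInstance
      ≤ ⨆ n ∈ (Set.range s)ᶜ, MeasurableSpace.comap (ω n) inferInstance := by
    rw [← measurable_iff_comap_le]
    refine @measurable_pi_lambda _ _ _ (_) _ _ fun n => ?_
    unfold restrictCompl
    by_cases hn : n ∈ Set.range s
    · simp only [hn, if_true]; exact @measurable_const _ _ (_) (_) _
    · simp only [hn, if_false]; exact hle _ _ hn
  exact (IndepFun_iff_Indep _ _ _).2 (indep_of_indep_of_le_left (indep_of_indep_of_le_right h1 h3) h2)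

/-- An event is as likely as the largest volume of its sections in finitely many couplings, up to
the bound on the density. -/
theorem measure_preimage_le (hω : BoundedIndep P ω B S) {ι : Type*} [Fintype ι] (s : ι → ℤ)
    (hs : Function.Injective s) (G : Set ((ι → ℝ) × (ℤ → ℝ))) (hG : MeasurableSet G) (c : ENNReal)
    (hc : ∀ y, volume {x | (x, y) ∈ G} ≤ c) :
    P {w | ((fun k => ω (s k) w), restrictCompl ω (Set.range s) w) ∈ G}
      ≤ (B : ENNReal) ^ Fintype.card ι * c := by
  have hX : Measurable fun w k => ω (s k) w := measurable_pi_iff.2 fun k => hω.meas _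
  have hY := hω.measurable_restrictCompl (Set.range s)
  have hmap := (indepFun_iff_map_prod_eq_prod_map_map hX.aemeasurable hY.aemeasurable).1
    (hω.indepFun_restrictCompl s)
  have hpi := (iIndepFun_iff_map_fun_eq_pi_map (fun k => (hω.meas (s k)).aemeasurable)).1
    (hω.indep.precomp hs)
  have hprob : ∀ k, IsProbabilityMeasure (P.map (ω (s k))) := fun k =>
    Measure.isProbabilityMeasure_map (hω.meas _).aemeasurable
  have hprobY : IsProbabilityMeasure (P.map (restrictCompl ω (Set.range s))) :=
    Measure.isProbabilityMeasure_map hY.aemeasurable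
  have hprobX : IsProbabilityMeasure (P.map fun w k => ω (s k) w) :=
    Measure.isProbabilityMeasure_map hX.aemeasurable
  have e : P {w | ((fun k => ω (s k) w), restrictCompl ω (Set.range s) w) ∈ G}
      = P.map (fun w => ((fun k => ω (s k) w), restrictCompl ω (Set.range s) w)) G :=
    (Measure.map_apply (hX.prodMk hY) hG).symm
  rw [e, hmap, Measure.prod_apply_symm hG]
  calc _ ≤ ∫⁻ _, (B : ENNReal) ^ Fintype.card ι * c
        ∂(P.map (restrictCompl ω (Set.range s))) := by
        refine lintegral_mono fun y => ?_
        have hm : MeasurableSet {x | (x, y) ∈ G} := measurable_prodMk_right hG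
        change (P.map fun w k => ω (s k) w) {x | (x, y) ∈ G} ≤ _
        have hpi' : (P.map fun w k => ω (s k) w) = Measure.pi fun k => P.map (ω (s k)) := hpi
        rw [hpi']
        refine (measure_pi_le_of_le _ B (fun k => hω.law_le (s k)) _ hm).trans ?_
        gcongr
        exact hc y
    _ = _ := by simp

end BoundedIndep

/-! ### The alloy-type potential as a function of the couplings -/

section Alloy

variable (d : ℤ → ℝ)

theorem alloyPotential_eq_tsum (w : ℤ → ℝ) (m : ℤ) :
    alloyPotential d w m = ∑' i, d (i - m) * w i := by
  rw [alloyPotential, ← (Equiv.subRight m).tsum_eq]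
  simp

theorem summable_alloy (hd : Summable fun n => |d n|) (w : ℤ → ℝ) (S : ℝ) (hw : ∀ n, |w n| ≤ S)
    (m : ℤ) : Summable fun i => d (i - m) * w i := by
  have h1 : Summable fun i => |d (i - m)| := (Equiv.subRight m).summable_iff.2 hd
  refine Summable.of_norm_bounded (h1.mul_right S) fun i => ?_
  rw [norm_mul, Real.norm_eq_abs, Real.norm_eq_abs]
  exact mul_le_mul_of_nonneg_left (hw i) (abs_nonneg _)

theorem abs_alloyPotential_le (hd : Summable fun n => |d n|) (w : ℤ → ℝ) (S : ℝ)
    (hw : ∀ n, |w n| ≤ S) (m : ℤ) : |alloyPotential d w m| ≤ (∑' n, |d n|) * S := by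
  rw [alloyPotential, ← tsum_mul_right]
  rw [← Real.norm_eq_abs]
  refine tsum_of_norm_bounded (hd.mul_right S).hasSum fun n => ?_
  rw [norm_mul, Real.norm_eq_abs, Real.norm_eq_abs]
  exact mul_le_mul_of_nonneg_left (hw _) (abs_nonneg _)

theorem measurable_alloyPotential {α : Type*} [MeasurableSpace α] (W : α → ℤ → ℝ)
    (hW : ∀ n, Measurable fun x => W x n) (m : ℤ) :
    Measurable fun x => alloyPotential d (W x) m := by
  unfold alloyPotential
  exact Measurable.tsum fun n => (hW _).const_mul _

/-- Splitting off the contribution of finitely many couplings to the potential. -/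
theorem alloyPotential_split {Ω : Type*} (hd : Summable fun n => |d n|) (ω : ℤ → Ω → ℝ) (S : ℝ)
    (hω : ∀ n w, |ω n w| ≤ S) {ι : Type*} [Fintype ι] (s : ι → ℤ) (hs : Function.Injective s)
    (w : Ω) (m : ℤ) :
    alloyPotential d (fun n => ω n w) m = ∑ k, d (s k - m) * ω (s k) w
      + alloyPotential d (BoundedIndep.restrictCompl ω (Set.range s) w) m := by
  classical
  rw [alloyPotential_eq_tsum, alloyPotential_eq_tsum]
  have hsum : ∑ k, d (s k - m) * ω (s k) w
      = ∑' i, (if i ∈ Finset.univ.image s then d (i - m) * ω i w else 0) := by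
    rw [tsum_eq_sum (s := Finset.univ.image s)]
    · rw [Finset.sum_image fun a _ b _ h => hs h]
      refine Finset.sum_congr rfl fun k _ => ?_
      rw [if_pos (Finset.mem_image_of_mem s (Finset.mem_univ k))]
    · intro i hi; rw [if_neg hi]
  have hS : 0 ≤ S := (abs_nonneg _).trans (hω 0 w)
  rw [hsum, ← Summable.tsum_add]
  · congr 1
    funext i
    simp only [BoundedIndep.restrictCompl, Finset.mem_image, Finset.mem_univ, true_and,
      Set.mem_range]
    split_ifs <;> simp
  · exact summable_of_ne_finset_zero (s := Finset.univ.image s) fun i hi => by rw [if_neg hi]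
  · refine summable_alloy d hd _ S (fun n => ?_) m
    unfold BoundedIndep.restrictCompl
    split_ifs
    · simpa using hS
    · exact hω n w

end Alloy

/-! ### Volume of the two-site constraints -/

/-- The condition on the potentials `x`, `y` at two neighbouring sites joined by a bond of weight
`a`, up to the error `τ`: either `x = c`, or `c` is an eigenvalue of the two-site operator. -/
def PairNear (c a τ x y : ℝ) : Prop :=
  |x - c| ≤ τ ∨ |(x - c) * (y - c) - a ^ 2| ≤ τ

/-- For fixed `y`, the point `x` is near `c` or near `c + a ^ 2 / (y - c)`. In the second case `τ ≤
a ^ 2 / 2` and `|x - c| ≤ R` give `|y - c| ≥ a ^ 2 / (2 R)`, which controls the division by `y - c`.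
-/
theorem volume_pairNear_le (c a τ R y : ℝ) (hτ : 0 ≤ τ) (ha : 0 < a ^ 2) (hτa : τ ≤ a ^ 2 / 2) :
    volume {x | PairNear c a τ x y ∧ |x - c| ≤ R} ≤ ENNReal.ofReal (2 * τ + 4 * R * τ / a ^ 2) := by
  by_cases hR : 0 < R
  swap
  · have hsub : {x | PairNear c a τ x y ∧ |x - c| ≤ R} ⊆ {c} := by
      rintro x ⟨-, hx⟩
      have : |x - c| = 0 := le_antisymm (hx.trans (not_lt.1 hR)) (abs_nonneg _)
      rw [abs_eq_zero, sub_eq_zero] at this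
      exact this
    rw [measure_mono_null hsub (measure_singleton c)]
    exact zero_le
  have hsub : {x | PairNear c a τ x y ∧ |x - c| ≤ R} ⊆
      Metric.closedBall c τ ∪ Metric.closedBall (c + a ^ 2 / (y - c)) (2 * R * τ / a ^ 2) := by
    rintro x ⟨h | h, hx⟩
    · exact Or.inl (by rwa [Metric.mem_closedBall, Real.dist_eq])
    · right
      rw [Metric.mem_closedBall, Real.dist_eq]
      have h1 : a ^ 2 / 2 ≤ R * |y - c| := by
        have : |(x - c) * (y - c)| ≤ R * |y - c| := by
          rw [abs_mul]; exact mul_le_mul_of_nonneg_right hx (abs_nonneg _)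
        have h3 := (abs_le.1 h).1
        have h4 := le_abs_self ((x - c) * (y - c))
        linarith
      have hy : 0 < |y - c| := by
        by_contra hcon
        have : |y - c| = 0 := le_antisymm (not_lt.1 hcon) (abs_nonneg _)
        rw [this] at h1
        linarith
      have hy0 : y - c ≠ 0 := abs_pos.1 hy
      have h2 : x - (c + a ^ 2 / (y - c)) = ((x - c) * (y - c) - a ^ 2) / (y - c) := by
        field_simp; ring
      rw [h2, abs_div, div_le_div_iff₀ hy ha]
      calc |(x - c) * (y - c) - a ^ 2| * a ^ 2 ≤ τ * a ^ 2 := by gcongr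
        _ ≤ τ * (2 * (R * |y - c|)) := by gcongr; linarith
        _ = _ := by ring
  refine (measure_mono hsub).trans ((measure_union_le _ _).trans ?_)
  rw [Real.volume_closedBall, Real.volume_closedBall, ← ENNReal.ofReal_add (by positivity)
    (by positivity)]
  exact ENNReal.ofReal_le_ofReal (le_of_eq (by ring))

theorem measurableSet_pairNear (c a τ : ℝ) :
    MeasurableSet {p : ℝ × ℝ | PairNear c a τ p.1 p.2} := by
  have h1 : MeasurableSet {p : ℝ × ℝ | |p.1 - c| ≤ τ} := by
    refine measurableSet_le ?_ measurable_const
    fun_prop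
  have h2 : MeasurableSet {p : ℝ × ℝ | |(p.1 - c) * (p.2 - c) - a ^ 2| ≤ τ} := by
    refine measurableSet_le ?_ measurable_const
    fun_prop
  exact h1.union h2

/-- Once the second site of every pair is fixed, the constraints decouple: each first site
contributes `A τ`, each second one the length `2 R`. -/
theorem volume_pi_pairNear_le {κ : Type*} [Fintype κ] (c τ R A : ℝ) (a : κ → ℝ) (hτ : 0 ≤ τ)
    (hR : 0 ≤ R) (ha : ∀ b, 0 < a b ^ 2) (hτa : ∀ b, τ ≤ a b ^ 2 / 2)
    (hA : ∀ b, 2 + 4 * R / a b ^ 2 ≤ A) :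
    volume {z : κ ⊕ κ → ℝ | ∀ b, PairNear c (a b) τ (z (Sum.inl b)) (z (Sum.inr b)) ∧
      |z (Sum.inl b) - c| ≤ R ∧ |z (Sum.inr b) - c| ≤ R}
      ≤ ENNReal.ofReal (A * τ * (2 * R)) ^ Fintype.card κ := by
  set U : Set ((κ → ℝ) × (κ → ℝ)) := {q | ∀ b, PairNear c (a b) τ (q.1 b) (q.2 b) ∧
      |q.1 b - c| ≤ R ∧ |q.2 b - c| ≤ R} with hU
  have hUm : MeasurableSet U := by
    have : U = ⋂ b, ({q : (κ → ℝ) × (κ → ℝ) | PairNear c (a b) τ (q.1 b) (q.2 b)} ∩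
        ({q | |q.1 b - c| ≤ R} ∩ {q | |q.2 b - c| ≤ R})) := by
      ext q; simp [hU]
    rw [this]
    refine MeasurableSet.iInter fun b => MeasurableSet.inter ?_ (MeasurableSet.inter ?_ ?_)
    · have hm : Measurable fun q : (κ → ℝ) × (κ → ℝ) => (q.1 b, q.2 b) := by fun_prop
      exact hm (measurableSet_pairNear c (a b) τ)
    · exact measurableSet_le (by fun_prop) measurable_const
    · exact measurableSet_le (by fun_prop) measurable_const
  have hmp := volume_measurePreserving_sumPiEquivProdPi (fun _ : κ ⊕ κ => ℝ)
  have e : {z : κ ⊕ κ → ℝ | ∀ b, PairNear c (a b) τ (z (Sum.inl b)) (z (Sum.inr b)) ∧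
      |z (Sum.inl b) - c| ≤ R ∧ |z (Sum.inr b) - c| ≤ R}
      = (MeasurableEquiv.sumPiEquivProdPi fun _ : κ ⊕ κ => ℝ) ⁻¹' U := rfl
  rw [e, hmp.measure_preimage hUm.nullMeasurableSet]
  change (volume.prod volume) U ≤ _
  rw [Measure.prod_apply_symm hUm]
  calc _ ≤ ∫⁻ y, (Set.Icc (fun _ : κ => c - R) (fun _ => c + R)).indicator
        (fun _ => ENNReal.ofReal (A * τ) ^ Fintype.card κ) y := by
        refine lintegral_mono fun y => ?_
        change volume {x | (x, y) ∈ U} ≤ _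
        by_cases hy : ∀ b, |y b - c| ≤ R
        · have hyI : y ∈ Set.Icc (fun _ : κ => c - R) (fun _ => c + R) := by
            constructor <;> intro b <;> have := abs_le.1 (hy b) <;> simp <;> linarith
          rw [Set.indicator_of_mem hyI]
          have hsub : {x | (x, y) ∈ U} ⊆
              Set.pi Set.univ fun b => {t | PairNear c (a b) τ t (y b) ∧ |t - c| ≤ R} :=
            fun x hx b _ => ⟨(hx b).1, (hx b).2.1⟩
          refine (measure_mono hsub).trans ?_
          rw [volume_pi, Measure.pi_pi]
          refine (Finset.prod_le_prod' fun b _ => ?_).trans_eq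
            (by rw [Finset.prod_const, Finset.card_univ])
          refine (volume_pairNear_le c (a b) τ R (y b) hτ (ha b) (hτa b)).trans ?_
          refine ENNReal.ofReal_le_ofReal ?_
          calc _ = (2 + 4 * R / a b ^ 2) * τ := by ring
            _ ≤ _ := by gcongr; exact hA b
        · have : {x | (x, y) ∈ U} = ∅ := by
            refine Set.eq_empty_of_forall_notMem fun x hx => hy fun b => (hx b).2.2
          rw [this, measure_empty]
          exact zero_le
    _ = ENNReal.ofReal (A * τ) ^ Fintype.card κ * ENNReal.ofReal (2 * R) ^ Fintype.card κ := by
        rw [lintegral_indicator_const measurableSet_Icc, Real.volume_Icc_pi, Finset.prod_const,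
          Finset.card_univ]
        congr 3; ring
    _ ≤ _ := by
        rw [← mul_pow]
        by_cases hκ : Nonempty κ
        · obtain ⟨b⟩ := hκ
          have hA0 : 0 ≤ A := le_trans (by have := ha b; positivity) (hA b)
          rw [← ENNReal.ofReal_mul (by positivity)]
        · have : Fintype.card κ = 0 := by
            rw [Fintype.card_eq_zero_iff]; exact not_nonempty_iff.1 hκ
          simp [this]

/-! ### Invertible dependence of the potential at separated pairs on the couplings -/

section Toeplitz

variable (d : ℤ → ℝ)

/-- A translate of a nonzero decaying sequence for which the `2 × 2` Toeplitz block is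
invertible. -/
theorem exists_toeplitz_block_ne_zero (hd : ∃ n, d n ≠ 0) (hds : Summable fun n => |d n|) :
    ∃ n₀, |d (n₀ + 1) * d (n₀ - 1)| < d n₀ ^ 2 := by
  obtain ⟨n₁, hn₁⟩ := hd
  have hpos : 0 < |d n₁| := abs_pos.2 hn₁
  have hfin : {n | |d n₁| ≤ |d n|}.Finite := by
    have := hds.tendsto_cofinite_zero.eventually (gt_mem_nhds hpos)
    rw [Filter.eventually_cofinite] at this
    simpa using this
  obtain ⟨m, hm, hmax⟩ := Set.exists_max_image _ (fun n => |d n|) hfin ⟨n₁, by simp⟩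
  have hmax' : ∀ n, |d n| ≤ |d m| := by
    intro n
    by_cases hn : |d n₁| ≤ |d n|
    · exact hmax n hn
    · exact (not_le.1 hn).le.trans hm
  have hfin2 : {n | |d m| ≤ |d n|}.Finite := hfin.subset fun n hn => by
    have h2 : |d m| ≤ |d n| := hn
    exact (show |d n₁| ≤ |d n| from le_trans hm h2)
  -- Take for `n₀` the last site where `|d|` is maximal: then `|d (n₀ + 1)|` is strictly smaller and
  -- `|d (n₀ - 1)|` is not larger.
  obtain ⟨n₀, hn₀, hlast⟩ := Set.exists_max_image _ (fun n : ℤ => n) hfin2 ⟨m, by simp⟩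
  have heq : |d n₀| = |d m| := le_antisymm (hmax' _) hn₀
  have h1 : |d (n₀ + 1)| < |d n₀| := by
    rw [heq]
    by_contra hcon
    have := hlast (n₀ + 1) (not_lt.1 hcon)
    simp at this
  have h0 : 0 < |d n₀| := by rw [heq]; exact hpos.trans_le hm
  refine ⟨n₀, ?_⟩
  rw [abs_mul, ← sq_abs (d n₀), sq]
  calc |d (n₀ + 1)| * |d (n₀ - 1)| ≤ |d (n₀ + 1)| * |d n₀| := by
        refine mul_le_mul_of_nonneg_left ?_ (abs_nonneg _)
        rw [heq]; exact hmax' _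
    _ < _ := mul_lt_mul_of_pos_right h1 h0

/-- The two sites `k b` and `k b + 1` of each block. -/
def pairSite {κ : Type*} (k : κ → ℤ) : κ ⊕ κ → ℤ :=
  Sum.elim k fun b => k b + 1

/-- The section of the Toeplitz operator of `d` that describes how the potential at the pairs of
sites depends on the couplings at these pairs, shifted by `n₀`. -/
def pairToeplitz {κ : Type*} [Fintype κ] (n₀ : ℤ) (k : κ → ℤ) (x : κ ⊕ κ → ℝ) (j : κ ⊕ κ) : ℝ :=
  ∑ j', d (pairSite k j' + n₀ - pairSite k j) * x j'

theorem pairSite_injective {κ : Type*} (k : κ → ℤ)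
    (hk : ∀ b b', b ≠ b' → 3 ≤ |k b - k b'|) : Function.Injective (pairSite k) := by
  have h : ∀ b b', b ≠ b' → 3 ≤ k b - k b' ∨ k b - k b' ≤ -3 := by
    intro b b' hb
    have := hk b b' hb
    rcases le_abs.1 this with h | h
    · exact Or.inl h
    · right; linarith
  rintro (b | b) (b' | b') hbb <;> simp only [pairSite, Sum.elim_inl, Sum.elim_inr] at hbb
  · by_contra hne
    rcases h b b' (fun h => hne (by rw [h])) with h | h <;> omega
  · by_cases hb : b = b'
    · subst hb; omega
    · rcases h b b' hb with h | h <;> omega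
  · by_cases hb : b = b'
    · subst hb; omega
    · rcases h b b' hb with h | h <;> omega
  · by_contra hne
    rcases h b b' (fun h => hne (by rw [h])) with h | h <;> omega

/-- The matrix is dominated by its `2 × 2` diagonal blocks, all equal and of determinant `Δ > 0`.
Entries that join different pairs belong to the tail of `d`, which is small once the gap `g` is
large. The expansion factor does not depend on the number of pairs, as the power `K` in the
probability bound requires. -/
theorem exists_pairToeplitz_expand (hds : Summable fun n => |d n|) (n₀ : ℤ)
    (hn₀ : |d (n₀ + 1) * d (n₀ - 1)| < d n₀ ^ 2) :
    ∃ (g : ℕ) (q : ℝ), 3 ≤ g ∧ 0 < q ∧ ∀ (κ : Type) [Fintype κ] (k : κ → ℤ),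
      (∀ b b', b ≠ b' → (g : ℤ) ≤ |k b - k b'|) → ∀ x : κ ⊕ κ → ℝ,
        ‖x‖ ≤ q * ‖pairToeplitz d n₀ k x‖ := by
  set Δ := d n₀ * d n₀ - d (n₀ + 1) * d (n₀ - 1) with hΔ
  have hΔ0 : 0 < Δ := by
    have := (abs_lt.1 hn₀).2
    nlinarith
  set m := |d n₀| + |d (n₀ + 1)| + |d (n₀ - 1)| with hm
  have hm0 : 0 < m := by
    have : d n₀ ≠ 0 := by
      intro h; rw [h] at hn₀
      have := abs_nonneg (d (n₀ + 1) * d (n₀ - 1))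
      rw [zero_pow two_ne_zero] at hn₀
      exact this.not_gt hn₀
    have := abs_pos.2 this
    positivity
  -- With this tail the interaction of the pairs costs `‖x‖ / 4` after inverting the blocks, and is
  -- absorbed on the left.
  obtain ⟨F, hF⟩ := summable_iff_vanishing_norm.1 hds (Δ / (4 * m)) (by positivity)
  obtain ⟨r, hr⟩ : ∃ r : ℕ, ∀ n ∈ F, |n| ≤ r := by
    refine ⟨∑ n ∈ F, n.natAbs, fun n hn => ?_⟩
    have := Finset.single_le_sum (f := fun n : ℤ => n.natAbs) (fun _ _ => Nat.zero_le _) hn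
    rw [Int.abs_eq_natAbs]
    exact_mod_cast this
  refine ⟨r + n₀.natAbs + 5, 4 * m / Δ, by omega, by positivity, fun κ _ k hk x => ?_⟩
  classical
  have hk' : ∀ b b', b ≠ b' → ((r + n₀.natAbs + 5 : ℕ) : ℤ) ≤ k b - k b' ∨
      k b - k b' ≤ -((r + n₀.natAbs + 5 : ℕ) : ℤ) := by
    intro b b' hb
    rcases le_abs.1 (hk b b' hb) with h | h
    · exact Or.inl h
    · right; linarith
  have hinj := pairSite_injective k fun b b' hb => by
    have := hk b b' hb
    push_cast at this
    have h0 : (0 : ℤ) ≤ r := by positivity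
    have h1 : (0 : ℤ) ≤ |n₀| := abs_nonneg _
    linarith
  set y := pairToeplitz d n₀ k x with hy
  set π : κ ⊕ κ → κ := Sum.elim id id with hπ
  set rest : κ ⊕ κ → ℝ := fun j => ∑ j' ∈ Finset.univ.filter (fun j' => π j' ≠ π j),
    d (pairSite k j' + n₀ - pairSite k j) * x j' with hrest
  have hrest_le : ∀ j, |rest j| ≤ Δ / (4 * m) * ‖x‖ := by
    intro j
    calc |rest j| ≤ ∑ j' ∈ Finset.univ.filter (fun j' => π j' ≠ π j),
          |d (pairSite k j' + n₀ - pairSite k j)| * ‖x‖ := by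
          refine (Finset.abs_sum_le_sum_abs _ _).trans (Finset.sum_le_sum fun j' _ => ?_)
          rw [abs_mul]
          gcongr
          exact norm_le_pi_norm x j'
      _ = (∑ i ∈ (Finset.univ.filter (fun j' => π j' ≠ π j)).image
          (fun j' => pairSite k j' + n₀ - pairSite k j), |d i|) * ‖x‖ := by
          rw [Finset.sum_image, Finset.sum_mul]
          intro p _ q _ hpq
          exact hinj (by simpa using hpq)
      _ ≤ _ := by
          gcongr
          have := hF ((Finset.univ.filter (fun j' => π j' ≠ π j)).image
            (fun j' => pairSite k j' + n₀ - pairSite k j)) (by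
            rw [Finset.disjoint_left]
            intro i hi hiF
            obtain ⟨j', hj', rfl⟩ := Finset.mem_image.1 hi
            have hne := (Finset.mem_filter.1 hj').2
            have h1 := hr _ hiF
            have h2 := abs_le.1 h1
            rcases hk' _ _ hne with h | h <;> rcases j' with b' | b' <;> rcases j with b | b <;>
              simp only [pairSite, hπ, Sum.elim_inl, Sum.elim_inr, id] at h h2 <;> omega)
          exact ((le_abs_self _).trans this.le)
  have hsplit : ∀ j, y j = d n₀ * x j + (rest j + match j with
      | Sum.inl b => d (n₀ + 1) * x (Sum.inr b)
      | Sum.inr b => d (n₀ - 1) * x (Sum.inl b)) := by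
    intro j
    have h1 : y j = rest j + ∑ j' ∈ Finset.univ.filter (fun j' => ¬ π j' ≠ π j),
        d (pairSite k j' + n₀ - pairSite k j) * x j' :=
      (Finset.sum_filter_add_sum_filter_not _ _ _).symm
    have h2 : Finset.univ.filter (fun j' => ¬ π j' ≠ π j) = {Sum.inl (π j), Sum.inr (π j)} := by
      ext j'
      rcases j' with b' | b' <;> simp [hπ]
    rw [h1, h2, Finset.sum_pair (by simp)]
    rcases j with b | b
    · simp only [hπ, Sum.elim_inl, id, pairSite, Sum.elim_inr]
      rw [show k b + n₀ - k b = n₀ by ring, show k b + 1 + n₀ - k b = n₀ + 1 by ring]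
      ring
    · simp only [hπ, Sum.elim_inl, id, pairSite, Sum.elim_inr]
      rw [show k b + n₀ - (k b + 1) = n₀ - 1 by ring, show k b + 1 + n₀ - (k b + 1) = n₀ by ring]
      ring
  have hyj : ∀ j, |y j| ≤ ‖y‖ := fun j => norm_le_pi_norm y j
  have hz : ∀ j, |y j - rest j| ≤ ‖y‖ + Δ / (4 * m) * ‖x‖ := fun j =>
    (abs_sub _ _).trans (add_le_add (hyj j) (hrest_le j))
  set Z := ‖y‖ + Δ / (4 * m) * ‖x‖ with hZ
  have hZ0 : 0 ≤ Z := by positivity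
  have hcomb : ∀ (α γ p q : ℝ), |p| ≤ Z → |q| ≤ Z → |α| + |γ| ≤ m → |α * p - γ * q| ≤ m * Z := by
    intro α γ p q hp hq hαγ
    calc |α * p - γ * q| ≤ |α| * |p| + |γ| * |q| := by
          rw [← abs_mul, ← abs_mul]; exact abs_sub _ _
      _ ≤ |α| * Z + |γ| * Z := by gcongr
      _ = (|α| + |γ|) * Z := by ring
      _ ≤ _ := by gcongr
  have hxj : ∀ j, Δ * |x j| ≤ m * Z := by
    intro j
    have hp1 := abs_nonneg (d (n₀ + 1))
    have hp2 := abs_nonneg (d (n₀ - 1))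
    rcases j with b | b
    · have e1 := hsplit (Sum.inl b)
      have e2 := hsplit (Sum.inr b)
      simp only at e1 e2
      have : Δ * x (Sum.inl b) = d n₀ * (y (Sum.inl b) - rest (Sum.inl b))
          - d (n₀ + 1) * (y (Sum.inr b) - rest (Sum.inr b)) := by
        rw [hΔ]; linear_combination (-d n₀) * e1 + d (n₀ + 1) * e2
      rw [← abs_of_pos hΔ0, ← abs_mul, this]
      exact hcomb _ _ _ _ (hz _) (hz _) (by rw [hm]; linarith)
    · have e1 := hsplit (Sum.inl b)
      have e2 := hsplit (Sum.inr b)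
      simp only at e1 e2
      have : Δ * x (Sum.inr b) = d n₀ * (y (Sum.inr b) - rest (Sum.inr b))
          - d (n₀ - 1) * (y (Sum.inl b) - rest (Sum.inl b)) := by
        rw [hΔ]; linear_combination (-d n₀) * e2 + d (n₀ - 1) * e1
      rw [← abs_of_pos hΔ0, ← abs_mul, this]
      exact hcomb _ _ _ _ (hz _) (hz _) (by rw [hm]; linarith)
  have hx : ‖x‖ ≤ m * Z / Δ := by
    refine (pi_norm_le_iff_of_nonneg (by positivity)).2 fun j => ?_
    rw [Real.norm_eq_abs, le_div_iff₀ hΔ0]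
    linarith [hxj j]
  have h5 : m * Z / Δ = m / Δ * ‖y‖ + ‖x‖ / 4 := by
    rw [hZ]; field_simp
  rw [h5] at hx
  have h6 : 4 * m / Δ * ‖y‖ = 4 * (m / Δ * ‖y‖) := by ring
  rw [h6]
  have : 0 ≤ m / Δ * ‖y‖ := by positivity
  linarith

end Toeplitz

open BoundedIndep in
/-- It is unlikely that the potential satisfies the condition `PairNear` at many pairs of
neighbouring sites. -/
theorem exists_measure_pairNear_le {Ω : Type*} [MeasurableSpace Ω] (P : Measure Ω)
    [IsProbabilityMeasure P] (ω : ℤ → Ω → ℝ) (B : NNReal) (S : ℝ) (hω : BoundedIndep P ω B S)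
    (d : ℤ → ℝ) (hd : ∃ n, d n ≠ 0) (hds : Summable fun n => |d n|) (a : ℤ → ℝ) (M : ℝ)
    (hM : 0 < M) (ha : ∀ n, 1 / M ≤ |a n|) (c : ℝ) :
    ∃ (g : ℕ) (C τ₀ : ℝ), 3 ≤ g ∧ 0 < C ∧ 0 < τ₀ ∧ ∀ (K : ℕ) (k : Fin K → ℤ),
      (∀ b b', b ≠ b' → (g : ℤ) ≤ |k b - k b'|) → ∀ τ, 0 < τ → τ ≤ τ₀ →
      P {w | ∀ b, PairNear c (a (k b + 1)) τ (alloyPotential d (fun n => ω n w) (k b))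
        (alloyPotential d (fun n => ω n w) (k b + 1))} ≤ ENNReal.ofReal ((C * τ) ^ K) := by
  obtain ⟨n₀, hn₀⟩ := exists_toeplitz_block_ne_zero d hd hds
  obtain ⟨g, q, hg, hq, hexp⟩ := exists_pairToeplitz_expand d hds n₀ hn₀
  obtain ⟨w₀⟩ : Nonempty Ω := P.nonempty_of_neZero
  have hS : 0 ≤ S := (abs_nonneg _).trans (hω.bdd 0 w₀)
  set R := (∑' n, |d n|) * S + |c| with hR
  have hR0 : 0 ≤ R := by
    have : 0 ≤ ∑' n, |d n| := tsum_nonneg fun n => abs_nonneg _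
    positivity
  have ha2 : ∀ n, 1 / M ^ 2 ≤ a n ^ 2 := by
    intro n
    rw [← sq_abs (a n), ← one_div_pow]
    have := ha n
    gcongr
  set A := 2 + 4 * R * M ^ 2 with hA
  -- The constant collects, for each pair, two densities, two factors of the inverse of the Toeplitz
  -- section, and the volume of the constraint. The bound on `τ` is half of the lower bound for `a n
  -- ^ 2`.
  refine ⟨g, (B : ℝ) ^ 2 * q ^ 2 * (A * (2 * R)) + 1, 1 / M ^ 2 / 2, hg, by positivity,
    by positivity, fun K k hk τ hτ hτ₀ => ?_⟩
  have hinj : Function.Injective fun j => pairSite k j + n₀ := fun j j' h =>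
    pairSite_injective k (fun b b' hb => le_trans (by exact_mod_cast hg) (hk b b' hb))
      (by simpa using h)
  set s : Fin K ⊕ Fin K → ℤ := fun j => pairSite k j + n₀ with hs
  set Tl := pairToeplitz d n₀ k with hTl
  have hTc : Continuous Tl := by
    refine continuous_pi fun j => ?_
    simp only [hTl, pairToeplitz]
    fun_prop
  have hTsub : ∀ x y, Tl x - Tl y = Tl (x - y) := by
    intro x y
    funext j
    simp only [hTl, pairToeplitz, Pi.sub_apply, mul_sub, Finset.sum_sub_distrib]
  set U : Set (Fin K ⊕ Fin K → ℝ) := {z | ∀ b, PairNear c (a (k b + 1)) τ (z (Sum.inl b))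
    (z (Sum.inr b)) ∧ |z (Sum.inl b) - c| ≤ R ∧ |z (Sum.inr b) - c| ≤ R} with hU
  have hUm : MeasurableSet U := by
    have : U = ⋂ b, ({z : Fin K ⊕ Fin K → ℝ | PairNear c (a (k b + 1)) τ (z (Sum.inl b))
        (z (Sum.inr b))} ∩ ({z | |z (Sum.inl b) - c| ≤ R} ∩ {z | |z (Sum.inr b) - c| ≤ R})) := by
      ext z; simp [hU]
    rw [this]
    refine MeasurableSet.iInter fun b => MeasurableSet.inter ?_ (MeasurableSet.inter ?_ ?_)
    · have hm : Measurable fun z : Fin K ⊕ Fin K → ℝ => (z (Sum.inl b), z (Sum.inr b)) := by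
        fun_prop
      exact hm (measurableSet_pairNear c (a (k b + 1)) τ)
    · exact measurableSet_le (by fun_prop) measurable_const
    · exact measurableSet_le (by fun_prop) measurable_const
  set Y : (ℤ → ℝ) → Fin K ⊕ Fin K → ℝ := fun y j => alloyPotential d y (pairSite k j) with hY
  have hYm : Measurable Y := measurable_pi_iff.2 fun j =>
    measurable_alloyPotential d (fun y : ℤ → ℝ => y) (fun n => measurable_pi_apply n) _
  set G : Set ((Fin K ⊕ Fin K → ℝ) × (ℤ → ℝ)) := {p | Tl p.1 + Y p.2 ∈ U} with hG
  have hGm : MeasurableSet G :=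
    ((hTc.measurable.comp measurable_fst).add (hYm.comp measurable_snd)) hUm
  -- The other couplings `y` are arbitrary here, and the series in `Y y` may take its default value
  -- `0`: only its being a constant vector matters. The map is affine and expands by `1 / q`, so the
  -- volume of the preimage is that of `U` times at most `q ^ (2 * K)`, by comparison of Hausdorff
  -- measures.
  have hvol : ∀ y, volume {x | (x, y) ∈ G}
      ≤ ENNReal.ofReal (q ^ (2 * K) * (A * τ * (2 * R)) ^ K) := by
    intro y
    have hanti : AntilipschitzWith q.toNNReal fun x => Tl x + Y y := by
      refine AntilipschitzWith.of_le_mul_dist fun x x' => ?_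
      rw [Real.coe_toNNReal q hq.le, dist_eq_norm, dist_eq_norm, add_sub_add_right_eq_sub, hTsub]
      exact hexp _ k hk _
    have h1 := hanti.hausdorffMeasure_preimage_le (d := (Fintype.card (Fin K ⊕ Fin K) : ℝ))
      (by positivity) U
    rw [hausdorffMeasure_pi_real] at h1
    refine h1.trans ?_
    have h2 := volume_pi_pairNear_le c τ R A (fun b => a (k b + 1)) hτ.le hR0
      (fun b => lt_of_lt_of_le (by positivity) (ha2 _))
      (fun b => hτ₀.trans (by gcongr; exact ha2 _)) (fun b => by
        rw [hA]
        gcongr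
        rw [div_le_iff₀ (lt_of_lt_of_le (by positivity) (ha2 _))]
        have := ha2 (k b + 1)
        rw [div_le_iff₀ (by positivity)] at this
        nlinarith)
    have hA0 : 0 ≤ A := by positivity
    rw [ENNReal.ofReal_mul (by positivity), ENNReal.ofReal_pow hq.le]
    refine mul_le_mul' (le_of_eq ?_) (h2.trans (le_of_eq ?_))
    · rw [ENNReal.rpow_natCast]
      simp only [Fintype.card_sum, Fintype.card_fin, ← two_mul]
      rfl
    · rw [Fintype.card_fin, ENNReal.ofReal_pow (by positivity)]
  have hmain := hω.measure_preimage_le s hinj G hGm _ hvol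
  have hsub : {w | ∀ b, PairNear c (a (k b + 1)) τ (alloyPotential d (fun n => ω n w) (k b))
        (alloyPotential d (fun n => ω n w) (k b + 1))}
      ⊆ {w | ((fun j => ω (s j) w), restrictCompl ω (Set.range s) w) ∈ G} := by
    intro w hw
    have hsplit : ∀ j, (Tl (fun j => ω (s j) w) + Y (restrictCompl ω (Set.range s) w)) j
        = alloyPotential d (fun n => ω n w) (pairSite k j) := by
      intro j
      rw [alloyPotential_split d hds ω S hω.bdd s hinj w]
      simp only [hTl, hY, hs, pairToeplitz, Pi.add_apply]
    have hb : ∀ m, |alloyPotential d (fun n => ω n w) m - c| ≤ R := fun m =>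
      (abs_sub _ _).trans (add_le_add (abs_alloyPotential_le d hds _ S (fun n => hω.bdd n w) m)
        le_rfl)
    change _ ∈ U
    intro b
    rw [hsplit, hsplit]
    exact ⟨hw b, hb _, hb _⟩
  refine (measure_mono hsub).trans (hmain.trans ?_)
  have hBq : (0 : ℝ) ≤ (B : ℝ) ^ 2 * q ^ 2 * (A * (2 * R)) := by positivity
  rw [← ENNReal.ofReal_coe_nnreal, ← ENNReal.ofReal_pow (by positivity),
    ← ENNReal.ofReal_mul (by positivity)]
  refine ENNReal.ofReal_le_ofReal ?_
  rw [Fintype.card_sum, Fintype.card_fin]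
  calc (B : ℝ) ^ (K + K) * (q ^ (2 * K) * (A * τ * (2 * R)) ^ K)
      = ((B : ℝ) ^ 2 * q ^ 2 * (A * (2 * R)) * τ) ^ K := by
        rw [← two_mul, pow_mul, pow_mul, ← mul_pow, ← mul_pow]; ring
    _ ≤ _ := by gcongr; linarith

/-! ### Two eigenfunctions with nearly equal absolute values -/

/-- The three-term recurrence of the Jacobi operator at the site `n`. -/
def JacobiAt (a V : ℤ → ℝ) (e : ℝ) (u : ℤ → ℝ) (n : ℤ) : Prop :=
  a (n + 1) * u (n + 1) + a n * u (n - 1) + V n * u n = e * u n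

theorem exists_sign_abs_sub_le (x y η : ℝ) (hη : 0 ≤ η) (h : |x ^ 2 - y ^ 2| ≤ η ^ 2) :
    ∃ s : ℝ, (s = 1 ∨ s = -1) ∧ |y - s * x| ≤ η := by
  by_contra hcon
  push Not at hcon
  have h1 := hcon 1 (Or.inl rfl)
  have h2 := hcon (-1) (Or.inr rfl)
  have h3 : |x ^ 2 - y ^ 2| = |y - 1 * x| * |y - -1 * x| := by
    rw [← abs_mul, ← abs_neg]; congr 1; ring
  rw [h3] at h
  nlinarith [abs_nonneg (y - 1 * x)]

/-- The relative signs of two nearly equal absolute values turn one recurrence into a second,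
twisted one. -/
theorem exists_twist (a V u v : ℤ → ℝ) (e' M R η : ℝ) (hη : 0 ≤ η) (ha : ∀ n, |a n| ≤ M)
    (huv : ∀ n, |u n ^ 2 - v n ^ 2| ≤ η ^ 2) :
    ∃ t : ℤ → ℝ, (∀ n, t n = 1 ∨ t n = -1) ∧ ∀ n, JacobiAt a V e' v n → |V n - e'| ≤ R →
      |t n * (a (n + 1) * u (n + 1)) + t (n - 1) * (a n * u (n - 1)) + (V n - e') * u n|
        ≤ (2 * M + R) * η := by
  choose s hs hsv using fun n => exists_sign_abs_sub_le (u n) (v n) η hη (huv n)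
  -- With `v n` close to `s n * u n`, multiplying the recurrence of `v` by `s n` leaves one sign on
  -- each bond.
  refine ⟨fun n => s n * s (n + 1), fun n => ?_, fun n hJ hV => ?_⟩
  · rcases hs n with h | h <;> rcases hs (n + 1) with h' | h' <;> simp [h, h']
  · have hss : s n * s n = 1 := by rcases hs n with h | h <;> simp [h]
    have hsa : |s n| = 1 := by rcases hs n with h | h <;> simp [h]
    have e1 : s n * s (n + 1) * (a (n + 1) * u (n + 1)) +
        s (n - 1) * s (n - 1 + 1) * (a n * u (n - 1)) + (V n - e') * u n
        = -s n * (a (n + 1) * (v (n + 1) - s (n + 1) * u (n + 1))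
          + a n * (v (n - 1) - s (n - 1) * u (n - 1)) + (V n - e') * (v n - s n * u n)) := by
      rw [sub_add_cancel]
      unfold JacobiAt at hJ
      linear_combination (s n) * hJ - ((V n - e') * u n) * hss
    rw [e1, abs_mul, abs_neg, hsa, one_mul]
    calc _ ≤ |a (n + 1) * (v (n + 1) - s (n + 1) * u (n + 1))|
          + |a n * (v (n - 1) - s (n - 1) * u (n - 1))| + |(V n - e') * (v n - s n * u n)| :=
          abs_add_three _ _ _
      _ ≤ M * η + M * η + R * η := by
          simp only [abs_mul]
          have hM : 0 ≤ M := (abs_nonneg _).trans (ha 0)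
          have hR : 0 ≤ R := (abs_nonneg _).trans hV
          exact add_le_add (add_le_add (mul_le_mul (ha _) (hsv _) (abs_nonneg _) hM)
            (mul_le_mul (ha _) (hsv _) (abs_nonneg _) hM))
            (mul_le_mul hV (hsv _) (abs_nonneg _) hR)
      _ = _ := by ring

/-- If an eigenfunction is not small at a site, and the recurrence with twisted signs and another
energy holds approximately, then the potential is constrained near the site. -/
theorem pairNear_or_of_twist (x y : ℝ) (a₁ u₀ u₁ c δ M R ε θ : ℝ)
    (hM : 0 ≤ M) (hε : 0 ≤ ε) (hθ : 0 < θ) (hδ : 0 < |δ|) (ha : |a₁| ≤ M)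
    (hu : θ ≤ |u₀|) (hx : |y - c| ≤ R) (h0 : |a₁ * u₁ + (x - c) * u₀| ≤ ε)
    (h1 : |a₁ * u₀ + (y - c) * u₁| ≤ ε ∨ |δ * u₁| ≤ ε) :
    PairNear c a₁ (ε * (1 + R + M + M / |δ|) / θ) x y := by
  have hR : 0 ≤ R := (abs_nonneg _).trans hx
  have hu0 : 0 < |u₀| := hθ.trans_le hu
  rcases h1 with h1 | h1
  · right
    rw [le_div_iff₀ hθ]
    have e1 : ((x - c) * (y - c) - a₁ ^ 2) * u₀
        = (y - c) * (a₁ * u₁ + (x - c) * u₀) - a₁ * (a₁ * u₀ + (y - c) * u₁) := by ring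
    calc |(x - c) * (y - c) - a₁ ^ 2| * θ ≤ |(x - c) * (y - c) - a₁ ^ 2| * |u₀| := by
          exact mul_le_mul_of_nonneg_left hu (abs_nonneg _)
      _ = |(y - c) * (a₁ * u₁ + (x - c) * u₀) - a₁ * (a₁ * u₀ + (y - c) * u₁)| := by
          rw [← abs_mul, e1]
      _ ≤ |y - c| * |a₁ * u₁ + (x - c) * u₀| + |a₁| * |a₁ * u₀ + (y - c) * u₁| := by
          rw [← abs_mul, ← abs_mul]; exact abs_sub _ _
      _ ≤ R * ε + M * ε :=
          add_le_add (mul_le_mul hx h0 (abs_nonneg _) hR) (mul_le_mul ha h1 (abs_nonneg _) hM)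
      _ ≤ _ := by
          have : 0 ≤ ε * (M / |δ|) := by positivity
          nlinarith
  · left
    rw [le_div_iff₀ hθ]
    have hu1 : |u₁| ≤ ε / |δ| := by
      rw [le_div_iff₀ hδ, mul_comm, ← abs_mul]; exact h1
    calc |x - c| * θ ≤ |x - c| * |u₀| := mul_le_mul_of_nonneg_left hu (abs_nonneg _)
      _ = |(a₁ * u₁ + (x - c) * u₀) - a₁ * u₁| := by rw [← abs_mul]; congr 1; ring
      _ ≤ |a₁ * u₁ + (x - c) * u₀| + |a₁| * |u₁| := by rw [← abs_mul]; exact abs_sub _ _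
      _ ≤ ε + M * (ε / |δ|) := add_le_add h0 (mul_le_mul ha hu1 (abs_nonneg _) hM)
      _ = ε * (1 + M / |δ|) := by ring
      _ ≤ _ := by gcongr; linarith

/-- The function `u` solves the recurrence exactly at energy `e` and, with twisted bonds,
approximately at energy `e'`. Sums and differences of both eliminate the untwisted or the twisted
bonds, and `c` is the mean of the energies. -/
theorem pairNear_of_large (a V u v : ℤ → ℝ) (e e' M R η θ τ : ℝ) (hM : 0 ≤ M) (hη : 0 ≤ η)
    (hθ : 0 < θ) (ha : ∀ n, |a n| ≤ M) (huv : ∀ n, |u n ^ 2 - v n ^ 2| ≤ η ^ 2) (n : ℤ)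
    (hJ : ∀ m, n - 1 ≤ m → m ≤ n + 1 → JacobiAt a V e u m ∧ JacobiAt a V e' v m)
    (hV : ∀ m, |V m - e| ≤ R ∧ |V m - e'| ≤ R) (hee : 0 < |e - e'|)
    (hsmall : (2 * M + R) * η < |e - e'| * θ) (hun : θ ≤ |u n|)
    (hτ : (2 * M + R) * η * (1 + R + M + M / |e - e'|) / θ ≤ τ) :
    PairNear ((e + e') / 2) (a (n + 1)) τ (V n) (V (n + 1)) ∨
      PairNear ((e + e') / 2) (a n) τ (V (n - 1)) (V n) := by
  obtain ⟨t, ht, htw⟩ := exists_twist a V u v e' M R η hη ha huv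
  set c := (e + e') / 2 with hc
  set ε := (2 * M + R) * η with hε
  have hR : 0 ≤ R := (abs_nonneg _).trans (hV 0).1
  have hε0 : 0 ≤ ε := by positivity
  have hVc : ∀ m, |V m - c| ≤ R := by
    intro m
    have h1 := abs_le.1 (hV m).1
    have h2 := abs_le.1 (hV m).2
    rw [abs_le]; constructor <;> rw [hc] <;> linarith
  have mono : ∀ {a x y τ₁ : ℝ}, PairNear c a τ₁ x y → τ₁ ≤ τ → PairNear c a τ x y :=
    fun h hle => h.imp (fun h => h.trans hle) (fun h => h.trans hle)
  have hbound : ε * (1 + R + M + M / |e - e'|) / θ ≤ τ := hτ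
  have j0 := (hJ n (by linarith) (by linarith)).1
  have w0 := htw n (hJ n (by linarith) (by linarith)).2 (hV n).2
  have jp := (hJ (n + 1) (by linarith) (by linarith)).1
  have wp := htw (n + 1) (hJ (n + 1) (by linarith) (by linarith)).2 (hV (n + 1)).2
  have jm := (hJ (n - 1) (by linarith) (by linarith)).1
  have wm := htw (n - 1) (hJ (n - 1) (by linarith) (by linarith)).2 (hV (n - 1)).2
  unfold JacobiAt at j0 jp jm
  rw [add_sub_cancel_right] at jp wp
  rw [sub_add_cancel] at jm wm
  rw [abs_le] at w0 wp wm
  have hbig : ε < |(e - e') * u n| := by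
    rw [abs_mul]
    exact hsmall.trans_le (mul_le_mul_of_nonneg_left hun (abs_nonneg _))
  -- If neither bond at `n` is twisted, the difference gives `(e - e') u n ≈ 0`, which is excluded.
  -- If both are, the sum gives `(V n - c) u n ≈ 0`. If exactly one is, the sum relates `u n` to its
  -- neighbour across the untwisted bond; the recurrences at that neighbour then show either that
  -- the neighbouring value is small, or a second such relation, whose combination with the first is
  -- the two-site condition.
  rcases ht n with h0 | h0 <;> rcases ht (n - 1) with hm | hm
  · exfalso
    rw [h0, hm] at w0
    refine absurd hbig (not_lt.2 ?_)
    rw [abs_le]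
    constructor <;> linarith
  · left
    rw [h0, hm] at w0
    refine mono (pairNear_or_of_twist (V n) (V (n + 1)) (a (n + 1)) (u n) (u (n + 1)) c (e - e') M R
      ε θ hM hε0 hθ hee (ha _) hun (hVc _) ?_ ?_) hbound
    · rw [abs_le, hc]
      constructor <;> linarith
    · rcases ht (n + 1) with hp | hp
      · right
        rw [h0, hp] at wp
        rw [abs_le]
        constructor <;> linarith
      · left
        rw [h0, hp] at wp
        rw [abs_le, hc]
        constructor <;> linarith
  · rw [h0, hm] at w0
    have key := pairNear_or_of_twist (V n) (V (n - 1)) (a n) (u n) (u (n - 1)) c (e - e') M R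
      ε θ hM hε0 hθ hee (ha _) hun (hVc _) (by
        rw [abs_le, hc]
        constructor <;> linarith) (by
        rcases ht (n - 1 - 1) with hp | hp
        · right
          rw [hm, hp] at wm
          rw [abs_le]
          constructor <;> linarith
        · left
          rw [hm, hp] at wm
          rw [abs_le, hc]
          constructor <;> linarith)
    rcases mono key hbound with h | h
    · exact Or.inl (Or.inl h)
    · exact Or.inr (Or.inr (by rwa [mul_comm (V (n - 1) - c)]))
  · left
    rw [h0, hm] at w0
    left
    refine le_trans ?_ hbound
    rw [le_div_iff₀ hθ]
    have h2 : |(V n - c) * u n| ≤ ε := by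
      rw [abs_le, hc]
      constructor <;> linarith
    calc |V n - c| * θ ≤ |V n - c| * |u n| := mul_le_mul_of_nonneg_left hun (abs_nonneg _)
      _ ≤ ε := by rw [← abs_mul]; exact h2
      _ ≤ ε * (1 + R + M + M / |e - e'|) := by
          refine le_mul_of_one_le_right hε0 ?_
          have : 0 ≤ M / |e - e'| := by positivity
          linarith

/-- Needed because the mean of the two eigenvalues depends on the realization, while the probability
bound is for a fixed energy. -/
theorem PairNear.shift {c c₀ a τ x y R h : ℝ} (hp : PairNear c a τ x y) (hx : |x - c| ≤ R)
    (hy : |y - c| ≤ R) (hc : |c - c₀| ≤ h) : PairNear c₀ a (τ + h * (2 * R + h + 1)) x y := by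
  have hR : 0 ≤ R := (abs_nonneg _).trans hx
  have hh : 0 ≤ h := (abs_nonneg _).trans hc
  rcases hp with hp | hp
  · left
    calc |x - c₀| = |(x - c) + (c - c₀)| := by ring_nf
      _ ≤ |x - c| + |c - c₀| := abs_add_le _ _
      _ ≤ τ + h := add_le_add hp hc
      _ ≤ _ := by nlinarith [mul_nonneg hh hR, mul_nonneg hh hh]
  · right
    calc |(x - c₀) * (y - c₀) - a ^ 2|
        = |((x - c) * (y - c) - a ^ 2) + (c - c₀) * ((x - c) + (y - c) + (c - c₀))| := by ring_nf
      _ ≤ |(x - c) * (y - c) - a ^ 2| + |c - c₀| * |(x - c) + (y - c) + (c - c₀)| := by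
          rw [← abs_mul]; exact abs_add_le _ _
      _ ≤ τ + h * (R + R + h) := by
          refine add_le_add hp (mul_le_mul hc ?_ (abs_nonneg _) hh)
          exact (abs_add_three _ _ _).trans (add_le_add (add_le_add hx hy) hc)
      _ ≤ _ := by nlinarith

/-- Lower bound on a solution of the recurrence to the right of a site. -/
theorem abs_le_pow_mul_max_right (a V u : ℤ → ℝ) (e M R : ℝ) (hM : 0 < M)
    (ha : ∀ n, 1 / M ≤ |a n| ∧ |a n| ≤ M) (hV : ∀ n, |V n - e| ≤ R) (m : ℤ) (k : ℕ)
    (hJ : ∀ n, m + 1 ≤ n → n ≤ m + k → JacobiAt a V e u n) :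
    |u m| ≤ (1 + M * (M + R)) ^ k * max |u (m + k)| |u (m + k + 1)| := by
  have hR : 0 ≤ R := (abs_nonneg _).trans (hV 0)
  have key : ∀ j : ℕ, j ≤ k → max |u m| |u (m + 1)|
      ≤ (1 + M * (M + R)) ^ j * max |u (m + j)| |u (m + j + 1)| := by
    intro j
    induction j with
    | zero => intro _; simp
    | succ j ih =>
      intro hj
      refine (ih (by omega)).trans ?_
      rw [pow_succ, mul_assoc]
      refine mul_le_mul_of_nonneg_left ?_ (by positivity)
      set X := max |u (m + (j + 1 : ℕ))| |u (m + (j + 1 : ℕ) + 1)| with hX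
      have hX0 : 0 ≤ X := le_max_of_le_left (abs_nonneg _)
      have h1 : |u (m + j + 1)| ≤ X := by
        rw [hX]; refine le_max_of_le_left (le_of_eq ?_); push_cast; ring_nf
      have h2 : |u (m + j + 1 + 1)| ≤ X := by
        rw [hX]; refine le_max_of_le_right (le_of_eq ?_); push_cast; ring_nf
      have hJj := hJ (m + j + 1) (by omega) (by omega)
      unfold JacobiAt at hJj
      rw [add_sub_cancel_right] at hJj
      have hmain : |u (m + j)| ≤ M * (M + R) * X := by
        have h3 : |a (m + j + 1)| * |u (m + j)| ≤ (M + R) * X := by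
          have : a (m + j + 1) * u (m + j) = -(a (m + j + 1 + 1) * u (m + j + 1 + 1)
              + (V (m + j + 1) - e) * u (m + j + 1)) := by linear_combination hJj
          rw [← abs_mul, this, abs_neg]
          calc _ ≤ |a (m + j + 1 + 1)| * |u (m + j + 1 + 1)|
                + |V (m + j + 1) - e| * |u (m + j + 1)| := by
                rw [← abs_mul, ← abs_mul]; exact abs_add_le _ _
            _ ≤ M * X + R * X := add_le_add (mul_le_mul (ha _).2 h2 (abs_nonneg _) hM.le)
                (mul_le_mul (hV _) h1 (abs_nonneg _) hR)
            _ = _ := by ring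
        have h4 : 1 ≤ M * |a (m + j + 1)| := by
          have := (ha (m + j + 1)).1
          rw [div_le_iff₀ hM] at this
          linarith
        calc |u (m + j)| ≤ (M * |a (m + j + 1)|) * |u (m + j)| :=
              le_mul_of_one_le_left (abs_nonneg _) h4
          _ = M * (|a (m + j + 1)| * |u (m + j)|) := by ring
          _ ≤ M * ((M + R) * X) := by gcongr
          _ = _ := by ring
      refine max_le (hmain.trans ?_) (h1.trans ?_)
      · nlinarith
      · exact le_mul_of_one_le_left hX0 (by
          have : 0 ≤ M * (M + R) := by positivity
          linarith)
  exact (le_max_left _ _).trans (key k le_rfl)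

theorem JacobiAt.reflect {a V u : ℤ → ℝ} {e : ℝ} {n : ℤ} (h : JacobiAt a V e u n) :
    JacobiAt (fun m => a (1 - m)) (fun m => V (-m)) e (fun m => u (-m)) (-n) := by
  unfold JacobiAt at h ⊢
  simp only [neg_neg]
  rw [show 1 - (-n + 1) = n by ring, show -(-n + 1) = n - 1 by ring, show 1 - -n = n + 1 by ring,
    show -(-n - 1) = n + 1 by ring]
  linarith

/-- Lower bound on a solution of the recurrence to the left of a site. -/
theorem abs_le_pow_mul_max_left (a V u : ℤ → ℝ) (e M R : ℝ) (hM : 0 < M)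
    (ha : ∀ n, 1 / M ≤ |a n| ∧ |a n| ≤ M) (hV : ∀ n, |V n - e| ≤ R) (m : ℤ) (k : ℕ)
    (hJ : ∀ n, m - k ≤ n → n ≤ m - 1 → JacobiAt a V e u n) :
    |u m| ≤ (1 + M * (M + R)) ^ k * max |u (m - k - 1)| |u (m - k)| := by
  have := abs_le_pow_mul_max_right (fun n => a (1 - n)) (fun n => V (-n)) (fun n => u (-n)) e M R hM
    (fun n => ha _) (fun n => hV _) (-m) k (fun n h1 h2 => by
      have := (hJ (-n) (by linarith) (by linarith)).reflect
      rwa [neg_neg] at this)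
  simp only [neg_neg] at this
  rwa [show -(-m + (k : ℤ)) = m - k by ring, show -(-m + (k : ℤ) + 1) = m - k - 1 by ring,
    max_comm] at this

/-- Two eigenfunctions with different energies and nearly equal absolute values constrain the
potential near many sites of a window next to a site where they are not small. -/
theorem exists_pairNear_of_close (a V u v : ℤ → ℝ) (e e' c₀ M R η θ τ τ' h : ℝ) (hM : 0 < M)
    (hη : 0 ≤ η) (hθ : 0 < θ) (ha : ∀ n, 1 / M ≤ |a n| ∧ |a n| ≤ M)
    (huv : ∀ n, |u n ^ 2 - v n ^ 2| ≤ η ^ 2)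
    (hV : ∀ m, |V m - e| ≤ R ∧ |V m - e'| ≤ R) (hee : 0 < |e - e'|)
    (hsmall : (2 * M + R) * η < |e - e'| * θ)
    (hτ : (2 * M + R) * η * (1 + R + M + M / |e - e'|) / θ ≤ τ)
    (hc : |(e + e') / 2 - c₀| ≤ h) (hτ' : τ + h * (2 * R + h + 1) ≤ τ')
    (g K G : ℕ) (hG : g * K + 6 ≤ G) (m₀ : ℤ)
    (hlarge : (1 + M * (M + R)) ^ G * θ ≤ |u m₀|)
    (hJ : (∀ n, m₀ + 1 ≤ n → n ≤ m₀ + G → JacobiAt a V e u n ∧ JacobiAt a V e' v n) ∨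
      (∀ n, m₀ - G ≤ n → n ≤ m₀ - 1 → JacobiAt a V e u n ∧ JacobiAt a V e' v n)) :
    ∃ n₀ : ℤ, m₀ - G ≤ n₀ ∧ n₀ ≤ m₀ + G ∧ ∀ b : Fin K, ∃ j : Fin 3,
      PairNear c₀ (a (n₀ + g * b + j + 1)) τ' (V (n₀ + g * b + j)) (V (n₀ + g * b + j + 1)) := by
  have hR : 0 ≤ R := (abs_nonneg _).trans (hV 0).1
  have hρ : 1 ≤ 1 + M * (M + R) := by
    have : 0 ≤ M * (M + R) := by positivity
    linarith
  have hVc : ∀ m, |V m - (e + e') / 2| ≤ R := by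
    intro m
    have h1 := abs_le.1 (hV m).1
    have h2 := abs_le.1 (hV m).2
    rw [abs_le]; constructor <;> linarith
  have mono : ∀ {a x y τ₁ : ℝ}, PairNear c₀ a τ₁ x y → τ₁ ≤ τ' → PairNear c₀ a τ' x y :=
    fun h hle => h.imp (fun h => h.trans hle) (fun h => h.trans hle)
  have hGb : ∀ b : Fin K, g * (b : ℕ) + g + 6 ≤ G := by
    intro b
    have : g * (b : ℕ) + g ≤ g * K := by
      calc g * (b : ℕ) + g = g * (b + 1) := by ring
        _ ≤ g * K := Nat.mul_le_mul_left _ b.2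
    omega
  -- two neighbouring sites, one of which carries a large value
  have site : ∀ q : ℤ, θ ≤ max |u (q + 1)| |u (q + 2)| →
      (∀ n, q ≤ n → n ≤ q + 3 → JacobiAt a V e u n ∧ JacobiAt a V e' v n) →
      ∃ j : Fin 3, PairNear c₀ (a (q + j + 1)) τ' (V (q + j)) (V (q + j + 1)) := by
    intro q hq hJq
    rcases le_max_iff.1 hq with hq | hq
    · rcases pairNear_of_large a V u v e e' M R η θ τ hM.le hη hθ (fun n => (ha n).2) huv (q + 1)
        (fun m h1 h2 => hJq m (by linarith) (by linarith)) hV hee hsmall hq hτ with h | h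
      · exact ⟨1, mono (h.shift (hVc _) (hVc _) hc) hτ'⟩
      · rw [add_sub_cancel_right] at h
        refine ⟨0, mono ?_ hτ'⟩
        simpa using h.shift (hVc _) (hVc _) hc
    · rcases pairNear_of_large a V u v e e' M R η θ τ hM.le hη hθ (fun n => (ha n).2) huv (q + 2)
        (fun m h1 h2 => hJq m (by linarith) (by linarith)) hV hee hsmall hq hτ with h | h
      · exact ⟨2, mono (h.shift (hVc _) (hVc _) hc) hτ'⟩
      · rw [show q + 2 - 1 = q + 1 by ring] at h
        refine ⟨1, mono ?_ hτ'⟩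
        have h3 := h.shift (hVc _) (hVc _) hc
        rw [show q + 2 = q + 1 + 1 by ring] at h3
        exact h3
  have hpow : ∀ k : ℕ, k ≤ G → ∀ X : ℝ, 0 ≤ X → |u m₀| ≤ (1 + M * (M + R)) ^ k * X → θ ≤ X := by
    intro k hk X hX hle
    have h1 : (1 + M * (M + R)) ^ k * X ≤ (1 + M * (M + R)) ^ G * X :=
      mul_le_mul_of_nonneg_right (pow_le_pow_right₀ hρ hk) hX
    have h2 := hlarge.trans (hle.trans h1)
    exact le_of_mul_le_mul_left h2 (by positivity)
  rcases hJ with hJ | hJ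
  · refine ⟨m₀ + 1, by omega, by omega, fun b => ?_⟩
    have hb := hGb b
    refine site (m₀ + 1 + g * b) ?_ ?_
    · refine hpow (g * b + 2) (by omega) _ (le_max_of_le_left (abs_nonneg _)) ?_
      have := abs_le_pow_mul_max_right a V u e M R hM ha (fun n => (hV n).1) m₀ (g * b + 2)
        (fun n h1 h2 => (hJ n h1 (by push_cast at h2; zify at hb; linarith)).1)
      rw [show m₀ + ((g * b + 2 : ℕ) : ℤ) = m₀ + 1 + g * b + 1 by push_cast; ring,
        show m₀ + 1 + (g : ℤ) * b + 1 + 1 = m₀ + 1 + g * b + 2 by ring] at this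
      exact this
    · intro n h1 h2
      have h3 : (0 : ℤ) ≤ g * b := by positivity
      refine hJ n (by linarith) ?_
      zify at hb
      linarith
  -- The left window is counted upwards from its far end, so that both cases give progressions of
  -- the same form.
  · refine ⟨m₀ - G, by omega, by omega, fun b => ?_⟩
    have hb := hGb b
    refine site (m₀ - G + g * b) ?_ ?_
    · obtain ⟨k, hk⟩ : ∃ k : ℕ, g * (b : ℕ) + k + 2 = G := ⟨G - (g * b + 2), by omega⟩
      refine hpow k (by omega) _ (le_max_of_le_left (abs_nonneg _)) ?_
      have := abs_le_pow_mul_max_left a V u e M R hM ha (fun n => (hV n).1) m₀ k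
        (fun n h1 h2 => (hJ n (by zify at hk; nlinarith [show (0 : ℤ) ≤ g * b by positivity]) h2).1)
      refine this.trans (le_of_eq ?_)
      zify at hk
      congr 3 <;> congr 1 <;> linarith
    · intro n h1 h2
      have h3 : (0 : ℤ) ≤ g * b := by positivity
      zify at hb
      refine hJ n (by linarith) (by linarith)

/-! ### Probability of constraints along a progression of sites -/

/-- The potential `V` is constrained near each of the sites `n₀ + g * b`, `b < K`. -/
def ConstrainedFrom (a V : ℤ → ℝ) (c τ : ℝ) (g K : ℕ) (n₀ : ℤ) : Prop :=
  ∀ b : Fin K, ∃ j : Fin 3,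
    PairNear c (a (n₀ + g * b + j + 1)) τ (V (n₀ + g * b + j)) (V (n₀ + g * b + j + 1))

/-- A union bound over the offsets in `Fin 3` costs `3 ^ K`, absorbed in the constant. The gap is
enlarged by `2` so that the sites stay separated whatever the offsets. -/
theorem exists_measure_constrainedFrom_le {Ω : Type*} [MeasurableSpace Ω] (P : Measure Ω)
    [IsProbabilityMeasure P] (ω : ℤ → Ω → ℝ) (B : NNReal) (S : ℝ) (hω : BoundedIndep P ω B S)
    (d : ℤ → ℝ) (hd : ∃ n, d n ≠ 0) (hds : Summable fun n => |d n|) (a : ℤ → ℝ) (M : ℝ)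
    (hM : 0 < M) (ha : ∀ n, 1 / M ≤ |a n|) (c : ℝ) :
    ∃ (g : ℕ) (C τ₀ : ℝ), 0 < C ∧ 0 < τ₀ ∧ ∀ (F : Finset ℤ) (K : ℕ) (τ : ℝ), 0 < τ → τ ≤ τ₀ →
      P {w | ∃ n₀ ∈ F, ConstrainedFrom a (alloyPotential d fun n => ω n w) c τ g K n₀}
        ≤ F.card * ENNReal.ofReal ((C * τ) ^ K) := by
  obtain ⟨g, C, τ₀, hg, hC, hτ₀, h⟩ := exists_measure_pairNear_le P ω B S hω d hd hds a M hM ha c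
  refine ⟨g + 2, 3 * C, τ₀, by positivity, hτ₀, fun F K τ hτ hττ₀ => ?_⟩
  have h1 : ∀ n₀ : ℤ, P {w | ConstrainedFrom a (alloyPotential d fun n => ω n w) c τ (g + 2) K n₀}
      ≤ ENNReal.ofReal ((3 * C * τ) ^ K) := by
    intro n₀
    have hsub : {w | ConstrainedFrom a (alloyPotential d fun n => ω n w) c τ (g + 2) K n₀}
        ⊆ ⋃ f : Fin K → Fin 3, {w | ∀ b, PairNear c (a ((n₀ + (g + 2 : ℕ) * b + f b) + 1)) τ
          (alloyPotential d (fun n => ω n w) (n₀ + (g + 2 : ℕ) * b + f b))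
          (alloyPotential d (fun n => ω n w) ((n₀ + (g + 2 : ℕ) * b + f b) + 1))} := by
      intro w hw
      choose f hf using hw
      exact Set.mem_iUnion.2 ⟨f, hf⟩
    refine (measure_mono hsub).trans ((measure_iUnion_le _).trans ?_)
    rw [tsum_fintype]
    calc _ ≤ ∑ _f : Fin K → Fin 3, ENNReal.ofReal ((C * τ) ^ K) := by
          refine Finset.sum_le_sum fun f _ => h K _ (fun b b' hb => ?_) τ hτ hττ₀
          have e : (n₀ + ((g + 2 : ℕ) : ℤ) * b + f b) - (n₀ + ((g + 2 : ℕ) : ℤ) * b' + f b')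
              = (g + 2) * ((b : ℤ) - b') + ((f b : ℤ) - f b') := by push_cast; ring
          rw [e]
          have hf1 : (f b : ℤ) - f b' ≤ 2 ∧ -2 ≤ (f b : ℤ) - f b' := by
            have := (f b).2; have := (f b').2; omega
          have hg0 : (0 : ℤ) ≤ (g : ℤ) + 2 := by positivity
          have hbb : (b : ℕ) ≠ b' := fun h => hb (Fin.ext h)
          rcases lt_or_gt_of_ne hbb with hlt | hlt
          · have : (b : ℤ) - b' ≤ -1 := by omega
            have := mul_le_mul_of_nonneg_left this hg0
            refine le_trans ?_ (neg_le_abs _)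
            linarith [hf1.1]
          · have : (1 : ℤ) ≤ (b : ℤ) - b' := by omega
            have := mul_le_mul_of_nonneg_left this hg0
            refine le_trans ?_ (le_abs_self _)
            linarith [hf1.2]
      _ = _ := by
          rw [Finset.sum_const, Finset.card_univ, Fintype.card_fun, Fintype.card_fin,
            Fintype.card_fin, nsmul_eq_mul, ← ENNReal.ofReal_natCast,
            ← ENNReal.ofReal_mul (by positivity)]
          congr 1
          push_cast
          rw [← mul_pow]; ring
  have hsub : {w | ∃ n₀ ∈ F, ConstrainedFrom a (alloyPotential d fun n => ω n w) c τ (g + 2) K n₀}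
      ⊆ ⋃ n₀ ∈ F,
        {w | ConstrainedFrom a (alloyPotential d fun n => ω n w) c τ (g + 2) K n₀} := by
    rintro w ⟨n₀, hn₀, hw⟩
    exact Set.mem_biUnion hn₀ hw
  refine (measure_mono hsub).trans ((measure_biUnion_finset_le _ _).trans ?_)
  refine (Finset.sum_le_sum fun n₀ _ => h1 n₀).trans (le_of_eq ?_)
  rw [Finset.sum_const, nsmul_eq_mul]

/-! ### Restriction of the operator to a set of sites of the box -/

section SubBox

variable {l : ℕ}

/-- The restriction of the box operator to a set of sites. -/
def subBox (bc : BoundaryCondition) (a V : ℤ → ℝ) (Λ : Finset (Fin l)) : Matrix Λ Λ ℝ :=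
  (boxOperator bc a V l).submatrix Subtype.val Subtype.val

theorem subBox_isSelfAdjoint (bc : BoundaryCondition) (a V : ℤ → ℝ) (Λ : Finset (Fin l)) :
    IsSelfAdjoint (subBox bc a V Λ) :=
  Matrix.IsHermitian.submatrix (boxOperator_isSelfAdjoint bc a V l) _

/-- The site of the index `x` in the canonical basis of the box. -/
def boxSite (x : Fin l) : ℤ := (x : ℤ) + 1

theorem boxSite_injective : Function.Injective (boxSite : Fin l → ℤ) := by
  intro x y h
  simp only [boxSite] at h
  exact Fin.ext (by omega)

/-- Extension by zero of a function on a set of sites of the box. -/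
def extendZero (Λ : Finset (Fin l)) (u : Λ → ℝ) (m : ℤ) : ℝ :=
  ∑ x : Λ, if boxSite x.1 = m then u x else 0

theorem extendZero_site (Λ : Finset (Fin l)) (u : Λ → ℝ) (x : Λ) :
    extendZero Λ u (boxSite x.1) = u x := by
  unfold extendZero
  rw [Finset.sum_eq_single x]
  · simp
  · intro y _ hy
    rw [if_neg]
    exact fun h => hy (Subtype.ext (boxSite_injective h))
  · simp

theorem extendZero_eq_zero (Λ : Finset (Fin l)) (u : Λ → ℝ) (m : ℤ)
    (hm : m ∉ Λ.image boxSite) : extendZero Λ u m = 0 := by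
  unfold extendZero
  refine Finset.sum_eq_zero fun x _ => if_neg fun h => hm ?_
  exact Finset.mem_image.2 ⟨x.1, x.2, h⟩

/-- Away from the two end sites the periodic bond is not seen, and neighbours outside `Λ` carry the
value zero; so both boundary conditions lead to the same recurrence at the sites of `Λ`. -/
theorem subBox_mulVec_interior (bc : BoundaryCondition) (a V : ℤ → ℝ) (Λ : Finset (Fin l))
    (u : Λ → ℝ) (x : Λ) (h1 : 1 ≤ (x.1 : ℕ)) (h2 : (x.1 : ℕ) + 2 ≤ l) :
    (subBox bc a V Λ).mulVec u x = a (boxSite x.1 + 1) * extendZero Λ u (boxSite x.1 + 1)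
      + a (boxSite x.1) * extendZero Λ u (boxSite x.1 - 1) + V (boxSite x.1) * u x := by
  have hrow : ∀ y : Λ, subBox bc a V Λ x y =
      (if x = y then V (boxSite x.1) else 0)
      + (if boxSite y.1 = boxSite x.1 + 1 then a (boxSite x.1 + 1) else 0)
      + (if boxSite y.1 = boxSite x.1 - 1 then a (boxSite x.1) else 0) := by
    intro y
    have e1 : (x.1 = y.1) ↔ x = y := Subtype.ext_iff.symm
    have e2 : ((y.1 : ℕ) = (x.1 : ℕ) + 1) ↔ boxSite y.1 = boxSite x.1 + 1 := by
      simp only [boxSite]; omega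
    have e3 : ((x.1 : ℕ) = (y.1 : ℕ) + 1) ↔ boxSite y.1 = boxSite x.1 - 1 := by
      simp only [boxSite]; omega
    have e4 : ((x.1 : ℤ) + 2) = boxSite x.1 + 1 := by simp only [boxSite]; ring
    simp only [subBox, Matrix.submatrix_apply, boxOperator, e1, e2, e3, e4]
    cases bc
    · simp only [add_zero]; rfl
    · rw [if_neg (show ¬((x.1 : ℕ) + 1 = l ∧ (y.1 : ℕ) = 0) by omega),
        if_neg (show ¬((x.1 : ℕ) = 0 ∧ (y.1 : ℕ) + 1 = l) by omega)]
      simp only [add_zero]; rfl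
  simp only [Matrix.mulVec, dotProduct, hrow, add_mul, Finset.sum_add_distrib, ite_mul, zero_mul]
  rw [Finset.sum_ite_eq Finset.univ x]
  simp only [Finset.mem_univ, if_true]
  unfold extendZero
  simp only [Finset.mul_sum, mul_ite, mul_zero]
  ring

theorem jacobiAt_extendZero (bc : BoundaryCondition) (a V : ℤ → ℝ) (Λ : Finset (Fin l))
    (u : Λ → ℝ) (e : ℝ) (hu : (subBox bc a V Λ).mulVec u = e • u) (x : Fin l) (hx : x ∈ Λ)
    (h1 : 1 ≤ (x : ℕ)) (h2 : (x : ℕ) + 2 ≤ l) :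
    JacobiAt a V e (extendZero Λ u) (boxSite x) := by
  have h := subBox_mulVec_interior bc a V Λ u ⟨x, hx⟩ h1 h2
  have h3 := extendZero_site Λ u ⟨x, hx⟩
  rw [hu] at h
  simp only [Pi.smul_apply, smul_eq_mul] at h h3
  unfold JacobiAt
  rw [h3, h]

/-- Every site of `Λ` is the end point of an interval of length `G` of sites of `Λ`, which does not
reach the other end of the box. -/
def IsThick (Λ : Finset (Fin l)) (G : ℕ) : Prop :=
  ∀ x ∈ Λ, ((x : ℕ) + G + 2 ≤ l ∧ ∀ y : Fin l, (x : ℕ) ≤ y → (y : ℕ) ≤ x + G → y ∈ Λ) ∨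
    (G + 1 ≤ (x : ℕ) ∧ ∀ y : Fin l, (x : ℕ) ≤ y + G → (y : ℕ) ≤ x → y ∈ Λ)

/-- A unit vector on `Λ` has a site with `|u| ≥ 1 / card Λ`. Thickness provides a window of length
`G` inside `Λ` next to this site, on which the recurrence holds and the argument with the twisted
bonds applies. -/
theorem exists_constrainedFrom_of_close (bc : BoundaryCondition) (a V : ℤ → ℝ) (Λ : Finset (Fin l))
    (u v : Λ → ℝ) (e e' c₀ M R η τ h : ℝ) (g K G : ℕ)
    (hu : ∑ x, u x ^ 2 = 1) (hue : (subBox bc a V Λ).mulVec u = e • u)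
    (hve : (subBox bc a V Λ).mulVec v = e' • v) (hM : 0 < M) (hη : 0 ≤ η)
    (ha : ∀ n, 1 / M ≤ |a n| ∧ |a n| ≤ M) (huv : ∀ x, |u x ^ 2 - v x ^ 2| ≤ η ^ 2)
    (hV : ∀ m, |V m - e| ≤ R ∧ |V m - e'| ≤ R) (hee : 0 < |e - e'|)
    (hsmall : (2 * M + R) * η * ((1 + M * (M + R)) ^ G * Λ.card) < |e - e'|)
    (hc : |(e + e') / 2 - c₀| ≤ h)
    (hτ : (2 * M + R) * η * (1 + R + M + M / |e - e'|) * ((1 + M * (M + R)) ^ G * Λ.card)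
      + h * (2 * R + h + 1) ≤ τ)
    (hG : g * K + 6 ≤ G) (hΛ : IsThick Λ G) :
    ∃ n₀ ∈ Finset.Icc (-(G : ℤ)) (l + G), ConstrainedFrom a V c₀ τ g K n₀ := by
  have hR : 0 ≤ R := (abs_nonneg _).trans (hV 0).1
  have hne : Nonempty Λ := by
    by_contra hcon
    rw [not_nonempty_iff] at hcon
    simp at hu
  have hcard : (0 : ℝ) < Λ.card := by
    obtain ⟨x⟩ := hne
    exact_mod_cast Finset.card_pos.2 ⟨x.1, x.2⟩
  obtain ⟨x, hx⟩ : ∃ x, 1 / (Λ.card : ℝ) ≤ u x ^ 2 := by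
    by_contra hcon
    push Not at hcon
    have : ∑ x, u x ^ 2 < ∑ _x : Λ, 1 / (Λ.card : ℝ) :=
      Finset.sum_lt_sum_of_nonempty Finset.univ_nonempty fun x _ => hcon x
    rw [hu, Finset.sum_const, Finset.card_univ, Fintype.card_coe, nsmul_eq_mul,
      mul_one_div_cancel hcard.ne'] at this
    exact lt_irrefl _ this
  have hux : 1 / (Λ.card : ℝ) ≤ |u x| := by
    have hle1 : |u x| ≤ 1 := by
      rw [← sq_le_one_iff_abs_le_one, ← hu]
      exact Finset.single_le_sum (f := fun x => u x ^ 2) (fun _ _ => sq_nonneg _)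
        (Finset.mem_univ x)
    refine hx.trans ?_
    rw [← sq_abs, sq]
    exact mul_le_of_le_one_left (abs_nonneg _) hle1
  set ρ := 1 + M * (M + R) with hρ
  have hρ0 : 0 < ρ := by positivity
  -- What the transfer matrices leave of the lower bound `1 / card Λ` after `G` steps.
  set θ := 1 / (ρ ^ G * Λ.card) with hθ
  have hθ0 : 0 < θ := by positivity
  have huv' : ∀ n, |extendZero Λ u n ^ 2 - extendZero Λ v n ^ 2| ≤ η ^ 2 := by
    intro n
    by_cases hn : n ∈ Λ.image boxSite
    · obtain ⟨y, hy, rfl⟩ := Finset.mem_image.1 hn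
      have e1 := extendZero_site Λ u ⟨y, hy⟩
      have e2 := extendZero_site Λ v ⟨y, hy⟩
      simp only at e1 e2
      rw [e1, e2]
      exact huv _
    · rw [extendZero_eq_zero _ _ _ hn, extendZero_eq_zero _ _ _ hn]
      simp; positivity
  have hJall : ∀ y : Fin l, y ∈ Λ → 1 ≤ (y : ℕ) → (y : ℕ) + 2 ≤ l →
      JacobiAt a V e (extendZero Λ u) (boxSite y) ∧ JacobiAt a V e' (extendZero Λ v) (boxSite y) :=
    fun y hy h1 h2 => ⟨jacobiAt_extendZero bc a V Λ u e hue y hy h1 h2,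
      jacobiAt_extendZero bc a V Λ v e' hve y hy h1 h2⟩
  have hJn : ∀ n : ℤ, 2 ≤ n → n + 1 ≤ l → (∀ y : Fin l, (y : ℤ) + 1 = n → y ∈ Λ) →
      JacobiAt a V e (extendZero Λ u) n ∧ JacobiAt a V e' (extendZero Λ v) n := by
    intro n h1 h2 h3
    obtain ⟨y, rfl⟩ : ∃ y : Fin l, boxSite y = n :=
      ⟨⟨(n - 1).toNat, by omega⟩, by simp only [boxSite]; omega⟩
    simp only [boxSite] at h1 h2
    exact hJall y (h3 y rfl) (by omega) (by omega)
  have hxl := x.1.2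
  obtain ⟨n₀, hn1, hn2, hn3⟩ := exists_pairNear_of_close a V (extendZero Λ u) (extendZero Λ v) e e' c₀
    M R η θ ((2 * M + R) * η * (1 + R + M + M / |e - e'|) / θ) τ h hM hη hθ0 ha huv' hV hee
    (by rw [hθ, mul_one_div, lt_div_iff₀ (by positivity)]; exact hsmall) le_rfl hc
    (by rw [hθ, div_div_eq_mul_div, div_one]; exact hτ) g K G hG (boxSite x.1)
    (by
      rw [extendZero_site]
      refine le_trans (le_of_eq ?_) hux
      rw [hθ]; field_simp; rw [hρ])
    (by
      rcases hΛ x.1 x.2 with ⟨hx1, hx2⟩ | ⟨hx1, hx2⟩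
      · left
        intro n h1 h2
        simp only [boxSite] at h1 h2
        refine hJn n (by omega) (by omega) fun y hy => hx2 y (by omega) (by omega)
      · right
        intro n h1 h2
        simp only [boxSite] at h1 h2
        refine hJn n (by omega) (by omega) fun y hy => hx2 y (by omega) (by omega))
  refine ⟨n₀, Finset.mem_Icc.2 ?_, hn3⟩
  simp only [boxSite] at hn1 hn2
  constructor <;> omega

end SubBox

/-! ### Linear independence of the gradients of two eigenvalues -/

section Gradient

/-- Summing the minors over `j` gives `p i * Q - R * q i`, with `R`, `Q` the total masses of `p` and
`q`. Since these masses are nearly equal, the sum over `i` of its absolute value is at least `Q`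
times the `ℓ¹` distance of `p` and `q`, up to the error `|R - Q| * Q`. One of the `T.card ^ 2`
minors is at least the average. -/
theorem exists_le_abs_det {ι : Type*} (T : Finset ι) (p q : ι → ℝ) (A ε t : ℝ)
    (hq : ∀ i ∈ T, 0 ≤ q i) (hA0 : 0 < A) (hA : A ≤ ∑ i ∈ T, q i)
    (hpq : |∑ i ∈ T, p i - ∑ i ∈ T, q i| ≤ t) (hε : ε + t ≤ ∑ i ∈ T, |p i - q i|) (hε0 : 0 ≤ ε) :
    ∃ i ∈ T, ∃ j ∈ T, A * ε / (T.card : ℝ) ^ 2 ≤ |p i * q j - p j * q i| := by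
  set Q := ∑ i ∈ T, q i with hQ
  set R := ∑ i ∈ T, p i with hR
  have hT : T.Nonempty := by
    rw [Finset.nonempty_iff_ne_empty]
    rintro rfl
    simp at hQ
    linarith
  have hcard : (0 : ℝ) < T.card := by exact_mod_cast Finset.card_pos.2 hT
  have h1 : A * ε ≤ ∑ i ∈ T, ∑ j ∈ T, |p i * q j - p j * q i| := by
    calc A * ε ≤ Q * ε := mul_le_mul_of_nonneg_right hA hε0
      _ ≤ Q * ∑ i ∈ T, |p i - q i| - |R - Q| * Q := by
          have hQ0 : 0 ≤ Q := by linarith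
          nlinarith [mul_le_mul_of_nonneg_right hpq hQ0, mul_le_mul_of_nonneg_left hε hQ0]
      _ = ∑ i ∈ T, (Q * |p i - q i| - |R - Q| * q i) := by
          rw [Finset.sum_sub_distrib, Finset.mul_sum, ← Finset.mul_sum _ _ (|R - Q|)]
      _ ≤ ∑ i ∈ T, |p i * Q - R * q i| := by
          refine Finset.sum_le_sum fun i hi => ?_
          have e : p i * Q - R * q i = Q * (p i - q i) - (R - Q) * q i := by ring
          rw [e]
          refine le_trans (le_of_eq ?_) (abs_sub_abs_le_abs_sub _ _)
          rw [abs_mul, abs_mul, abs_of_nonneg (hq i hi), abs_of_nonneg (by linarith : 0 ≤ Q)]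
      _ ≤ _ := by
          refine Finset.sum_le_sum fun i _ => ?_
          rw [hQ, hR, Finset.mul_sum, Finset.sum_mul, ← Finset.sum_sub_distrib]
          exact Finset.abs_sum_le_sum_abs _ _
  by_contra hcon
  push Not at hcon
  have h2 : ∑ i ∈ T, ∑ j ∈ T, |p i * q j - p j * q i|
      < ∑ _i ∈ T, ∑ _j ∈ T, A * ε / (T.card : ℝ) ^ 2 :=
    Finset.sum_lt_sum_of_nonempty hT fun i hi =>
      Finset.sum_lt_sum_of_nonempty hT fun j hj => hcon i hi j hj
  have h3 : ∑ _i ∈ T, ∑ _j ∈ T, A * ε / (T.card : ℝ) ^ 2 = A * ε := by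
    simp only [Finset.sum_const, nsmul_eq_mul]
    field_simp
  linarith

theorem sum_smear_le {X : Type*} [Fintype X] (d : ℤ → ℝ) (s : X → ℤ) (w : X → ℝ)
    (hw0 : ∀ x, 0 ≤ w x) (hw1 : ∑ x, w x = 1) (F : Finset ℤ) (t : ℝ)
    (h : ∀ x, ∑ i ∈ F, d (i - s x) ≤ t) : ∑ i ∈ F, ∑ x, d (i - s x) * w x ≤ t := by
  rw [Finset.sum_comm]
  calc _ = ∑ x, (∑ i ∈ F, d (i - s x)) * w x := by simp only [Finset.sum_mul]
    _ ≤ ∑ x, t * w x := Finset.sum_le_sum fun x _ => mul_le_mul_of_nonneg_right (h x) (hw0 x)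
    _ = t := by rw [← Finset.mul_sum, hw1, mul_one]

theorem le_sum_smear {X : Type*} [Fintype X] (d : ℤ → ℝ) (s : X → ℤ) (w : X → ℝ)
    (hw0 : ∀ x, 0 ≤ w x) (hw1 : ∑ x, w x = 1) (F : Finset ℤ) (t : ℝ)
    (h : ∀ x, t ≤ ∑ i ∈ F, d (i - s x)) : t ≤ ∑ i ∈ F, ∑ x, d (i - s x) * w x := by
  rw [Finset.sum_comm]
  calc t = ∑ x, t * w x := by rw [← Finset.mul_sum, hw1, mul_one]
    _ ≤ ∑ x, (∑ i ∈ F, d (i - s x)) * w x :=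
        Finset.sum_le_sum fun x _ => mul_le_mul_of_nonneg_right (h x) (hw0 x)
    _ = _ := by simp only [Finset.sum_mul]

/-- The sites within distance `r` of a set of sites of the box. -/
def siteNhd {l : ℕ} (Λ : Finset (Fin l)) (r : ℕ) : Finset ℤ :=
  Λ.biUnion fun x => Finset.Icc (boxSite x - r) (boxSite x + r)

theorem card_siteNhd_le {l : ℕ} (Λ : Finset (Fin l)) (r : ℕ) :
    (siteNhd Λ r).card ≤ Λ.card * (2 * r + 1) := by
  unfold siteNhd
  refine Finset.card_biUnion_le_card_mul _ _ _ fun x _ => ?_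
  rw [Int.card_Icc]
  omega

theorem convOn_extendZero {l : ℕ} (d : ℤ → ℝ) (Λ : Finset (Fin l)) (u v : Λ → ℝ) (i : ℤ) :
    convOn d (Λ.image boxSite) (fun m => extendZero Λ u m ^ 2 - extendZero Λ v m ^ 2) i
      = ∑ x : Λ, d (i - boxSite x.1) * u x ^ 2 - ∑ x : Λ, d (i - boxSite x.1) * v x ^ 2 := by
  unfold convOn
  rw [Finset.sum_image fun x _ y _ h => boxSite_injective h, ← Finset.sum_sub_distrib,
    ← Finset.sum_coe_sort]
  refine Finset.sum_congr rfl fun x _ => ?_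
  simp only [extendZero_site]
  ring

/-- If the densities of two unit vectors are not close to each other, then the pairs of their
responses to two of the single-site potentials are quantitatively linearly independent. -/
theorem exists_le_abs_det_of_not_close {l : ℕ} (d : ℤ → ℝ) (hd0 : ∀ n, 0 ≤ d n) (hds : Summable d)
    (c : ℝ) (N : ℕ) (hc : 0 < c)
    (hconv : ∀ (S : Finset ℤ) (f : ℤ → ℝ), (∀ m ∉ S, f m = 0) →
      ∀ B : ℝ, (∀ F : Finset ℤ, ∑ i ∈ F, |convOn d S f i| ≤ B) →
        ∀ m, |f m| ≤ c * (S.card : ℝ) ^ N * B)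
    (Λ : Finset (Fin l)) (u v : Λ → ℝ) (hu : ∑ x, u x ^ 2 = 1) (hv : ∑ x, v x ^ 2 = 1)
    (ρ : ℝ) (hρ0 : 0 < ρ) (hρ : ∃ x, ρ < |u x ^ 2 - v x ^ 2|) (r : ℕ) (t : ℝ)
    (ht : ∀ F : Finset ℤ, (∀ n ∈ F, (r : ℤ) < |n|) → ∑ n ∈ F, d n ≤ t)
    (htD : 2 * t ≤ ∑' n, d n) (hD : 0 < ∑' n, d n)
    (htρ : 6 * t ≤ ρ / (c * (Λ.card : ℝ) ^ N)) :
    ∃ i ∈ siteNhd Λ r, ∃ j ∈ siteNhd Λ r,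
      (∑' n, d n) * ρ / (4 * c * (Λ.card : ℝ) ^ N * ((siteNhd Λ r).card : ℝ) ^ 2) ≤
      |(∑ x : Λ, d (i - boxSite x.1) * u x ^ 2) * (∑ x : Λ, d (j - boxSite x.1) * v x ^ 2)
        - (∑ x : Λ, d (j - boxSite x.1) * u x ^ 2) * (∑ x : Λ, d (i - boxSite x.1) * v x ^ 2)| := by
  obtain ⟨x₀, hx₀⟩ := hρ
  have hn : (0 : ℝ) < Λ.card := by exact_mod_cast Finset.card_pos.2 ⟨x₀.1, x₀.2⟩
  set D := ∑' n, d n with hDdef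
  set B := ρ / (c * (Λ.card : ℝ) ^ N) with hB
  have hB0 : 0 < B := by positivity
  set T := siteNhd Λ r with hT
  set p : ℤ → ℝ := fun i => ∑ x : Λ, d (i - boxSite x.1) * u x ^ 2 with hp
  set q : ℤ → ℝ := fun i => ∑ x : Λ, d (i - boxSite x.1) * v x ^ 2 with hq
  have ht0 : 0 ≤ t := by simpa using ht ∅ (by simp)
  have hp0 : ∀ i, 0 ≤ p i := fun i =>
    Finset.sum_nonneg fun x _ => mul_nonneg (hd0 _) (sq_nonneg _)
  have hq0 : ∀ i, 0 ≤ q i := fun i =>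
    Finset.sum_nonneg fun x _ => mul_nonneg (hd0 _) (sq_nonneg _)
  have hshift : ∀ (F : Finset ℤ) (y : ℤ),
      ∑ i ∈ F, d (i - y) = ∑ n ∈ F.map (Equiv.subRight y).toEmbedding, d n := by
    intro F y
    rw [Finset.sum_map]; rfl
  have htot : ∀ (F : Finset ℤ), ∑ n ∈ F, d n ≤ D := fun F =>
    hds.sum_le_tsum F fun n _ => hd0 n
  have hcore : D - t ≤ ∑ n ∈ Finset.Icc (-(r : ℤ)) r, d n := by
    rw [sub_le_iff_le_add]
    refine Real.tsum_le_of_sum_le hd0 fun F => ?_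
    rw [← Finset.sum_filter_add_sum_filter_not F fun n => n ∈ Finset.Icc (-(r : ℤ)) r]
    refine add_le_add (Finset.sum_le_sum_of_subset_of_nonneg
      (fun n hn => (Finset.mem_filter.1 hn).2) fun n _ _ => hd0 n) (ht _ fun n hn => ?_)
    have := (Finset.mem_filter.1 hn).2
    rw [Finset.mem_Icc, ← abs_le] at this
    exact not_le.1 this
  have hlow : ∀ x : Λ, D - t ≤ ∑ i ∈ T, d (i - boxSite x.1) := by
    intro x
    refine hcore.trans ?_
    rw [hshift]
    refine Finset.sum_le_sum_of_subset_of_nonneg (fun n hn => ?_) fun n _ _ => hd0 n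
    rw [Finset.mem_map]
    refine ⟨n + boxSite x.1, Finset.mem_biUnion.2 ⟨x.1, x.2, ?_⟩, by simp⟩
    rw [Finset.mem_Icc] at hn ⊢
    omega
  have hup : ∀ x : Λ, ∑ i ∈ T, d (i - boxSite x.1) ≤ D := by
    intro x
    rw [hshift]
    exact htot _
  have htail : ∀ (F : Finset ℤ) (x : Λ), ∑ i ∈ F \ T, d (i - boxSite x.1) ≤ t := by
    intro F x
    rw [hshift]
    refine ht _ fun n hn => ?_
    rw [Finset.mem_map] at hn
    obtain ⟨i, hi, rfl⟩ := hn
    rw [Finset.mem_sdiff] at hi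
    by_contra hcon
    refine hi.2 (Finset.mem_biUnion.2 ⟨x.1, x.2, ?_⟩)
    simp only [Equiv.coe_toEmbedding, Equiv.subRight_apply, not_lt] at hcon
    rw [abs_le] at hcon
    rw [Finset.mem_Icc]
    omega
  have hu0 : ∀ x : Λ, 0 ≤ u x ^ 2 := fun x => sq_nonneg _
  have hv0 : ∀ x : Λ, 0 ≤ v x ^ 2 := fun x => sq_nonneg _
  have hPl := le_sum_smear d (fun x : Λ => boxSite x.1) _ hu0 hu T _ hlow
  have hQl := le_sum_smear d (fun x : Λ => boxSite x.1) _ hv0 hv T _ hlow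
  have hPu := sum_smear_le d (fun x : Λ => boxSite x.1) _ hu0 hu T _ hup
  have hQu := sum_smear_le d (fun x : Λ => boxSite x.1) _ hv0 hv T _ hup
  -- `p - q` is the convolution of `d` with `u ^ 2 - v ^ 2`. If all its partial `ℓ¹` sums were at
  -- most `B`, the lower bound for convolutions would contradict the gap at `x₀`.
  obtain ⟨F, hF⟩ : ∃ F : Finset ℤ, B < ∑ i ∈ F, |p i - q i| := by
    by_contra hcon
    push Not at hcon
    have h := hconv (Λ.image boxSite) (fun m => extendZero Λ u m ^ 2 - extendZero Λ v m ^ 2)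
      (fun m hm => by
        rw [extendZero_eq_zero _ _ _ hm, extendZero_eq_zero _ _ _ hm]; simp) B
      (fun F => by simpa only [convOn_extendZero] using hcon F) (boxSite x₀.1)
    rw [extendZero_site, extendZero_site, Finset.card_image_of_injective _ boxSite_injective,
      hB, mul_div_cancel₀ _ (by positivity)] at h
    exact absurd h (not_le.2 hx₀)
  have hsum : B - 2 * t ≤ ∑ i ∈ T, |p i - q i| := by
    have h1 := Finset.sum_inter_add_sum_sdiff F T fun i => |p i - q i|
    have h2 : ∑ i ∈ F ∩ T, |p i - q i| ≤ ∑ i ∈ T, |p i - q i| :=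
      Finset.sum_le_sum_of_subset_of_nonneg Finset.inter_subset_right fun _ _ _ => abs_nonneg _
    have h3 : ∑ i ∈ F \ T, |p i - q i| ≤ ∑ i ∈ F \ T, p i + ∑ i ∈ F \ T, q i := by
      rw [← Finset.sum_add_distrib]
      refine Finset.sum_le_sum fun i _ => ?_
      rw [abs_le]
      constructor <;> linarith [hp0 i, hq0 i]
    have h4 := sum_smear_le d (fun x : Λ => boxSite x.1) _ hu0 hu (F \ T) _ (htail F)
    have h5 := sum_smear_le d (fun x : Λ => boxSite x.1) _ hv0 hv (F \ T) _ (htail F)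
    linarith
  -- Truncation to `T` loses at most `t` of each mass, and `2 t` of the distance. So `2 t ≤ D` keeps
  -- the mass `D / 2`, and `6 t ≤ B` keeps `B / 2` beyond the imbalance `t`.
  obtain ⟨i, hi, j, hj, hij⟩ := exists_le_abs_det T p q (D / 2) (B / 2) t (fun i _ => hq0 i)
    (by linarith) (by linarith) (by rw [abs_le]; constructor <;> linarith) (by linarith)
    (by linarith)
  refine ⟨i, hi, j, hj, le_trans (le_of_eq ?_) hij⟩
  rw [hB]
  field_simp
  norm_num

end Gradient

/-! ### Probability of a resonance with independent gradients -/

section Resonance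

variable {n : Type*} [Fintype n]

/-- The witnesses range over a compact set and satisfy closed conditions, so the projection is
closed. This gives the measurability of the event in spite of its existential form. -/
theorem isClosed_resonantPair (E E' h δ : ℝ) (α b : n → ℝ) :
    IsClosed {g : n → n → ℝ | ResonantPair E E' h δ α b (Matrix.of g)} := by
  set Kc : Set (ℝ × ℝ × (n → ℝ) × (n → ℝ)) :=
    {q | |q.1 - E| ≤ h ∧ |q.2.1 - E'| ≤ h ∧ ∑ x, q.2.2.1 x ^ 2 = 1 ∧ ∑ x, q.2.2.2 x ^ 2 = 1}
    with hKc
  have hunit : ∀ u : n → ℝ, ∑ x, u x ^ 2 = 1 → u ∈ Metric.closedBall (0 : n → ℝ) 1 := by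
    intro u hu
    rw [mem_closedBall_zero_iff, pi_norm_le_iff_of_nonneg zero_le_one]
    intro x
    rw [Real.norm_eq_abs, ← sq_le_one_iff_abs_le_one]
    exact hu ▸ Finset.single_le_sum (f := fun x => u x ^ 2) (fun x _ => sq_nonneg _)
      (Finset.mem_univ x)
  have hcpt : IsCompact Kc := by
    refine IsCompact.of_isClosed_subset (s := Metric.closedBall E h ×ˢ Metric.closedBall E' h ×ˢ
      Metric.closedBall (0 : n → ℝ) 1 ×ˢ Metric.closedBall (0 : n → ℝ) 1) ?_ ?_ ?_
    · exact (isCompact_closedBall _ _).prod ((isCompact_closedBall _ _).prod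
        ((isCompact_closedBall _ _).prod (isCompact_closedBall _ _)))
    · simp only [hKc, Set.ofPred_and]
      refine IsClosed.inter (isClosed_le ?_ continuous_const) (IsClosed.inter
        (isClosed_le ?_ continuous_const) (IsClosed.inter
        (isClosed_eq ?_ continuous_const) (isClosed_eq ?_ continuous_const))) <;> fun_prop
    · rintro q ⟨h1, h2, h3, h4⟩
      exact ⟨h1, h2, hunit _ h3, hunit _ h4⟩
  have : CompactSpace Kc := isCompact_iff_compactSpace.1 hcpt
  set Z : Set ((n → n → ℝ) × Kc) := {z | (Matrix.of z.1).mulVec z.2.1.2.2.1 = z.2.1.1 • z.2.1.2.2.1 ∧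
    (Matrix.of z.1).mulVec z.2.1.2.2.2 = z.2.1.2.1 • z.2.1.2.2.2 ∧
    δ ≤ |(∑ x, α x * z.2.1.2.2.1 x ^ 2) * (∑ x, b x * z.2.1.2.2.2 x ^ 2)
      - (∑ x, b x * z.2.1.2.2.1 x ^ 2) * (∑ x, α x * z.2.1.2.2.2 x ^ 2)|} with hZ
  have hZc : IsClosed Z := by
    simp only [hZ, Set.ofPred_and]
    refine IsClosed.inter (isClosed_eq ?_ (by fun_prop)) (IsClosed.inter
      (isClosed_eq ?_ (by fun_prop)) (isClosed_le continuous_const ?_))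
    · refine continuous_pi fun x => ?_
      simp only [Matrix.mulVec, dotProduct, Matrix.of_apply]
      fun_prop
    · refine continuous_pi fun x => ?_
      simp only [Matrix.mulVec, dotProduct, Matrix.of_apply]
      fun_prop
    · fun_prop
  have := isClosedMap_fst_of_compactSpace Z hZc
  convert this using 1
  ext g
  constructor
  · rintro ⟨e, e', u, v, hu, hv, h1, h2, h3, h4, h5⟩
    exact ⟨(g, ⟨(e, e', u, v), h3, h4, hu, hv⟩), ⟨h1, h2, h5⟩, rfl⟩
  · rintro ⟨⟨g', ⟨⟨e, e', u, v⟩, h3, h4, hu, hv⟩⟩, ⟨h1, h2, h5⟩, rfl⟩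
    exact ⟨e, e', u, v, hu, hv, h1, h2, h3, h4, h5⟩

theorem measurableSet_resonantPair {Y : Type*} [MeasurableSpace Y] (E E' h δ : ℝ) (α b : n → ℝ)
    (M : Y → Matrix n n ℝ) (hM : ∀ x y, Measurable fun w => M w x y) :
    MeasurableSet {w | ResonantPair E E' h δ α b (M w)} := by
  have hm : Measurable fun w => (fun x y => M w x y : n → n → ℝ) :=
    measurable_pi_iff.2 fun x => measurable_pi_iff.2 fun y => hM x y
  exact hm (isClosed_resonantPair E E' h δ α b).measurableSet

theorem subBox_apply {l : ℕ} (bc : BoundaryCondition) (a V : ℤ → ℝ) (Λ : Finset (Fin l))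
    (x y : Λ) : subBox bc a V Λ x y = boxOperator bc a (fun _ => 0) l x.1 y.1
      + if x = y then V (boxSite x.1) else 0 := by
  have e1 : (x.1 = y.1) ↔ x = y := Subtype.ext_iff.symm
  simp only [subBox, Matrix.submatrix_apply, boxOperator, e1, boxSite]
  by_cases h : x = y
  · simp only [if_pos h]; ring
  · simp only [if_neg h]; ring

theorem measurable_subBox {l : ℕ} {Y : Type*} [MeasurableSpace Y] (bc : BoundaryCondition)
    (a : ℤ → ℝ) (V : Y → ℤ → ℝ) (hV : ∀ m, Measurable fun w => V w m) (Λ : Finset (Fin l))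
    (x y : Λ) : Measurable fun w => subBox bc a (V w) Λ x y := by
  simp only [subBox_apply]
  refine measurable_const.add ?_
  split_ifs
  · exact hV _
  · exact measurable_const

/-- The probability that the restriction of the operator to a set of sites has two resonances, whose
responses to two of the couplings are quantitatively linearly independent. -/
theorem measure_resonantPair_le {Ω : Type*} [MeasurableSpace Ω] (P : Measure Ω)
    [IsProbabilityMeasure P] (ω : ℤ → Ω → ℝ) (B : NNReal) (S : ℝ) (hω : BoundedIndep P ω B S)
    (d : ℤ → ℝ) (hd0 : ∀ n, 0 ≤ d n) (hds : Summable fun n => |d n|) (a : ℤ → ℝ)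
    (bc : BoundaryCondition) {l : ℕ} (Λ : Finset (Fin l)) (hΛ : Λ.Nonempty) (i j : ℤ) (hij : i ≠ j)
    (E E' h δ : ℝ) (hδ : 0 < δ) (hh : 0 < h) :
    P {w | ResonantPair E E' h δ (fun x : Λ => d (i - boxSite x.1)) (fun x => d (j - boxSite x.1))
        (subBox bc a (alloyPotential d fun n => ω n w) Λ)}
      ≤ (B : ENNReal) ^ 2 * ENNReal.ofReal ((Λ.card : ℝ) ^ 3 * (32 * h ^ 2 / δ)) := by
  have hne : Nonempty Λ := hΛ.coe_sort
  have hs : Function.Injective ![i, j] := by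
    intro k k'
    fin_cases k <;> fin_cases k' <;> simp [hij, hij.symm]
  set α : Λ → ℝ := fun x => d (i - boxSite x.1) with hα
  set b : Λ → ℝ := fun x => d (j - boxSite x.1) with hb
  -- With the other couplings frozen, the operator is affine in `(ω i, ω j)`, with the translates of
  -- `d` as diagonal perturbations.
  set F : (Fin 2 → ℝ) × (ℤ → ℝ) → Matrix Λ Λ ℝ := fun z =>
    diagFamily (subBox bc a (alloyPotential d z.2) Λ) α b z.1 with hF
  have hFa : ∀ z x y, F z x y = subBox bc a (alloyPotential d z.2) Λ x y
      + (if x = y then z.1 0 * α x + z.1 1 * b x else 0) := by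
    intro z x y
    simp only [hF, diagFamily, Matrix.add_apply, Matrix.smul_apply, Matrix.diagonal_apply,
      smul_eq_mul]
    split_ifs <;> ring
  set G : Set ((Fin 2 → ℝ) × (ℤ → ℝ)) := {z | |z.1 1| ≤ S ∧ ResonantPair E E' h δ α b (F z)}
    with hG
  have hGm : MeasurableSet G := by
    have h2 : Measurable fun z : (Fin 2 → ℝ) × (ℤ → ℝ) => |z.1 1| := by fun_prop
    refine MeasurableSet.inter (measurableSet_le h2 measurable_const)
      (measurableSet_resonantPair _ _ _ _ _ _ _ fun x y => ?_)
    simp only [hFa]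
    refine (measurable_subBox bc a _ (fun m =>
      measurable_alloyPotential d Prod.snd
        (fun n => (measurable_pi_apply n).comp measurable_snd) m) Λ x y).add ?_
    split_ifs <;> fun_prop
  have h1 := hω.measure_preimage_le ![i, j] hs G hGm
    (ENNReal.ofReal ((Λ.card : ℝ) ^ 3 * (32 * h ^ 2 / δ))) fun y => by
      have := volume_resonantPair_le (subBox bc a (alloyPotential d y) Λ)
        (subBox_isSelfAdjoint _ _ _ _) α b (fun x => hd0 _) E E' h δ S hδ hh
      rw [Fintype.card_coe] at this
      exact this
  rw [Fintype.card_fin] at h1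
  refine (measure_mono fun w hw => ?_).trans h1
  refine ⟨hω.bdd _ _, ?_⟩
  have e : F ((fun k => ω (![i, j] k) w), BoundedIndep.restrictCompl ω (Set.range ![i, j]) w)
      = subBox bc a (alloyPotential d fun n => ω n w) Λ := by
    ext x y
    rw [hFa, subBox_apply, subBox_apply]
    split_ifs with hxy
    · subst hxy
      rw [alloyPotential_split d hds ω S hω.bdd ![i, j] hs w]
      simp [hα, hb, Fin.sum_univ_two]
      ring
    · ring
  rw [e]
  exact hw

end Resonance

/-! ### From the localization estimate to the restriction near a centre -/

section Localization

/-- Entries of polynomials in `M w` are measurable, and `f` is approximated by polynomials uniformly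
on growing intervals, which eventually contain the spectrum of any given `M w`. The continuity of
`f` enters here, whence a bump function in place of an indicator. -/
theorem measurable_cfc_apply {Y n : Type*} [MeasurableSpace Y] [Fintype n] [DecidableEq n]
    (f : ℝ → ℝ) (hf : Continuous f) (M : Y → Matrix n n ℝ) (hM : ∀ w, IsSelfAdjoint (M w))
    (hm : ∀ x y, Measurable fun w => M w x y) (x y : n) :
    Measurable fun w => cfc f (M w) x y := by
  have hpoly : ∀ q : Polynomial ℝ, Measurable fun w => cfc q.eval (M w) x y := by
    intro q
    have hpow : ∀ (k : ℕ) (x y : n), Measurable fun w => (M w ^ k) x y := by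
      intro k
      induction k with
      | zero => intro x y; simp only [pow_zero]; exact measurable_const
      | succ k ih =>
        intro x y
        simp only [pow_succ, Matrix.mul_apply]
        exact Finset.measurable_fun_sum _ fun z _ => (ih x z).mul (hm z y)
    have e : ∀ w, cfc q.eval (M w) x y = ∑ k ∈ q.support, q.coeff k * (M w ^ k) x y := by
      intro w
      rw [cfc_polynomial q (M w) (hM w), Polynomial.aeval_eq_sum_range, Matrix.sum_apply,
        Finset.sum_subset (s₁ := q.support) (s₂ := Finset.range (q.natDegree + 1))]
      · rfl
      · exact Polynomial.supp_subset_range_natDegree_succ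
      · intro k _ hk
        rw [Polynomial.notMem_support_iff.1 hk, zero_mul]
    simp only [e]
    exact Finset.measurable_fun_sum _ fun k _ => (hpow k x y).const_mul _
  have happrox : ∀ N : ℕ, ∃ q : Polynomial ℝ, ∀ t ∈ Set.Icc (-(N : ℝ)) N,
      |q.eval t - f t| < 1 / ((N : ℝ) + 1) := fun N =>
    exists_polynomial_near_of_continuousOn _ _ f hf.continuousOn _ (by positivity)
  choose q hq using happrox
  refine measurable_of_tendsto_metrizable (fun N => hpoly (q N)) ?_
  rw [tendsto_pi_nhds]
  intro w
  obtain ⟨ed⟩ := exists_eigenData (M w) (hM w)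
  simp only [ed.cfc_apply]
  refine tendsto_finsetSum _ fun j _ => Tendsto.mul_const _ (Tendsto.mul_const _ ?_)
  rw [tendsto_iff_dist_tendsto_zero]
  refine squeeze_zero' (Eventually.of_forall fun _ => dist_nonneg) ?_
    tendsto_one_div_add_atTop_nhds_zero_nat
  obtain ⟨N₀, hN₀⟩ := exists_nat_ge |ed.val j|
  filter_upwards [eventually_ge_atTop N₀] with N hN
  rw [Real.dist_eq]
  refine (hq N _ ?_).le
  rw [Set.mem_Icc, ← abs_le]
  exact hN₀.trans (by exact_mod_cast hN)

/-- The localization estimate gives the decay of the kernel of a function of the operator, outside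
an event of small probability. -/
theorem measure_not_kernel_decay_le {Ω : Type*} [MeasurableSpace Ω] (P : Measure Ω) {l : ℕ}
    (bc : BoundaryCondition) (H : Ω → Matrix (Fin l) (Fin l) ℝ) (hH : ∀ w, IsSelfAdjoint (H w))
    (hm : ∀ x y, Measurable fun w => H w x y) (f : ℝ → ℝ) (hf : Continuous f) (ξ K A : ℝ)
    (hA : 0 < A)
    (hK : ∀ x, ∫⁻ ω, ∑ y : Fin l,
        ENNReal.ofReal (Real.exp (boxDist bc l x y ^ ξ) * |cfc f (H ω) x y|) ∂P
      ≤ ENNReal.ofReal K) :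
    P {w | ¬∀ x y, Real.exp (boxDist bc l x y ^ ξ) * |cfc f (H w) x y| ≤ A}
      ≤ l * (ENNReal.ofReal K / ENNReal.ofReal A) := by
  have hsub : {w | ¬∀ x y, Real.exp (boxDist bc l x y ^ ξ) * |cfc f (H w) x y| ≤ A}
      ⊆ ⋃ x : Fin l, {w | ENNReal.ofReal A ≤ ∑ y : Fin l,
        ENNReal.ofReal (Real.exp (boxDist bc l x y ^ ξ) * |cfc f (H w) x y|)} := by
    intro w hw
    replace hw : ¬∀ x y, Real.exp (boxDist bc l x y ^ ξ) * |cfc f (H w) x y| ≤ A := hw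
    push Not at hw
    obtain ⟨x, y, hxy⟩ := hw
    refine Set.mem_iUnion.2 ⟨x, ?_⟩
    refine le_trans (ENNReal.ofReal_le_ofReal hxy.le) ?_
    exact Finset.single_le_sum (f := fun y => ENNReal.ofReal
      (Real.exp (boxDist bc l x y ^ ξ) * |cfc f (H w) x y|)) (fun _ _ => zero_le)
      (Finset.mem_univ y)
  refine (measure_mono hsub).trans ((measure_iUnion_le _).trans ?_)
  rw [tsum_fintype]
  have hx : ∀ x : Fin l, P {w | ENNReal.ofReal A ≤ ∑ y : Fin l,
        ENNReal.ofReal (Real.exp (boxDist bc l x y ^ ξ) * |cfc f (H w) x y|)}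
      ≤ ENNReal.ofReal K / ENNReal.ofReal A := by
    intro x
    refine (meas_ge_le_lintegral_div ?_ (by simpa using hA) ENNReal.ofReal_ne_top).trans
      (ENNReal.div_le_div_right (hK x) _)
    refine (Finset.measurable_fun_sum _ fun y _ => ENNReal.measurable_ofReal.comp
      (((measurable_cfc_apply f hf H hH hm x y).abs).const_mul _)).aemeasurable
  refine (Finset.sum_le_sum fun x _ => hx x).trans (le_of_eq ?_)
  rw [Finset.sum_const, Finset.card_univ, Fintype.card_fin, nsmul_eq_mul]

/-- An eigenvalue of the box operator whose spectral kernel decays away from every site is seen by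
the restriction of the operator to a neighbourhood of one site. -/
theorem exists_center {l : ℕ} (H : Matrix (Fin l) (Fin l) ℝ) (hH : IsSelfAdjoint H) (f : ℝ → ℝ)
    (E h R ε : ℝ) (hh : 0 < h) (hε : 0 ≤ ε) (hf1 : ∀ t ∈ Set.Icc (E - h) (E + h), f t = 1)
    (hf2 : ∀ t, f t ≠ 0 → |t - E| ≤ 2 * h) (htr : spectralTrace (Set.Icc (E - h) (E + h)) H ≠ 0)
    (hR : ∀ x y, |H x y| ≤ R)
    (hsmall : (l : ℝ) ^ 4 * R ^ 2 * ε ^ 2 + 3 * h ^ 2 * (l : ℝ) ^ 2 * ε ^ 2 ≤ h ^ 2)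
    (hl : 2 * (l : ℝ) ^ 2 * ε ^ 2 ≤ 1) :
    ∃ x₀ : Fin l, ∀ Λ : Finset (Fin l), (∀ y ∉ Λ, |cfc f H x₀ y| ≤ ε) →
      ∃ (e : ℝ) (u : Λ → ℝ), ∑ x, u x ^ 2 = 1 ∧
        (H.submatrix Subtype.val Subtype.val : Matrix Λ Λ ℝ).mulVec u = e • u ∧
        |e - E| ≤ 3 * h := by
  obtain ⟨ed⟩ := exists_eigenData H hH
  obtain ⟨j₀, hj₀⟩ : ∃ j, ed.val j ∈ Set.Icc (E - h) (E + h) := by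
    by_contra hcon
    push Not at hcon
    refine htr ?_
    unfold spectralTrace Matrix.trace
    refine Finset.sum_eq_zero fun x _ => ?_
    rw [Matrix.diag_apply, ed.cfc_apply]
    refine Finset.sum_eq_zero fun j _ => ?_
    rw [Set.indicator_of_notMem (hcon j)]
    simp
  set F : Fin l → Fin l → ℝ := fun x y => cfc f H x y with hF
  have hFe : ∀ x y, F x y = ∑ j, (f (ed.val j) * ed.vec j x) * ed.vec j y := fun x y =>
    ed.cfc_apply f x y
  have hFsq : ∀ x, ∑ y, F x y ^ 2 = ∑ j, (f (ed.val j) * ed.vec j x) ^ 2 := by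
    intro x
    simp only [hFe]
    exact ed.sum_sq _
  have hl0 : (0 : ℝ) < l := by exact_mod_cast (Nat.zero_le _).trans_lt j₀.2
  -- The squared Hilbert–Schmidt norm of `f(H)` is at least `1`, since `f` is `1` at some
  -- eigenvalue; so some row carries at least the fraction `1 / l`.
  obtain ⟨x₀, hx₀⟩ : ∃ x, 1 / (l : ℝ) ≤ ∑ y, F x y ^ 2 := by
    by_contra hcon
    push Not at hcon
    have h1 : ∑ x, ∑ y, F x y ^ 2 < ∑ _x : Fin l, 1 / (l : ℝ) :=
      Finset.sum_lt_sum_of_nonempty ⟨j₀, Finset.mem_univ _⟩ fun x _ => hcon x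
    rw [Finset.sum_const, Finset.card_univ, Fintype.card_fin, nsmul_eq_mul,
      mul_one_div_cancel hl0.ne'] at h1
    have h2 : 1 ≤ ∑ x, ∑ y, F x y ^ 2 := by
      simp only [hFsq]
      rw [Finset.sum_comm]
      refine le_trans ?_ (Finset.single_le_sum (f := fun j => ∑ x, (f (ed.val j) * ed.vec j x) ^ 2)
        (fun j _ => Finset.sum_nonneg fun x _ => sq_nonneg _) (Finset.mem_univ j₀))
      simp only [mul_pow, hf1 _ hj₀]
      have := ed.orth j₀ j₀
      simp only [if_true] at this
      simp only [one_mul, sq, this, le_refl]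
    linarith
  -- The centre is chosen before `Λ`, so that one and the same `Λ` can serve two energies.
  refine ⟨x₀, fun Λ hΛ => ?_⟩
  set W : ℝ := ∑ y, F x₀ y ^ 2 with hW
  have hWpos : 0 < W := lt_of_lt_of_le (by positivity) hx₀
  -- The row of `f(H)` at `x₀` is an approximate eigenvector, as `f` lives within `2h` of `E`. It
  -- stays one after truncation to `Λ`, where the kernel is concentrated.
  have hres : ∑ y, (H.mulVec (F x₀) y - E * F x₀ y) ^ 2 ≤ 4 * h ^ 2 * W := by
    have e1 : ∀ y, H.mulVec (F x₀) y - E * F x₀ y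
        = ∑ j, ((ed.val j - E) * (f (ed.val j) * ed.vec j x₀)) * ed.vec j y := by
      intro y
      have e2 : F x₀ = ∑ j, (f (ed.val j) * ed.vec j x₀) • ed.vec j := by
        funext y; rw [hFe]; simp
      have e3 : H.mulVec (F x₀) y = ∑ j, ed.val j * (f (ed.val j) * ed.vec j x₀) * ed.vec j y := by
        rw [e2, Matrix.mulVec_sum, Finset.sum_apply]
        refine Finset.sum_congr rfl fun j _ => ?_
        rw [Matrix.mulVec_smul, ed.mulVec_vec]
        simp; ring
      rw [e3, hFe, Finset.mul_sum, ← Finset.sum_sub_distrib]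
      exact Finset.sum_congr rfl fun j _ => by ring
    simp only [e1]
    rw [ed.sum_sq, hW, hFsq, Finset.mul_sum]
    refine Finset.sum_le_sum fun j _ => ?_
    by_cases hj : f (ed.val j) = 0
    · simp [hj]
    · rw [mul_pow]
      refine mul_le_mul_of_nonneg_right ?_ (sq_nonneg _)
      have := hf2 _ hj
      rw [← sq_abs]
      nlinarith [abs_nonneg (ed.val j - E)]
  set u : Λ → ℝ := fun x => F x₀ x.1 with hu
  have hsplit : ∀ g : Fin l → ℝ, ∑ y, g y = ∑ y : Λ, g y.1 + ∑ y ∈ Λᶜ, g y := fun g => by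
    rw [Finset.sum_coe_sort Λ g, Finset.sum_add_sum_compl]
  have hR0 : 0 ≤ R := (abs_nonneg _).trans (hR x₀ x₀)
  have hcompl : ((Λᶜ : Finset (Fin l)).card : ℝ) ≤ l := by
    exact_mod_cast (Finset.card_le_univ _).trans (by simp)
  have hΛ' : ∀ y ∈ Λᶜ, |F x₀ y| ≤ ε := fun y hy => hΛ y (Finset.mem_compl.1 hy)
  have hunorm : W - l * ε ^ 2 ≤ ∑ x, u x ^ 2 := by
    have h1 : ∑ y ∈ Λᶜ, F x₀ y ^ 2 ≤ l * ε ^ 2 := by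
      refine (Finset.sum_le_card_nsmul _ _ (ε ^ 2) fun y hy => ?_).trans ?_
      · rw [← sq_abs]
        have := hΛ' y hy
        have := abs_nonneg (F x₀ y)
        gcongr
      · rw [nsmul_eq_mul]
        exact mul_le_mul_of_nonneg_right hcompl (sq_nonneg _)
    rw [hW, hsplit]
    linarith
  have htail : ∀ x : Fin l, |∑ y ∈ Λᶜ, H x y * F x₀ y| ≤ l * (R * ε) := by
    intro x
    refine (Finset.abs_sum_le_sum_abs _ _).trans ?_
    refine (Finset.sum_le_card_nsmul _ _ (R * ε) fun y hy => ?_).trans ?_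
    · rw [abs_mul]
      exact mul_le_mul (hR x y) (hΛ' y hy) (abs_nonneg _) hR0
    · rw [nsmul_eq_mul]
      exact mul_le_mul_of_nonneg_right hcompl (by positivity)
  have hmul : ∀ x : Λ, (H.submatrix Subtype.val Subtype.val : Matrix Λ Λ ℝ).mulVec u x
      = H.mulVec (F x₀) x.1 - ∑ y ∈ Λᶜ, H x.1 y * F x₀ y := by
    intro x
    simp only [Matrix.mulVec, dotProduct, Matrix.submatrix_apply, hu]
    rw [hsplit fun y => H x.1 y * F x₀ y, add_sub_cancel_right]
  have hbound : ∑ x : Λ, ((H.submatrix Subtype.val Subtype.val : Matrix Λ Λ ℝ).mulVec u x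
      - E * u x) ^ 2 ≤ 6 * h ^ 2 * W + l * (3 * (l * (R * ε)) ^ 2) := by
    -- By `(s - t) ^ 2 ≤ 3/2 s ^ 2 + 3 t ^ 2` the main term becomes `6 h ^ 2 W`. The margin to `9 h
    -- ^ 2 W` absorbs the truncation errors, and the energy ends up within `3h`.
    calc _ ≤ ∑ x : Λ, (3 / 2 * (H.mulVec (F x₀) x.1 - E * F x₀ x.1) ^ 2
          + 3 * (l * (R * ε)) ^ 2) := by
          refine Finset.sum_le_sum fun x _ => ?_
          rw [hmul]
          have h1 : (∑ y ∈ Λᶜ, H x.1 y * F x₀ y) ^ 2 ≤ (l * (R * ε)) ^ 2 := by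
            rw [← sq_abs]
            exact pow_le_pow_left₀ (abs_nonneg _) (htail x.1) 2
          simp only [hu]
          nlinarith [sq_nonneg ((H.mulVec (F x₀) x.1 - E * F x₀ x.1)
            + 2 * ∑ y ∈ Λᶜ, H x.1 y * F x₀ y)]
      _ ≤ 3 / 2 * ∑ y, (H.mulVec (F x₀) y - E * F x₀ y) ^ 2 + l * (3 * (l * (R * ε)) ^ 2) := by
          rw [Finset.sum_add_distrib, ← Finset.mul_sum]
          refine add_le_add (mul_le_mul_of_nonneg_left ?_ (by norm_num)) ?_
          · rw [hsplit fun y => (H.mulVec (F x₀) y - E * F x₀ y) ^ 2]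
            exact le_add_of_nonneg_right (Finset.sum_nonneg fun _ _ => sq_nonneg _)
          · rw [Finset.sum_const, nsmul_eq_mul, Finset.card_univ, Fintype.card_coe]
            refine mul_le_mul_of_nonneg_right ?_ (by positivity)
            exact_mod_cast (Finset.card_le_univ Λ).trans (by simp)
      _ ≤ _ := by linarith
  have hlε : l * ε ^ 2 ≤ 1 / (2 * l) := by
    rw [le_div_iff₀ (by positivity)]
    linarith
  have hu0 : 0 < ∑ x, u x ^ 2 := by
    refine lt_of_lt_of_le ?_ hunorm
    have : 1 / (2 * (l : ℝ)) = 1 / l / 2 := by field_simp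
    have : 0 < 1 / (l : ℝ) := by positivity
    linarith
  have hfinal : 6 * h ^ 2 * W + l * (3 * (l * (R * ε)) ^ 2) ≤ (3 * h) ^ 2 * ∑ x, u x ^ 2 := by
    have h1 : (l : ℝ) * (3 * (l * (R * ε)) ^ 2) + 9 * h ^ 2 * (l * ε ^ 2) ≤ 3 * h ^ 2 * W := by
      refine le_trans ?_ (mul_le_mul_of_nonneg_left hx₀ (by positivity))
      rw [mul_one_div, le_div_iff₀ hl0]
      nlinarith [hsmall]
    have h2 := mul_le_mul_of_nonneg_left hunorm (by positivity : 0 ≤ (3 * h) ^ 2)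
    nlinarith [h1, h2]
  have hne : Nonempty Λ := by
    by_contra hcon
    rw [not_nonempty_iff] at hcon
    simp at hu0
  have hsub : IsSelfAdjoint (H.submatrix Subtype.val Subtype.val : Matrix Λ Λ ℝ) :=
    Matrix.IsHermitian.submatrix hH _
  have hdist := (infDist_spectrum_sq_le _ hsub E u).trans (hbound.trans hfinal)
  have hdist' := le_of_mul_le_mul_right hdist hu0
  obtain ⟨e, v, hv, hve, he⟩ := exists_infDist_spectrum_eq _ hsub E
  refine ⟨e, v, hv, hve, ?_⟩
  rw [he]
  exact (sq_le_sq₀ Metric.infDist_nonneg (by positivity)).1 hdist'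

end Localization

/-! ### The sites near two centres and near the ends of the box -/

section Window

variable {l : ℕ}

/-- The sites of the box within distance `r` of one of two given sites or of an end of the box. -/
def windowSites (r : ℕ) (x₀ y₀ : Fin l) : Finset (Fin l) :=
  {i | ((i : ℕ) ≤ x₀ + r ∧ (x₀ : ℕ) ≤ i + r) ∨ ((i : ℕ) ≤ y₀ + r ∧ (y₀ : ℕ) ≤ i + r) ∨
    (i : ℕ) < r ∨ l ≤ i + r}

theorem mem_windowSites (r : ℕ) (x₀ y₀ i : Fin l) : i ∈ windowSites r x₀ y₀ ↔
    ((i : ℕ) ≤ x₀ + r ∧ (x₀ : ℕ) ≤ i + r) ∨ ((i : ℕ) ≤ y₀ + r ∧ (y₀ : ℕ) ≤ i + r) ∨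
      (i : ℕ) < r ∨ l ≤ i + r := by
  simp [windowSites]

theorem card_windowSites_le (r : ℕ) (x₀ y₀ : Fin l) : (windowSites r x₀ y₀).card ≤ 6 * r + 2 := by
  have hsub : (windowSites r x₀ y₀).image Fin.val ⊆ Finset.Icc ((x₀ : ℕ) - r) (x₀ + r) ∪
      (Finset.Icc ((y₀ : ℕ) - r) (y₀ + r) ∪ (Finset.range r ∪ Finset.Ico (l - r) l)) := by
    intro i hi
    obtain ⟨j, hj, rfl⟩ := Finset.mem_image.1 hi
    rw [mem_windowSites] at hj
    have := j.2
    simp only [Finset.mem_union, Finset.mem_Icc, Finset.mem_range, Finset.mem_Ico]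
    omega
  rw [← Finset.card_image_of_injective _ Fin.val_injective]
  refine (Finset.card_le_card hsub).trans ?_
  have h1 := Finset.card_union_le (Finset.Icc ((x₀ : ℕ) - r) (x₀ + r))
    (Finset.Icc ((y₀ : ℕ) - r) (y₀ + r) ∪ (Finset.range r ∪ Finset.Ico (l - r) l))
  have h2 := Finset.card_union_le (Finset.Icc ((y₀ : ℕ) - r) (y₀ + r))
    (Finset.range r ∪ Finset.Ico (l - r) l)
  have h3 := Finset.card_union_le (Finset.range r) (Finset.Ico (l - r) l)
  simp only [Nat.card_Icc, Nat.card_Ico, Finset.card_range] at h1 h2 h3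
  omega

/-- From a site near a centre the interval extends towards the centre, unless an end of the box is
close; there it extends inwards, inside the strip of width `r` at that end. -/
theorem isThick_windowSites (r G : ℕ) (x₀ y₀ : Fin l) (hr : 2 * G + 3 ≤ r) (hl : 2 * G + 3 ≤ l) :
    IsThick (windowSites r x₀ y₀) G := by
  intro x hx
  rw [mem_windowSites] at hx
  have hxl := x.2
  simp only [mem_windowSites]
  by_cases h1 : (x : ℕ) + G + 2 ≤ l
  · by_cases h2 : (x : ℕ) < G + 1
    · exact Or.inl ⟨h1, fun y _ _ => by omega⟩
    · rcases hx with h | h | h | h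
      · rcases le_total (x : ℕ) x₀ with h' | h'
        · exact Or.inl ⟨h1, fun y _ _ => by omega⟩
        · exact Or.inr ⟨by omega, fun y _ _ => by omega⟩
      · rcases le_total (x : ℕ) y₀ with h' | h'
        · exact Or.inl ⟨h1, fun y _ _ => by omega⟩
        · exact Or.inr ⟨by omega, fun y _ _ => by omega⟩
      · exact Or.inr ⟨by omega, fun y _ _ => by omega⟩
      · exact Or.inl ⟨h1, fun y _ _ => by omega⟩
  · exact Or.inr ⟨by omega, fun y _ _ => by omega⟩

/-- A site away from both ends is not reached in fewer than `r` steps through the periodic bond.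
With the ends included in `windowSites`, sites outside are far from the centres for both boundary
conditions. -/
theorem le_boxDist (bc : BoundaryCondition) (r : ℕ) (x y : Fin l)
    (h1 : (x : ℕ) + r < y ∨ (y : ℕ) + r < x) (h2 : r ≤ (y : ℕ)) (h3 : (y : ℕ) + r < l) :
    (r : ℝ) ≤ boxDist bc l x y := by
  have hxl := x.2
  have h4 : (r : ℝ) ≤ |(x : ℝ) - y| ∧ |(x : ℝ) - y| ≤ l - r := by
    rcases h1 with h | h
    · have e1 : ((x : ℕ) : ℝ) + r < (y : ℕ) := by exact_mod_cast h
      have e2 : ((y : ℕ) : ℝ) + r < l := by exact_mod_cast h3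
      have e3 : (0 : ℝ) ≤ (x : ℕ) := by positivity
      have e4 : (0 : ℝ) ≤ r := by positivity
      rw [abs_sub_comm, abs_of_nonneg (by linarith)]
      constructor <;> linarith
    · have e1 : ((y : ℕ) : ℝ) + r < (x : ℕ) := by exact_mod_cast h
      have e2 : ((x : ℕ) : ℝ) < l := by exact_mod_cast hxl
      have e3 : (r : ℝ) ≤ (y : ℕ) := by exact_mod_cast h2
      have e4 : (0 : ℝ) ≤ r := by positivity
      rw [abs_of_nonneg (by linarith)]
      constructor <;> linarith
  cases bc
  · exact h4.1
  · exact le_min h4.1 (by linarith [h4.2])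

theorem abs_boxOperator_le (bc : BoundaryCondition) (a V : ℤ → ℝ) (M R : ℝ) (ha : ∀ n, |a n| ≤ M)
    (hV : ∀ n, |V n| ≤ R) (x y : Fin l) : |boxOperator bc a V l x y| ≤ R + 4 * M := by
  have hM : 0 ≤ M := (abs_nonneg _).trans (ha 0)
  have hR : 0 ≤ R := (abs_nonneg _).trans (hV 0)
  have hite : ∀ (p : Prop) [Decidable p] (z Z : ℝ), |z| ≤ Z → |if p then z else 0| ≤ Z := by
    intro p _ z Z hz
    split_ifs
    · exact hz
    · simpa using (abs_nonneg z).trans hz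
  have h1 := hite (x = y) _ _ (hV ((x : ℤ) + 1))
  have h2 := hite ((y : ℕ) = (x : ℕ) + 1) _ _ (ha ((x : ℤ) + 2))
  have h3 := hite ((x : ℕ) = (y : ℕ) + 1) _ _ (ha ((x : ℤ) + 1))
  have h4 := hite ((x : ℕ) + 1 = l ∧ (y : ℕ) = 0) _ _ (ha 1)
  have h5 := hite ((x : ℕ) = 0 ∧ (y : ℕ) + 1 = l) _ _ (ha 1)
  rw [abs_le] at *
  cases bc
  · simp only [boxOperator]
    constructor <;> linarith [h1.1, h1.2, h2.1, h2.2, h3.1, h3.2]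
  · simp only [boxOperator]
    constructor <;> linarith [h1.1, h1.2, h2.1, h2.2, h3.1, h3.2, h4.1, h4.2, h5.1, h5.2]

end Window

/-! ### Either the potential is constrained or the gradients are independent -/

section Dichotomy

/-- A bump function that is one on `[E - h, E + h]` and vanishes outside of `[E - 2h, E + 2h]`. -/
def energyBump (E h t : ℝ) : ℝ := max 0 (min 1 (2 - |t - E| / h))

theorem continuous_energyBump (E h : ℝ) : Continuous (energyBump E h) := by
  unfold energyBump
  fun_prop

theorem abs_energyBump_le (E h t : ℝ) : |energyBump E h t| ≤ 1 := by
  unfold energyBump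
  rw [abs_of_nonneg (le_max_left _ _)]
  exact max_le zero_le_one (min_le_left _ _)

theorem energyBump_eq_one {E h t : ℝ} (hh : 0 < h) (ht : t ∈ Set.Icc (E - h) (E + h)) :
    energyBump E h t = 1 := by
  have h1 : |t - E| ≤ h := by
    rw [abs_le]
    constructor <;> linarith [ht.1, ht.2]
  have h2 : |t - E| / h ≤ 1 := (div_le_one hh).2 h1
  unfold energyBump
  rw [min_eq_left (by linarith), max_eq_right zero_le_one]

theorem abs_sub_le_of_energyBump_ne_zero {E h t : ℝ} (hh : 0 < h) (ht : energyBump E h t ≠ 0) :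
    |t - E| ≤ 2 * h := by
  by_contra hcon
  push Not at hcon
  refine ht ?_
  unfold energyBump
  have : 2 < |t - E| / h := (lt_div_iff₀ hh).2 hcon
  exact max_eq_left ((min_le_right _ _).trans (by linarith))

theorem tsupport_energyBump_subset {E h : ℝ} (hh : 0 < h) :
    tsupport (energyBump E h) ⊆ Metric.closedBall E (2 * h) := by
  refine closure_minimal (fun t ht => ?_) Metric.isClosed_closedBall
  rw [Metric.mem_closedBall, Real.dist_eq]
  exact abs_sub_le_of_energyBump_ne_zero hh ht

/-- If the box operator has eigenvalues near two energies and localized spectral kernels, then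
either the potential is constrained, or the restriction of the operator to the neighbourhood of two
sites and of the ends of the box is resonant, with linearly independent responses. -/
theorem exists_constrainedFrom_or_resonantPair {l : ℕ} (bc : BoundaryCondition) (a V d : ℤ → ℝ)
    (hd0 : ∀ n, 0 ≤ d n) (hds : Summable d) (hD : 0 < ∑' n, d n)
    (c : ℝ) (N : ℕ) (hc : 0 < c)
    (hconv : ∀ (S : Finset ℤ) (f : ℤ → ℝ), (∀ m ∉ S, f m = 0) →
      ∀ B : ℝ, (∀ F : Finset ℤ, ∑ i ∈ F, |convOn d S f i| ≤ B) →
        ∀ m, |f m| ≤ c * (S.card : ℝ) ^ N * B)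
    (M R E E' κ h η τ t A : ℝ) (g K G r : ℕ) (hM : 0 < M) (hh : 0 < h) (hη : 0 < η) (hA : 0 ≤ A)
    (ha : ∀ n, 1 / M ≤ |a n| ∧ |a n| ≤ M)
    (hV : ∀ m, |V m| + 4 * M + |E| + |E'| + 3 * h ≤ R)
    (hκ : 0 < κ) (hEE : κ + 6 * h ≤ |E - E'|)
    (hsmall : (2 * M + R) * η * ((1 + M * (M + R)) ^ G * (6 * r + 2)) < κ)
    (hτ : (2 * M + R) * η * (1 + R + M + M / κ) * ((1 + M * (M + R)) ^ G * (6 * r + 2))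
      + 3 * h * (2 * R + 3 * h + 1) ≤ τ)
    (hG : g * K + 6 ≤ G) (hr : 2 * G + 3 ≤ r) (hl : 2 * G + 3 ≤ l)
    (ht : ∀ F : Finset ℤ, (∀ n ∈ F, (r : ℤ) < |n|) → ∑ n ∈ F, d n ≤ t)
    (htD : 2 * t ≤ ∑' n, d n) (htη : 6 * t ≤ η ^ 2 / (c * (6 * r + 2) ^ N))
    (hloc : (l : ℝ) ^ 4 * R ^ 2 * (A * Real.exp (-(r : ℝ) ^ (1 / 2 : ℝ))) ^ 2
      + 3 * h ^ 2 * (l : ℝ) ^ 2 * (A * Real.exp (-(r : ℝ) ^ (1 / 2 : ℝ))) ^ 2 ≤ h ^ 2)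
    (hloc' : 2 * (l : ℝ) ^ 2 * (A * Real.exp (-(r : ℝ) ^ (1 / 2 : ℝ))) ^ 2 ≤ 1)
    (hk : ∀ x y, Real.exp (boxDist bc l x y ^ (1 / 2 : ℝ))
      * |cfc (energyBump E h) (boxOperator bc a V l) x y| ≤ A)
    (hk' : ∀ x y, Real.exp (boxDist bc l x y ^ (1 / 2 : ℝ))
      * |cfc (energyBump E' h) (boxOperator bc a V l) x y| ≤ A)
    (htr : spectralTrace (Set.Icc (E - h) (E + h)) (boxOperator bc a V l) ≠ 0)
    (htr' : spectralTrace (Set.Icc (E' - h) (E' + h)) (boxOperator bc a V l) ≠ 0) :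
    (∃ n₀ ∈ Finset.Icc (-(G : ℤ)) (l + G), ConstrainedFrom a V ((E + E') / 2) τ g K n₀) ∨
    ∃ x₀ y₀ : Fin l, ∃ i ∈ siteNhd (windowSites r x₀ y₀) r,
      ∃ j ∈ siteNhd (windowSites r x₀ y₀) r, i ≠ j ∧
      ResonantPair E E' (3 * h)
        ((∑' n, d n) * η ^ 2 / (4 * c * (6 * r + 2) ^ N * ((6 * r + 2) * (2 * r + 1)) ^ 2))
        (fun x : windowSites r x₀ y₀ => d (i - boxSite x.1)) (fun x => d (j - boxSite x.1))
        (subBox bc a V (windowSites r x₀ y₀)) := by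
  have hVR : ∀ x y, |boxOperator bc a V l x y| ≤ R := by
    intro x y
    refine (abs_boxOperator_le bc a V M (R - 4 * M - |E| - |E'| - 3 * h) (fun n => (ha n).2)
      (fun n => by linarith [hV n]) x y).trans ?_
    linarith [abs_nonneg E, abs_nonneg E']
  have hR0 : 0 ≤ R := by linarith [hV 0, abs_nonneg (V 0), abs_nonneg E, abs_nonneg E']
  have hfar : ∀ (f : ℝ → ℝ) (x₀ y₀ z : Fin l), (z = x₀ ∨ z = y₀) →
      (∀ x y, Real.exp (boxDist bc l x y ^ (1 / 2 : ℝ))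
        * |cfc f (boxOperator bc a V l) x y| ≤ A) →
      ∀ y ∉ windowSites r x₀ y₀, |cfc f (boxOperator bc a V l) z y|
        ≤ A * Real.exp (-(r : ℝ) ^ (1 / 2 : ℝ)) := by
    intro f x₀ y₀ z hz hf y hy
    rw [mem_windowSites] at hy
    push Not at hy
    have h1 : (r : ℝ) ≤ boxDist bc l z y := by
      refine le_boxDist bc r z y ?_ (by omega) (by omega)
      rcases hz with rfl | rfl <;> omega
    have h2 : Real.exp ((r : ℝ) ^ (1 / 2 : ℝ)) ≤ Real.exp (boxDist bc l z y ^ (1 / 2 : ℝ)) :=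
      Real.exp_le_exp.2 (Real.rpow_le_rpow (by positivity) h1 (by norm_num))
    rw [Real.exp_neg, ← div_eq_mul_inv, le_div_iff₀ (Real.exp_pos _), mul_comm]
    exact (mul_le_mul_of_nonneg_right h2 (abs_nonneg _)).trans (hf z y)
  have hself := boxOperator_isSelfAdjoint bc a V l
  have hε : 0 ≤ A * Real.exp (-(r : ℝ) ^ (1 / 2 : ℝ)) := mul_nonneg hA (Real.exp_pos _).le
  obtain ⟨x₀, hx₀⟩ := exists_center _ hself (energyBump E h) E h R _ hh hε
    (fun t ht => energyBump_eq_one hh ht) (fun t ht => abs_sub_le_of_energyBump_ne_zero hh ht) htr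
    hVR hloc hloc'
  obtain ⟨y₀, hy₀⟩ := exists_center _ hself (energyBump E' h) E' h R _ hh hε
    (fun t ht => energyBump_eq_one hh ht) (fun t ht => abs_sub_le_of_energyBump_ne_zero hh ht) htr'
    hVR hloc hloc'
  set Λ := windowSites r x₀ y₀ with hΛ
  obtain ⟨e, u, hu, hue, he⟩ := hx₀ Λ (hfar _ x₀ y₀ x₀ (Or.inl rfl) hk)
  obtain ⟨e', v, hv, hve, he'⟩ := hy₀ Λ (hfar _ x₀ y₀ y₀ (Or.inr rfl) hk')
  have hcard : (Λ.card : ℝ) ≤ 6 * r + 2 := by exact_mod_cast card_windowSites_le r x₀ y₀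
  have hx₀Λ : x₀ ∈ Λ := by rw [hΛ, mem_windowSites]; left; omega
  have hcard0 : (0 : ℝ) < Λ.card := by exact_mod_cast Finset.card_pos.2 ⟨x₀, hx₀Λ⟩
  have hκe : κ ≤ |e - e'| := by
    rw [abs_le] at he he'
    rcases le_total 0 (E - E') with h0 | h0
    · rw [abs_of_nonneg h0] at hEE
      refine le_trans ?_ (le_abs_self _)
      linarith [he.1, he'.2]
    · rw [abs_of_nonpos h0] at hEE
      refine le_trans ?_ (neg_le_abs _)
      linarith [he.2, he'.1]
  have hρ0 : 0 < 1 + M * (M + R) := by positivity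
  -- Nearly equal densities constrain the potential; different densities give independent gradients.
  by_cases huv : ∀ x, |u x ^ 2 - v x ^ 2| ≤ η ^ 2
  · left
    refine exists_constrainedFrom_of_close bc a V Λ u v e e' ((E + E') / 2) M R η τ (3 * h) g K G
      hu hue hve hM hη.le ha huv (fun m => ?_) (hκ.trans_le hκe) ?_ ?_ ?_ hG
      (isThick_windowSites r G x₀ y₀ hr hl)
    · have h1 := hV m
      rw [abs_le] at he he'
      have h2 := abs_le.1 (le_refl |V m|)
      have h3 := abs_le.1 (le_refl |E|)
      have h4 := abs_le.1 (le_refl |E'|)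
      rw [abs_le, abs_le]
      refine ⟨⟨?_, ?_⟩, ?_, ?_⟩ <;> linarith [he.1, he.2, he'.1, he'.2, h2.1, h2.2, h3.1, h3.2, h4.1,
        h4.2]
    · refine lt_of_le_of_lt ?_ (hsmall.trans_le hκe)
      gcongr
    · have e1 : (e + e') / 2 - (E + E') / 2 = ((e - E) + (e' - E')) / 2 := by ring
      rw [e1, abs_div, abs_two, div_le_iff₀ two_pos]
      linarith [abs_add_le (e - E) (e' - E')]
    · refine le_trans ?_ hτ
      gcongr
  · right
    push Not at huv
    refine ⟨x₀, y₀, ?_⟩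
    obtain ⟨i, hi, j, hj, hij⟩ := exists_le_abs_det_of_not_close d hd0 hds c N hc hconv Λ u v hu hv
      (η ^ 2) (by positivity) huv r t ht htD hD (htη.trans (by gcongr))
    have hT : (0 : ℝ) < (siteNhd Λ r).card := by exact_mod_cast Finset.card_pos.2 ⟨i, hi⟩
    have hT' : ((siteNhd Λ r).card : ℝ) ≤ (6 * r + 2) * (2 * r + 1) := by
      refine le_trans (b := (Λ.card : ℝ) * (2 * r + 1)) ?_ (by gcongr)
      exact_mod_cast card_siteNhd_le Λ r
    have hδ : (∑' n, d n) * η ^ 2 / (4 * c * (6 * r + 2) ^ N * ((6 * r + 2) * (2 * r + 1)) ^ 2)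
        ≤ (∑' n, d n) * η ^ 2 / (4 * c * (Λ.card : ℝ) ^ N * ((siteNhd Λ r).card : ℝ) ^ 2) := by
      gcongr
    refine ⟨i, hi, j, hj, ?_, e, e', u, v, hu, hv, hue, hve, he, he', hδ.trans hij⟩
    rintro rfl
    rw [sub_self, abs_zero] at hij
    have : 0 < (∑' n, d n) * η ^ 2
      / (4 * c * (Λ.card : ℝ) ^ N * ((siteNhd Λ r).card : ℝ) ^ 2) := by positivity
    linarith

end Dichotomy

/-! ### Union bound over the exceptional events -/

/-- The probability that the box operator has eigenvalues near two energies, for one box and one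
choice of the scales. -/
theorem measure_spectralTrace_ne_zero_le {Ω : Type*} [MeasurableSpace Ω] (P : Measure Ω)
    [IsProbabilityMeasure P] (ω : ℤ → Ω → ℝ) (B : NNReal) (S : ℝ) (hω : BoundedIndep P ω B S)
    {l : ℕ} (bc : BoundaryCondition) (a d : ℤ → ℝ)
    (hd0 : ∀ n, 0 ≤ d n) (hds : Summable d) (hD : 0 < ∑' n, d n)
    (c : ℝ) (N : ℕ) (hc : 0 < c)
    (hconv : ∀ (S : Finset ℤ) (f : ℤ → ℝ), (∀ m ∉ S, f m = 0) →
      ∀ B : ℝ, (∀ F : Finset ℤ, ∑ i ∈ F, |convOn d S f i| ≤ B) →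
        ∀ m, |f m| ≤ c * (S.card : ℝ) ^ N * B)
    (M R E E' κ h η τ t A C Kl : ℝ) (g K G r : ℕ) (hM : 0 < M) (hh : 0 < h) (hη : 0 < η)
    (hA : 0 < A)
    (ha : ∀ n, 1 / M ≤ |a n| ∧ |a n| ≤ M)
    (hCF : P {w | ∃ n₀ ∈ Finset.Icc (-(G : ℤ)) (l + G),
        ConstrainedFrom a (alloyPotential d fun n => ω n w) ((E + E') / 2) τ g K n₀}
      ≤ (Finset.Icc (-(G : ℤ)) (l + G)).card * ENNReal.ofReal ((C * τ) ^ K))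
    (hR : (∑' n, d n) * S + 4 * M + |E| + |E'| + 3 * h ≤ R)
    (hκ : 0 < κ) (hEE : κ + 6 * h ≤ |E - E'|)
    (hsmall : (2 * M + R) * η * ((1 + M * (M + R)) ^ G * (6 * r + 2)) < κ)
    (hτ : (2 * M + R) * η * (1 + R + M + M / κ) * ((1 + M * (M + R)) ^ G * (6 * r + 2))
      + 3 * h * (2 * R + 3 * h + 1) ≤ τ)
    (hG : g * K + 6 ≤ G) (hr : 2 * G + 3 ≤ r) (hl : 2 * G + 3 ≤ l)
    (ht : ∀ F : Finset ℤ, (∀ n ∈ F, (r : ℤ) < |n|) → ∑ n ∈ F, d n ≤ t)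
    (htD : 2 * t ≤ ∑' n, d n) (htη : 6 * t ≤ η ^ 2 / (c * (6 * r + 2) ^ N))
    (hloc : (l : ℝ) ^ 4 * R ^ 2 * (A * Real.exp (-(r : ℝ) ^ (1 / 2 : ℝ))) ^ 2
      + 3 * h ^ 2 * (l : ℝ) ^ 2 * (A * Real.exp (-(r : ℝ) ^ (1 / 2 : ℝ))) ^ 2 ≤ h ^ 2)
    (hloc' : 2 * (l : ℝ) ^ 2 * (A * Real.exp (-(r : ℝ) ^ (1 / 2 : ℝ))) ^ 2 ≤ 1)
    (hK : ∀ e ∈ ({E, E'} : Set ℝ), ∀ x, ∫⁻ w, ∑ y : Fin l,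
        ENNReal.ofReal (Real.exp (boxDist bc l x y ^ (1 / 2 : ℝ))
          * |cfc (energyBump e h) (boxOperator bc a (alloyPotential d fun n => ω n w) l) x y|) ∂P
      ≤ ENNReal.ofReal Kl) :
    P {w | spectralTrace (Set.Icc (E - h) (E + h))
          (boxOperator bc a (alloyPotential d fun n => ω n w) l) ≠ 0 ∧
        spectralTrace (Set.Icc (E' - h) (E' + h))
          (boxOperator bc a (alloyPotential d fun n => ω n w) l) ≠ 0}
      ≤ 2 * (l * (ENNReal.ofReal Kl / ENNReal.ofReal A))
        + (l + 2 * G + 1 : ℕ) * ENNReal.ofReal ((C * τ) ^ K)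
        + (l * l : ℕ) * (((6 * r + 2) * (2 * r + 1)) ^ 2 : ℕ) * ((B : ENNReal) ^ 2
          * ENNReal.ofReal ((6 * r + 2) ^ 3 * (32 * (3 * h) ^ 2
            / ((∑' n, d n) * η ^ 2
              / (4 * c * (6 * r + 2) ^ N * ((6 * r + 2) * (2 * r + 1)) ^ 2))))) := by
  set V : Ω → ℤ → ℝ := fun w => alloyPotential d fun n => ω n w with hV
  set H : Ω → Matrix (Fin l) (Fin l) ℝ := fun w => boxOperator bc a (V w) l with hH
  set δ : ℝ := (∑' n, d n) * η ^ 2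
    / (4 * c * (6 * r + 2) ^ N * ((6 * r + 2) * (2 * r + 1)) ^ 2) with hδ
  have hδ0 : 0 < δ := by positivity
  have hdabs : (fun n => |d n|) = d := funext fun n => abs_of_nonneg (hd0 n)
  have hdsa : Summable fun n => |d n| := by rwa [hdabs]
  have hVm : ∀ m, Measurable fun w => V w m := fun m =>
    measurable_alloyPotential d (fun w n => ω n w) hω.meas m
  have hHm : ∀ x y, Measurable fun w => H w x y := by
    intro x y
    have := measurable_subBox bc a V hVm Finset.univ ⟨x, Finset.mem_univ _⟩ ⟨y, Finset.mem_univ _⟩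
    exact this
  have hHs : ∀ w, IsSelfAdjoint (H w) := fun w => boxOperator_isSelfAdjoint _ _ _ _
  have hVb : ∀ w m, |V w m| + 4 * M + |E| + |E'| + 3 * h ≤ R := by
    intro w m
    have := abs_alloyPotential_le d hdsa (fun n => ω n w) S (fun n => hω.bdd n w) m
    rw [hdabs] at this
    have h' : |V w m| ≤ (∑' n, d n) * S := this
    linarith
  set Bad : ℝ → Set Ω := fun e => {w | ¬∀ x y, Real.exp (boxDist bc l x y ^ (1 / 2 : ℝ))
    * |cfc (energyBump e h) (H w) x y| ≤ A} with hBad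
  have hBadP : ∀ e ∈ ({E, E'} : Set ℝ),
      P (Bad e) ≤ l * (ENNReal.ofReal Kl / ENNReal.ofReal A) := fun e he =>
    measure_not_kernel_decay_le P bc H hHs hHm _ (continuous_energyBump e h) _ Kl A hA (hK e he)
  set Con : Set Ω := {w | ∃ n₀ ∈ Finset.Icc (-(G : ℤ)) (l + G),
    ConstrainedFrom a (V w) ((E + E') / 2) τ g K n₀} with hCon
  -- The condition `q.1 ≠ q.2` makes the event empty on the diagonal, so that one bound `q₀` serves
  -- all pairs of couplings.
  set Res : (Fin l × Fin l) → ℤ × ℤ → Set Ω := fun z q => {w | q.1 ≠ q.2 ∧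
    ResonantPair E E' (3 * h) δ (fun x : windowSites r z.1 z.2 => d (q.1 - boxSite x.1))
      (fun x => d (q.2 - boxSite x.1)) (subBox bc a (V w) (windowSites r z.1 z.2))} with hRes
  set T : Fin l × Fin l → Finset (ℤ × ℤ) := fun z =>
    siteNhd (windowSites r z.1 z.2) r ×ˢ siteNhd (windowSites r z.1 z.2) r with hT
  set q₀ : ENNReal := (B : ENNReal) ^ 2
    * ENNReal.ofReal ((6 * r + 2) ^ 3 * (32 * (3 * h) ^ 2 / δ)) with hq₀
  have hResP : ∀ z q, P (Res z q) ≤ q₀ := by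
    intro z q
    by_cases hq : q.1 = q.2
    · have : Res z q = ∅ := Set.eq_empty_of_forall_notMem fun w hw => hw.1 hq
      rw [this, measure_empty]
      exact zero_le
    · have hz : z.1 ∈ windowSites r z.1 z.2 := by rw [mem_windowSites]; left; omega
      have hcard : ((windowSites r z.1 z.2).card : ℝ) ≤ 6 * r + 2 := by
        exact_mod_cast card_windowSites_le r z.1 z.2
      refine (measure_mono fun w hw => hw.2).trans ((measure_resonantPair_le P ω B S hω d hd0 hdsa a
        bc _ ⟨_, hz⟩ q.1 q.2 hq E E' (3 * h) δ hδ0 (by positivity)).trans ?_)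
      rw [hq₀]
      gcongr
  have hTcard : ∀ z, (T z).card ≤ ((6 * r + 2) * (2 * r + 1)) ^ 2 := by
    intro z
    rw [hT, Finset.card_product, ← sq]
    refine Nat.pow_le_pow_left ((card_siteNhd_le _ _).trans ?_) 2
    exact Nat.mul_le_mul_right _ (card_windowSites_le _ _ _)
  have hsub : {w | spectralTrace (Set.Icc (E - h) (E + h)) (H w) ≠ 0 ∧
        spectralTrace (Set.Icc (E' - h) (E' + h)) (H w) ≠ 0}
      ⊆ ((Bad E ∪ Bad E') ∪ Con) ∪ ⋃ z, ⋃ q ∈ T z, Res z q := by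
    rintro w ⟨hw1, hw2⟩
    by_cases hb : w ∈ Bad E ∪ Bad E'
    · exact Or.inl (Or.inl hb)
    have hb1 : ¬ w ∈ Bad E := fun h => hb (Or.inl h)
    have hb2 : ¬ w ∈ Bad E' := fun h => hb (Or.inr h)
    have hb1' := not_not.1 hb1
    have hb2' := not_not.1 hb2
    rcases exists_constrainedFrom_or_resonantPair bc a (V w) d hd0 hds hD c N hc hconv M R E E' κ h η
      τ t A g K G r hM hh hη hA.le ha (hVb w) hκ hEE hsmall hτ hG hr hl ht htD htη hloc hloc'
      hb1' hb2' hw1 hw2 with h1 | ⟨x₀, y₀, i, hi, j, hj, hij, h1⟩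
    · exact Or.inl (Or.inr h1)
    · refine Or.inr (Set.mem_iUnion.2 ⟨(x₀, y₀), Set.mem_iUnion₂.2 ⟨(i, j), ?_, hij, h1⟩⟩)
      exact Finset.mem_product.2 ⟨hi, hj⟩
  refine (measure_mono hsub).trans ((measure_union_le _ _).trans (add_le_add
    ((measure_union_le _ _).trans (add_le_add ((measure_union_le _ _).trans ?_) ?_)) ?_))
  · rw [two_mul]
    exact add_le_add (hBadP E (by simp)) (hBadP E' (by simp))
  · refine hCF.trans (le_of_eq ?_)
    congr 2
    rw [Int.card_Icc]
    omega
  · calc P (⋃ z, ⋃ q ∈ T z, Res z q) ≤ ∑ z : Fin l × Fin l, ∑ q ∈ T z, P (Res z q) := by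
          refine (measure_iUnion_fintype_le _ _).trans (Finset.sum_le_sum fun z _ => ?_)
          exact measure_biUnion_finset_le _ _
      _ ≤ ∑ _z : Fin l × Fin l, ((((6 * r + 2) * (2 * r + 1)) ^ 2 : ℕ) : ENNReal) * q₀ := by
          refine Finset.sum_le_sum fun z _ => ?_
          refine (Finset.sum_le_card_nsmul _ _ q₀ fun q _ => hResP z q).trans ?_
          rw [nsmul_eq_mul]
          gcongr
          exact hTcard z
      _ = _ := by
          rw [Finset.sum_const, Finset.card_univ, Fintype.card_prod, Fintype.card_fin,
            nsmul_eq_mul, ← mul_assoc]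

/-! ### Comparison of the scales `K = ⌈x ^ b⌉₊` and `r = ⌈x ^ 3⌉₊`, with `x = log L` -/

section Scales

theorem eventually_ceil_pow_le_exp {b : ℝ} (hb : 0 < b) (c : ℝ) (p : ℕ) :
    ∀ᶠ x : ℝ in atTop, c * (6 * ((⌈x ^ 3⌉₊ : ℕ) : ℝ) + 2) ^ p ≤ Real.exp (⌈x ^ b⌉₊ : ℕ) := by
  have h1 : Tendsto (fun z : ℝ => |c| * 14 ^ p * (z ^ (3 * p / b) / Real.exp z)) atTop (nhds 0) := by
    have := (isLittleO_rpow_exp_atTop (3 * p / b)).tendsto_div_nhds_zero.const_mul (|c| * 14 ^ p)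
    simpa using this
  have h2 := (h1.comp (tendsto_rpow_atTop hb)).eventually (ge_mem_nhds zero_lt_one)
  filter_upwards [h2, eventually_ge_atTop 1] with x hx hx1
  have hx0 : (0 : ℝ) ≤ x := by linarith
  simp only [Function.comp] at hx
  have e1 : (x ^ b) ^ (3 * p / b) = x ^ (3 * p) := by
    rw [← Real.rpow_mul hx0, mul_div_cancel₀ _ hb.ne']
    exact_mod_cast Real.rpow_natCast x (3 * p)
  rw [e1, ← mul_div_assoc, div_le_one (Real.exp_pos _)] at hx
  have h3 : ((⌈x ^ 3⌉₊ : ℕ) : ℝ) ≤ x ^ 3 + 1 := (Nat.ceil_lt_add_one (by positivity)).le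
  have h4 : (1 : ℝ) ≤ x ^ 3 := one_le_pow₀ hx1
  have h5 : 6 * ((⌈x ^ 3⌉₊ : ℕ) : ℝ) + 2 ≤ 14 * x ^ 3 := by linarith
  calc c * (6 * ((⌈x ^ 3⌉₊ : ℕ) : ℝ) + 2) ^ p ≤ |c| * (14 * x ^ 3) ^ p := by
        gcongr
        exact le_abs_self c
    _ = |c| * 14 ^ p * x ^ (3 * p) := by rw [mul_pow, ← pow_mul]; ring
    _ ≤ Real.exp (x ^ b) := hx
    _ ≤ _ := Real.exp_le_exp.2 (Nat.le_ceil _)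

theorem eventually_mul_ceil_le {b β : ℝ} (hb : 0 < b) (hbβ : b < β) (c : ℝ) :
    ∀ᶠ x : ℝ in atTop, c * ((⌈x ^ b⌉₊ : ℕ) : ℝ) ≤ x ^ β := by
  have h1 : ∀ᶠ x : ℝ in atTop, 2 * |c| ≤ x ^ (β - b) :=
    (tendsto_rpow_atTop (sub_pos.2 hbβ)).eventually_ge_atTop _
  filter_upwards [h1, eventually_ge_atTop 1] with x hx hx1
  have hx0 : (0 : ℝ) < x := by linarith
  have h2 : (1 : ℝ) ≤ x ^ b := Real.one_le_rpow hx1 hb.le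
  have h3 : ((⌈x ^ b⌉₊ : ℕ) : ℝ) ≤ x ^ b + 1 := (Nat.ceil_lt_add_one (by positivity)).le
  calc c * ((⌈x ^ b⌉₊ : ℕ) : ℝ) ≤ |c| * (2 * x ^ b) := by
        gcongr
        · exact le_abs_self c
        · linarith
    _ = (2 * |c|) * x ^ b := by ring
    _ ≤ x ^ (β - b) * x ^ b := by gcongr
    _ = x ^ β := by rw [← Real.rpow_add hx0]; ring_nf

theorem eventually_mul_le_ceil_sq {b : ℝ} (hb : 1 / 2 < b) (c : ℝ) :
    ∀ᶠ x : ℝ in atTop, c * x ≤ ((⌈x ^ b⌉₊ : ℕ) : ℝ) ^ 2 := by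
  have h1 : ∀ᶠ x : ℝ in atTop, c ≤ x ^ (2 * b - 1) :=
    (tendsto_rpow_atTop (by linarith)).eventually_ge_atTop _
  filter_upwards [h1, eventually_ge_atTop 1] with x hx hx1
  have hx0 : (0 : ℝ) < x := by linarith
  calc c * x ≤ x ^ (2 * b - 1) * x := by gcongr
    _ = (x ^ b) ^ 2 := by
        rw [← Real.rpow_add_one hx0.ne', ← Real.rpow_natCast, ← Real.rpow_mul hx0.le]
        push_cast; ring_nf
    _ ≤ _ := by gcongr; exact Nat.le_ceil _

theorem eventually_mul_le_sqrt_ceil (c : ℝ) :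
    ∀ᶠ x : ℝ in atTop, c * x ≤ ((⌈x ^ 3⌉₊ : ℕ) : ℝ) ^ (1 / 2 : ℝ) := by
  filter_upwards [eventually_ge_atTop 1, eventually_ge_atTop (c ^ 2)] with x hx1 hxc
  have hx0 : (0 : ℝ) < x := by linarith
  rw [← Real.sqrt_eq_rpow]
  refine Real.le_sqrt_of_sq_le (le_trans ?_ (Nat.le_ceil _))
  calc (c * x) ^ 2 = c ^ 2 * x ^ 2 := by ring
    _ ≤ x * x ^ 2 := by gcongr
    _ = x ^ 3 := by ring

theorem eventually_mul_ceil_le_ceil {b : ℝ} (hb : 0 < b) (hb1 : b < 1) (c : ℝ) :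
    ∀ᶠ x : ℝ in atTop, c * ((⌈x ^ b⌉₊ : ℕ) : ℝ) ≤ ((⌈x ^ 3⌉₊ : ℕ) : ℝ) := by
  filter_upwards [eventually_mul_ceil_le hb hb1 c, eventually_ge_atTop 1] with x hx hx1
  rw [Real.rpow_one] at hx
  refine hx.trans (le_trans ?_ (Nat.le_ceil _))
  calc x = x * 1 := (mul_one x).symm
    _ ≤ x * x ^ 2 := by gcongr; exact one_le_pow₀ hx1
    _ = x ^ 3 := by ring

theorem eventually_mul_ceil_le_exp (c : ℝ) {s : ℝ} (hs : 0 < s) :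
    ∀ᶠ x : ℝ in atTop, c * ((⌈x ^ 3⌉₊ : ℕ) : ℝ) ≤ Real.exp (s * x) := by
  have h1 : Tendsto (fun x : ℝ => 2 * |c| * (x ^ (3 : ℝ) / Real.exp (s * x))) atTop (nhds 0) := by
    have := (isLittleO_rpow_exp_pos_mul_atTop 3 hs).tendsto_div_nhds_zero.const_mul (2 * |c|)
    simpa using this
  filter_upwards [h1.eventually (ge_mem_nhds zero_lt_one), eventually_ge_atTop 1] with x hx hx1
  have hx0 : (0 : ℝ) ≤ x := by linarith
  rw [← mul_div_assoc, div_le_one (Real.exp_pos _)] at hx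
  refine le_trans ?_ hx
  have h3 : ((⌈x ^ 3⌉₊ : ℕ) : ℝ) ≤ x ^ 3 + 1 := (Nat.ceil_lt_add_one (by positivity)).le
  have h4 : (1 : ℝ) ≤ x ^ 3 := one_le_pow₀ hx1
  have e : x ^ (3 : ℝ) = x ^ 3 := by exact_mod_cast Real.rpow_natCast x 3
  rw [e]
  calc c * ((⌈x ^ 3⌉₊ : ℕ) : ℝ) ≤ |c| * (2 * x ^ 3) := by
        gcongr
        · exact le_abs_self c
        · linarith
    _ = _ := by ring

/-- Tails of an exponentially decaying sequence. -/
theorem exists_sum_tail_le (d : ℤ → ℝ)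
    (hd : ∃ K lam : ℝ, 0 < K ∧ 0 < lam ∧ ∀ n : ℤ, |d n| ≤ K * Real.exp (-lam * |(n : ℝ)|)) :
    (Summable fun n => |d n|) ∧ ∃ C μ : ℝ, 0 < C ∧ 0 < μ ∧ ∀ (r : ℕ) (F : Finset ℤ),
      (∀ n ∈ F, (r : ℤ) < |n|) → ∑ n ∈ F, |d n| ≤ C * Real.exp (-μ * r) := by
  obtain ⟨K, lam, hK, hlam, h⟩ := hd
  have hsum : ∀ s : ℝ, 0 < s → Summable fun n : ℤ => Real.exp (-s * |(n : ℝ)|) := by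
    intro s hs
    have h0 : Summable fun n : ℕ => Real.exp (-s * (n : ℝ)) := by
      have := summable_geometric_of_lt_one (Real.exp_pos (-s)).le (Real.exp_lt_one_iff.2 (by linarith))
      refine this.congr fun n => ?_
      rw [← Real.exp_nat_mul, mul_comm]
    refine Summable.of_nat_of_neg ?_ ?_
    · simpa using h0
    · simpa using h0
  refine ⟨Summable.of_nonneg_of_le (fun n => abs_nonneg _) h ((hsum lam hlam).mul_left K),
    K * (∑' n : ℤ, Real.exp (-(lam / 2) * |(n : ℝ)|)) + 1, lam / 2, ?_, by positivity,
    fun r F hF => ?_⟩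
  · have : 0 ≤ ∑' n : ℤ, Real.exp (-(lam / 2) * |(n : ℝ)|) := tsum_nonneg fun n => (Real.exp_pos _).le
    positivity
  -- Half of the decay rate gives the smallness of the tail, the other half its summability.
  · calc ∑ n ∈ F, |d n| ≤ ∑ n ∈ F, Real.exp (-(lam / 2) * |(n : ℝ)|) *
          (K * Real.exp (-(lam / 2) * r)) := by
          refine Finset.sum_le_sum fun n hn => (h n).trans ?_
          have h1 : (r : ℝ) ≤ |(n : ℝ)| := by exact_mod_cast (hF n hn).le
          rw [mul_left_comm, ← Real.exp_add]
          refine mul_le_mul_of_nonneg_left (Real.exp_le_exp.2 ?_) hK.le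
          nlinarith
      _ = (∑ n ∈ F, Real.exp (-(lam / 2) * |(n : ℝ)|)) * (K * Real.exp (-(lam / 2) * r)) := by
          rw [Finset.sum_mul]
      _ ≤ (∑' n : ℤ, Real.exp (-(lam / 2) * |(n : ℝ)|)) * (K * Real.exp (-(lam / 2) * r)) := by
          refine mul_le_mul_of_nonneg_right ?_ (by positivity)
          exact (hsum _ (by positivity)).sum_le_tsum F fun n _ => (Real.exp_pos _).le
      _ ≤ _ := by
          have := (Real.exp_pos (-(lam / 2) * r)).le
          nlinarith

end Scales

/-! ### Bounds for the error terms at the chosen scales -/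

section Numerics

theorem toReal_sum_eq (l m n : ℕ) (k A z w : ℝ) (B : NNReal) (hA : 0 < A) (hk : 0 ≤ k) (hz : 0 ≤ z)
    (hw : 0 ≤ w) :
    2 * (l * (ENNReal.ofReal k / ENNReal.ofReal A)) + (m : ENNReal) * ENNReal.ofReal z
      + ((l * l : ℕ) : ENNReal) * (n : ENNReal) * ((B : ENNReal) ^ 2 * ENNReal.ofReal w)
      = ENNReal.ofReal (2 * (l * (k / A)) + m * z + (l * l) * n * ((B : ℝ) ^ 2 * w)) := by
  have hB : (B : ENNReal) = ENNReal.ofReal (B : ℝ) := (ENNReal.ofReal_coe_nnreal).symm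
  rw [ENNReal.ofReal_add (by positivity) (by positivity),
    ENNReal.ofReal_add (by positivity) (by positivity), ENNReal.ofReal_mul zero_le_two,
    ENNReal.ofReal_mul (by positivity), ENNReal.ofReal_mul (by positivity),
    ENNReal.ofReal_mul (by positivity), ENNReal.ofReal_mul (by positivity),
    ENNReal.ofReal_mul (by positivity), ENNReal.ofReal_mul (by positivity),
    ENNReal.ofReal_div_of_pos hA, ENNReal.ofReal_pow (by positivity), hB]
  simp

/-- The growth of the transfer matrices over a window is absorbed by the scale of the gradient. -/
theorem transfer_pow_mul_le (ρ W : ℝ) (g K r q : ℕ) (hρ : 0 < ρ)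
    (hq : g * Real.log ρ + 3 ≤ q) (hr : W * ρ ^ 6 * (6 * r + 2) ≤ Real.exp K) :
    W * Real.exp (-(q * K : ℝ)) * (ρ ^ (g * K + 6) * (6 * r + 2)) ≤ Real.exp (-(2 * K : ℝ)) := by
  have e1 : ρ ^ (g * K) = Real.exp (g * K * Real.log ρ) := by
    rw [← Real.exp_log (pow_pos hρ _), Real.log_pow]
    push_cast; rfl
  have hK : (0 : ℝ) ≤ K := by positivity
  calc W * Real.exp (-(q * K : ℝ)) * (ρ ^ (g * K + 6) * (6 * r + 2))
      = (W * ρ ^ 6 * (6 * r + 2)) * Real.exp (-(q * K : ℝ) + g * K * Real.log ρ) := by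
        rw [pow_add, e1, Real.exp_add]; ring
    -- `q` exceeds the growth rate `g log ρ` by `3`: one factor `e ^ (-K)` pays for the polynomial
    -- in `r`, two remain.
    _ ≤ Real.exp K * Real.exp (-(3 * K : ℝ)) := by
        gcongr
        nlinarith
    _ = _ := by rw [← Real.exp_add]; congr 1; ring

/-- The kernel bound `Kl * l * L ^ 2` comes from Markov's inequality, and `y` is the square root of
`r`. The decay `L ^ (-10)` beats every power of `L` that occurs, with one factor `L` left for the
constants. -/
theorem localization_error_le (l L R k Kl y : ℝ) (hl0 : 0 ≤ l) (hl : l ≤ k * L) (hL : 1 ≤ L)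
    (hKl : 0 ≤ Kl) (hy : Real.exp (-y) ≤ (L ^ 10)⁻¹)
    (hc : k ^ 4 * R ^ 2 * (Kl * k) ^ 2 + 5 * k ^ 2 * (Kl * k) ^ 2 ≤ L) :
    l ^ 4 * R ^ 2 * (Kl * l * L ^ 2 * Real.exp (-y)) ^ 2
      + 3 * L⁻¹ ^ 2 * l ^ 2 * (Kl * l * L ^ 2 * Real.exp (-y)) ^ 2 ≤ L⁻¹ ^ 2 ∧
    2 * l ^ 2 * (Kl * l * L ^ 2 * Real.exp (-y)) ^ 2 ≤ 1 := by
  have hL0 : 0 < L := by linarith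
  have hk : 0 ≤ k := by
    by_contra hcon
    push Not at hcon
    nlinarith
  have h1 : Kl * l * L ^ 2 * Real.exp (-y) ≤ Kl * k * (L ^ 7)⁻¹ := by
    calc Kl * l * L ^ 2 * Real.exp (-y) ≤ Kl * (k * L) * L ^ 2 * (L ^ 10)⁻¹ := by gcongr
      _ = _ := by field_simp
  have h0 : 0 ≤ Kl * l * L ^ 2 * Real.exp (-y) := by positivity
  have h2 : (Kl * l * L ^ 2 * Real.exp (-y)) ^ 2 ≤ (Kl * k) ^ 2 * (L ^ 14)⁻¹ := by
    refine (pow_le_pow_left₀ h0 h1 2).trans (le_of_eq ?_)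
    field_simp
  have hLi : L⁻¹ ^ 2 ≤ 1 := by
    rw [inv_pow]; exact inv_le_one_of_one_le₀ (one_le_pow₀ hL)
  have h3 : l ^ 4 ≤ k ^ 4 * L ^ 4 := by rw [← mul_pow]; gcongr
  have h4 : l ^ 2 ≤ k ^ 2 * L ^ 2 := by rw [← mul_pow]; gcongr
  set z := (Kl * k) ^ 2 with hz
  have hz0 : 0 ≤ z := sq_nonneg _
  have hL9 : L * (L ^ 10)⁻¹ ≤ L⁻¹ ^ 2 := by
    have : L * (L ^ 10)⁻¹ = L⁻¹ ^ 2 * (L ^ 7)⁻¹ := by field_simp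
    rw [this]
    exact mul_le_of_le_one_right (by positivity) (inv_le_one_of_one_le₀ (one_le_pow₀ hL))
  have h24 : L ^ 2 ≤ L ^ 4 := pow_le_pow_right₀ hL (by norm_num)
  have e14 : L ^ 4 * (L ^ 14)⁻¹ = (L ^ 10)⁻¹ := by field_simp
  constructor
  · calc _ ≤ (k ^ 4 * L ^ 4) * R ^ 2 * (z * (L ^ 14)⁻¹)
          + 3 * 1 * (k ^ 2 * L ^ 4) * (z * (L ^ 14)⁻¹) := by
          gcongr
          exact h4.trans (by gcongr)
      _ = (k ^ 4 * R ^ 2 * z + 3 * k ^ 2 * z) * (L ^ 4 * (L ^ 14)⁻¹) := by ring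
      _ ≤ L * (L ^ 10)⁻¹ := by
          rw [e14]
          gcongr
          nlinarith [mul_nonneg (sq_nonneg k) hz0]
      _ ≤ _ := hL9
  · calc _ ≤ 2 * (k ^ 2 * L ^ 4) * (z * (L ^ 14)⁻¹) := by
          gcongr
          exact h4.trans (by gcongr)
      _ = (2 * k ^ 2 * z) * (L ^ 4 * (L ^ 14)⁻¹) := by ring
      _ ≤ L * (L ^ 10)⁻¹ := by
          rw [e14]
          gcongr
          nlinarith [mul_nonneg (sq_nonneg k) hz0, mul_nonneg (mul_nonneg (pow_nonneg hk 4)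
            (sq_nonneg R)) hz0]
      _ ≤ 1 := hL9.trans hLi

/-- Here `η = e ^ (-qK)`, so that `η ^ (-2) = e ^ (2qK)`; all powers of `r` go into one more `e ^
K`. The constant is `1152 = 32 * 3 ^ 2 * 4`, and the exponent `N + 11` is `N + 3` plus twice the
fourth power of the number of couplings, estimated by `(6r + 2) ^ 2`. -/
theorem resonance_term_le (l L D c B : ℝ) (K r q N : ℕ) (hL : 0 < L)
    (hD : 0 < D) (hc : 0 < c)
    (hr : 1152 * c * B ^ 2 / D * (6 * r + 2) ^ (N + 11) ≤ Real.exp K) :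
    (l * l) * (((6 * r + 2) * (2 * r + 1)) ^ 2 : ℝ) * (B ^ 2
      * ((6 * r + 2) ^ 3 * (32 * (3 * L⁻¹) ^ 2
        / (D * Real.exp (-(q * K : ℝ)) ^ 2
          / (4 * c * (6 * r + 2) ^ N * ((6 * r + 2) * (2 * r + 1)) ^ 2)))))
      ≤ l ^ 2 * L⁻¹ ^ 2 * Real.exp ((2 * q + 1) * K) := by
  have e1 : Real.exp (-(q * K : ℝ)) ^ 2 = (Real.exp (2 * q * K))⁻¹ := by
    rw [← Real.exp_neg, ← Real.exp_nat_mul]; congr 1; push_cast; ring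
  have hm : ((6 * r + 2) * (2 * r + 1) : ℝ) ≤ (6 * r + 2) ^ 2 := by
    have : (0 : ℝ) ≤ r := by positivity
    nlinarith
  have e2 : (2 * q + 1) * (K : ℝ) = 2 * q * K + K := by ring
  rw [e1, e2, Real.exp_add]
  calc _ = l ^ 2 * L⁻¹ ^ 2 * Real.exp (2 * q * K) * (1152 * c * B ^ 2 / D * ((6 * r + 2) ^ (N + 3) *
        ((6 * r + 2) * (2 * r + 1)) ^ 4)) := by
        field_simp
        ring
    _ ≤ l ^ 2 * L⁻¹ ^ 2 * Real.exp (2 * q * K) * (1152 * c * B ^ 2 / D * ((6 * r + 2) ^ (N + 3) *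
        ((6 * r + 2) ^ 2) ^ 4)) := by gcongr
    _ = l ^ 2 * L⁻¹ ^ 2 * Real.exp (2 * q * K)
        * (1152 * c * B ^ 2 / D * (6 * r + 2) ^ (N + 11)) := by
        ring
    _ ≤ l ^ 2 * L⁻¹ ^ 2 * Real.exp (2 * q * K) * Real.exp K := by gcongr
    _ = _ := by ring

end Numerics

/-- Half of the exponent absorbs `C`, which leaves `e ^ (-K ^ 2 / 2)`. With `x = log L` this is at
most `L ^ (-2)` once `K ^ 2 ≥ 4 x`, the reason for `b > 1/2`. -/
theorem constrained_term_le (C x : ℝ) (K : ℕ) (hC : 0 ≤ C) (h1 : C ^ 2 ≤ Real.exp K)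
    (h2 : 4 * x ≤ (K : ℝ) ^ 2) : (C * Real.exp (-(K : ℝ))) ^ K ≤ Real.exp (-(2 * x)) := by
  have h3 : (C * Real.exp (-(K : ℝ))) ^ 2 ≤ Real.exp (-(K : ℝ)) := by
    calc (C * Real.exp (-(K : ℝ))) ^ 2 = C ^ 2 * Real.exp (-(K : ℝ)) ^ 2 := by ring
      _ ≤ Real.exp K * Real.exp (-(K : ℝ)) ^ 2 := by gcongr
      _ = _ := by
        rw [← Real.exp_nat_mul, ← Real.exp_add]; congr 1; push_cast; ring
  have h0 : 0 ≤ C * Real.exp (-(K : ℝ)) := by positivity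
  refine (sq_le_sq₀ (pow_nonneg h0 K) (Real.exp_pos _).le).1 ?_
  calc ((C * Real.exp (-(K : ℝ))) ^ K) ^ 2 = ((C * Real.exp (-(K : ℝ))) ^ 2) ^ K :=
        pow_right_comm _ _ _
    _ ≤ Real.exp (-(K : ℝ)) ^ K := pow_le_pow_left₀ (sq_nonneg _) h3 K
    _ = Real.exp (-((K : ℝ) ^ 2)) := by rw [← Real.exp_nat_mul]; congr 1; ring
    _ ≤ Real.exp (-(4 * x)) := Real.exp_le_exp.2 (by linarith)
    _ = _ := by rw [← Real.exp_nat_mul]; congr 1; push_cast; ring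

/-- All three terms are at most multiples of `l ^ 2 * L ^ (-2) * e ^ Q`; the exponent `4/3` only
weakens `2`. -/
theorem total_le (l L x p Q m z w : ℝ) (hl : 1 ≤ l) (hL : 1 ≤ L) (hx : x = Real.log L)
    (hm0 : 0 ≤ m) (hm : m ≤ 2 * l) (hz : z ≤ Real.exp (-(2 * x)))
    (hw : w ≤ l ^ 2 * L⁻¹ ^ 2 * Real.exp Q) (hQ0 : 0 ≤ Q) (hQ : Q ≤ p) :
    2 * L⁻¹ ^ 2 + m * z + w ≤ 5 * (l ^ 2 / L ^ (4 / 3 : ℝ)) * Real.exp p := by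
  have hL0 : 0 < L := by linarith
  have e1 : Real.exp (-(2 * x)) = L⁻¹ ^ 2 := by
    rw [Real.exp_neg, hx, ← Real.log_rpow hL0, Real.exp_log (by positivity), inv_pow]
    norm_num
  rw [e1] at hz
  have h1 : L⁻¹ ^ 2 ≤ 1 / L ^ (4 / 3 : ℝ) := by
    rw [inv_pow, ← one_div]
    refine one_div_le_one_div_of_le (by positivity) ?_
    rw [← Real.rpow_natCast L 2]
    exact Real.rpow_le_rpow_of_exponent_le hL (by norm_num)
  have h2 : 1 ≤ Real.exp Q := Real.one_le_exp hQ0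
  have h3 : Real.exp Q ≤ Real.exp p := Real.exp_le_exp.2 hQ
  have h4 : l ≤ l ^ 2 := by nlinarith
  have hi : 0 ≤ L⁻¹ ^ 2 := by positivity
  have h5 : m * z ≤ 2 * l ^ 2 * L⁻¹ ^ 2 := by
    calc m * z ≤ m * L⁻¹ ^ 2 := by gcongr
      _ ≤ 2 * l ^ 2 * L⁻¹ ^ 2 := by gcongr; linarith
  have h6 : 2 * L⁻¹ ^ 2 ≤ 2 * l ^ 2 * L⁻¹ ^ 2 := by
    refine mul_le_mul_of_nonneg_right ?_ hi
    linarith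
  calc 2 * L⁻¹ ^ 2 + m * z + w ≤ 4 * (l ^ 2 * L⁻¹ ^ 2) + l ^ 2 * L⁻¹ ^ 2 * Real.exp Q := by linarith
    _ ≤ 4 * (l ^ 2 * L⁻¹ ^ 2) * Real.exp Q + l ^ 2 * L⁻¹ ^ 2 * Real.exp Q := by
        exact add_le_add (le_mul_of_one_le_right (by positivity) h2) le_rfl
    _ = 5 * (l ^ 2 * L⁻¹ ^ 2) * Real.exp Q := by ring
    _ ≤ 5 * (l ^ 2 * (1 / L ^ (4 / 3 : ℝ))) * Real.exp p := by gcongr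
    _ = _ := by rw [mul_one_div]

/-! ### Choice of the scales and the bound for bounded couplings -/

set_option maxHeartbeats 400000 in
/-- The probability bound for one box, with the scales chosen in terms of two natural numbers `K`
and `r`. -/
theorem measureReal_spectralTrace_le_of_scales {Ω : Type*} [MeasurableSpace Ω] (P : Measure Ω)
    [IsProbabilityMeasure P] (ω : ℤ → Ω → ℝ) (B : NNReal) (S : ℝ) (hω : BoundedIndep P ω B S)
    (bc : BoundaryCondition) (a d : ℤ → ℝ) (hd0 : ∀ n, 0 ≤ d n) (hds : Summable d)
    (D : ℝ) (hDdef : D = ∑' n, d n) (hD : 0 < D) (c : ℝ) (N : ℕ) (hc : 0 < c)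
    (hconv : ∀ (S : Finset ℤ) (f : ℤ → ℝ), (∀ m ∉ S, f m = 0) →
      ∀ B : ℝ, (∀ F : Finset ℤ, ∑ i ∈ F, |convOn d S f i| ≤ B) →
        ∀ m, |f m| ≤ c * (S.card : ℝ) ^ N * B)
    (M R E E' κ h x ρ Ct μ Cc τ₀ Kl α β k : ℝ) (g K r q L l : ℕ) (hM : 0 < M)
    (haM : ∀ n, 1 / M ≤ |a n| ∧ |a n| ≤ M) (hCt : 0 < Ct) (hμ : 0 < μ)
    (htail : ∀ F : Finset ℤ, (∀ n ∈ F, (r : ℤ) < |n|) → ∑ n ∈ F, |d n| ≤ Ct * Real.exp (-μ * r))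
    (hCc : 0 < Cc) (hτ₀ : 0 < τ₀)
    (hCF : ∀ (F : Finset ℤ) (τ : ℝ), 0 < τ → τ ≤ τ₀ →
      P {w | ∃ n₀ ∈ F,
        ConstrainedFrom a (alloyPotential d fun n => ω n w) ((E + E') / 2) τ g K n₀}
        ≤ F.card * ENNReal.ofReal ((Cc * τ) ^ K))
    (hKl1 : 1 ≤ Kl)
    (hK : ∀ e ∈ ({E, E'} : Set ℝ), ∀ x, ∫⁻ w, ∑ y : Fin l,
        ENNReal.ofReal (Real.exp (boxDist bc l x y ^ (1 / 2 : ℝ))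
          * |cfc (energyBump e h) (boxOperator bc a (alloyPotential d fun n => ω n w) l) x y|) ∂P
      ≤ ENNReal.ofReal Kl)
    (hκ : 0 < κ) (hκdef : |E - E'| = κ + κ)
    (hR : D * S + 4 * M + |E| + |E'| + 3 ≤ R) (hρ : 0 < ρ) (hρdef : ρ = 1 + M * (M + R))
    (hq : g * Real.log ρ + 3 ≤ q) (hα : α ∈ Set.Ioo (0 : ℝ) 1) (hk : 1 < k)
    (hL1 : 1 ≤ L) (hx : x = Real.log L) (hh : h = (L : ℝ)⁻¹) (hh3 : h ≤ κ / 6) (hh4 : h ≤ 1)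
    (v1 : (2 * M + R) * ρ ^ 6 * (6 * r + 2) ≤ Real.exp K)
    (v2 : (2 * M + R) * (1 + R + M + M / κ) * ρ ^ 6 * (6 * r + 2) ≤ Real.exp K)
    (v3 : 1152 * c * (B : ℝ) ^ 2 / D * (6 * r + 2) ^ (N + 11) ≤ Real.exp K)
    (v4 : 6 * Ct * c * (6 * r + 2) ^ N ≤ Real.exp K) (v5 : 2 * Ct / D ≤ Real.exp K)
    (v6 : 2 / κ ≤ Real.exp K) (v7 : 2 ≤ Real.exp K) (v8 : 6 * (2 * R + 4) ≤ Real.exp K)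
    (v9 : Cc ^ 2 ≤ Real.exp K) (v10 : τ₀⁻¹ ≤ Real.exp K)
    (v11 : k ^ 4 * R ^ 2 * (Kl * k) ^ 2 + 5 * k ^ 2 * (Kl * k) ^ 2 ≤ Real.exp K)
    (v12 : (2 * q + 1) * (K : ℝ) ≤ x ^ β) (v13 : 2 * (K : ℝ) ≤ x) (v14 : 4 * x ≤ (K : ℝ) ^ 2)
    (v15 : 10 * x ≤ (r : ℝ) ^ (1 / 2 : ℝ)) (v16 : (2 * g + 15) * (K : ℝ) ≤ r)
    (v17 : (2 * q + 1) / μ * (K : ℝ) ≤ r) (v18 : k * (r : ℝ) ≤ Real.exp (α * x))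
    (hl1 : (L : ℝ) ^ α / k ≤ l) (hl2 : (l : ℝ) ≤ k * (L : ℝ) ^ α) :
    P.real {w | spectralTrace (Set.Icc (E - h) (E + h))
          (boxOperator bc a (alloyPotential d fun n => ω n w) l) ≠ 0 ∧
        spectralTrace (Set.Icc (E' - h) (E' + h))
          (boxOperator bc a (alloyPotential d fun n => ω n w) l) ≠ 0}
      ≤ 5 * ((l : ℝ) ^ 2 / (L : ℝ) ^ (4 / 3 : ℝ)) * Real.exp (x ^ β) := by
  subst hDdef
  have hLr : (1 : ℝ) ≤ L := by exact_mod_cast hL1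
  have hL0 : (0 : ℝ) < L := by linarith
  have hexp : Real.exp x = L := hx ▸ Real.exp_log hL0
  have hh0 : 0 < h := by rw [hh]; positivity
  have hK1 : 1 ≤ K := by
    by_contra hcon
    have h0 : K = 0 := by omega
    rw [h0] at v7
    norm_num at v7
  have hKr : (1 : ℝ) ≤ K := by exact_mod_cast hK1
  have hx0 : 0 ≤ x := hx ▸ Real.log_nonneg hLr
  have hGr : 2 * (g * K + 6) + 3 ≤ r := by
    have h1 : 2 * (g * K + 6) + 3 ≤ (2 * g + 15) * K := by
      rw [add_mul, mul_assoc]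
      omega
    refine h1.trans ?_
    exact_mod_cast v16
  have hrl : r ≤ l := by
    have h1 : (L : ℝ) ^ α = Real.exp (α * x) := by
      rw [Real.rpow_def_of_pos hL0, hx, mul_comm]
    have h2 : (r : ℝ) ≤ l := by
      refine le_trans ?_ hl1
      rw [le_div_iff₀ (by linarith), h1, mul_comm]
      exact v18
    exact_mod_cast h2
  have hl0 : (1 : ℝ) ≤ l := by
    have : 1 ≤ l := by omega
    exact_mod_cast this
  have hlL : (l : ℝ) ≤ k * L := by
    refine hl2.trans (mul_le_mul_of_nonneg_left ?_ (by linarith))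
    calc (L : ℝ) ^ α ≤ (L : ℝ) ^ (1 : ℝ) := Real.rpow_le_rpow_of_exponent_le hLr hα.2.le
      _ = L := Real.rpow_one _
  have hEK : Real.exp K ≤ (L : ℝ) := by
    rw [← hexp]
    exact Real.exp_le_exp.2 (by linarith)
  have hEK2 : Real.exp K * Real.exp K ≤ (L : ℝ) := by
    rw [← hexp, ← Real.exp_add]
    exact Real.exp_le_exp.2 (by linarith)
  have he0 := Real.exp_pos (K : ℝ)
  have hnegK : Real.exp (-(K : ℝ)) = (Real.exp K)⁻¹ := Real.exp_neg _
  have hneg2K : Real.exp (-(2 * K : ℝ)) = (Real.exp K)⁻¹ * (Real.exp K)⁻¹ := by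
    rw [← Real.exp_neg, ← Real.exp_add]; congr 1; ring
  have hτhalf : Real.exp (-(2 * K : ℝ)) ≤ Real.exp (-(K : ℝ)) / 2 := by
    rw [hneg2K, hnegK, div_eq_mul_inv]
    refine mul_le_mul_of_nonneg_left ?_ (by positivity)
    exact inv_anti₀ two_pos v7
  have hκK : Real.exp (-(2 * K : ℝ)) < κ := by
    refine lt_of_le_of_lt hτhalf ?_
    rw [hnegK]
    have : (Real.exp K)⁻¹ ≤ (2 / κ)⁻¹ := inv_anti₀ (by positivity) v6
    rw [inv_div] at this
    linarith
  have hμK : ∀ c₀ : ℝ, 0 < c₀ → c₀ ≤ Real.exp K →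
      c₀ * Real.exp (-μ * r) ≤ Real.exp (-(2 * (q * K) : ℝ)) := by
    intro c₀ _ h1
    calc c₀ * Real.exp (-μ * r) ≤ Real.exp K * Real.exp (-μ * r) := by gcongr
      _ = Real.exp (K - μ * r) := by rw [← Real.exp_add]; congr 1; ring
      _ ≤ _ := by
        refine Real.exp_le_exp.2 ?_
        rw [div_mul_eq_mul_div, div_le_iff₀ hμ] at v17
        linarith
  -- With this threshold, Markov's inequality over the `l` sites and both energies costs `2 L ^
  -- (-2)`.
  obtain ⟨A, hA⟩ : ∃ A, A = Kl * l * (L : ℝ) ^ 2 := ⟨_, rfl⟩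
  have hA0 : 0 < A := by rw [hA]; positivity
  have hlocerr := localization_error_le l L R k Kl ((r : ℝ) ^ (1 / 2 : ℝ)) (by positivity) hlL hLr
    (by positivity) (by
      rw [← hexp, ← Real.exp_nat_mul, ← Real.exp_neg]
      refine Real.exp_le_exp.2 ?_
      push_cast
      linarith) (v11.trans hEK)
  rw [← hA, ← hh] at hlocerr
  -- The scales are `η = e ^ (-qK)`, `τ = e ^ (-K)`, `t = Ct e ^ (-μ r)` and `G = g K + 6`.
  have key := measure_spectralTrace_ne_zero_le P ω B S hω (l := l) bc a d hd0 hds hD c N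
    hc hconv M R E E' κ h (Real.exp (-(q * K : ℝ))) (Real.exp (-(K : ℝ))) (Ct * Real.exp (-μ * r)) A Cc Kl g K
    (g * K + 6) r hM hh0 (Real.exp_pos _) hA0 haM
    (hCF _ _ (Real.exp_pos _) (by
      rw [hnegK]
      exact inv_le_of_inv_le₀ hτ₀ v10))
    (by linarith) hκ (by linarith)
    (hρdef ▸ lt_of_le_of_lt (transfer_pow_mul_le ρ (2 * M + R) g K r q hρ hq v1) hκK)
    (by
      have h1 := transfer_pow_mul_le ρ ((2 * M + R) * (1 + R + M + M / κ)) g K r q hρ hq v2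
      have h2 : 3 * h * (2 * R + 3 * h + 1) ≤ Real.exp (-(K : ℝ)) / 2 := by
        have h3 : 3 * h * (2 * R + 3 * h + 1) ≤ 3 * h * (2 * R + 4) :=
          mul_le_mul_of_nonneg_left (by linarith only [hh4]) (by positivity)
        refine h3.trans ?_
        rw [hnegK, hh, inv_eq_one_div, inv_eq_one_div, div_div, mul_one_div, div_mul_eq_mul_div,
          div_le_div_iff₀ hL0 (by positivity)]
        linarith only [mul_le_mul_of_nonneg_right v8 he0.le, hEK2]
      have h4 : (2 * M + R) * Real.exp (-(q * K : ℝ)) * (1 + R + M + M / κ)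
          * ((1 + M * (M + R)) ^ (g * K + 6) * (6 * r + 2))
          = (2 * M + R) * (1 + R + M + M / κ) * Real.exp (-(q * K : ℝ))
          * (ρ ^ (g * K + 6) * (6 * r + 2)) := by rw [hρdef]; ring
      rw [h4]
      linarith)
    le_rfl hGr (hGr.trans hrl)
    (fun F hF => by
      have := htail F hF
      rwa [Finset.sum_congr rfl fun n _ => abs_of_nonneg (hd0 n)] at this)
    (by
      have h1 := hμK (2 * Ct / (∑' n, d n)) (by positivity) v5
      have h2 : Real.exp (-(2 * (q * K) : ℝ)) ≤ 1 := Real.exp_le_one_iff.2 (by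
        have : (0 : ℝ) ≤ q * K := by positivity
        linarith)
      have h3 : 2 * Ct / (∑' n, d n) * Real.exp (-μ * r) = 2 * (Ct * Real.exp (-μ * r)) / (∑' n, d n) := by
        ring
      rw [h3] at h1
      exact (div_le_one hD).1 (h1.trans h2))
    (by
      have h1 := hμK _ (by positivity) v4
      rw [le_div_iff₀ (by positivity), ← Real.exp_nat_mul]
      refine le_trans (le_of_eq ?_) (h1.trans (le_of_eq ?_))
      · ring
      · congr 1; push_cast; ring)
    hlocerr.1 hlocerr.2 hK
  rw [toReal_sum_eq _ _ _ _ _ _ _ _ hA0 (by positivity) (by positivity) (by positivity)] at key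
  refine (ENNReal.toReal_le_of_le_ofReal (by positivity) key).trans ?_
  have e1 : 2 * ((l : ℝ) * (Kl / A)) = 2 * (L : ℝ)⁻¹ ^ 2 := by
    rw [hA]; field_simp
  rw [e1]
  refine total_le l L x (x ^ β) ((2 * q + 1) * K) _ _ _ hl0 hLr hx (by positivity) ?_
    (constrained_term_le Cc x K hCc.le v9 v14) ?_ (by positivity) v12
  · have : l + 2 * (g * K + 6) + 1 ≤ 2 * l := by omega
    exact_mod_cast this
  · have := resonance_term_le l L _ c B K r q N hL0 hD hc v3
    rw [hh]
    push_cast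
    exact this

/-- The probability bound for bounded couplings and a non-negative single-site potential. -/
theorem exists_measureReal_spectralTrace_le {Ω : Type*} [MeasurableSpace Ω] (P : Measure Ω)
    [IsProbabilityMeasure P] (ω : ℤ → Ω → ℝ) (B : NNReal) (S : ℝ) (hω : BoundedIndep P ω B S)
    (a : ℤ → ℝ) (ha : ∃ M : ℝ, 0 < M ∧ ∀ n, 1 / M ≤ |a n| ∧ |a n| ≤ M)
    (d : ℤ → ℝ) (hd_ne : ∃ n, d n ≠ 0)
    (hd_decay : ∃ K lam : ℝ, 0 < K ∧ 0 < lam ∧ ∀ n : ℤ, |d n| ≤ K * Real.exp (-lam * |(n : ℝ)|))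
    (hd0 : ∀ n, 0 ≤ d n)
    (hH2 : (Function.support d).Finite ∨
      ∀ θ ∈ Set.Ico (0 : ℝ) (2 * Real.pi),
        ∑' n : ℤ, (d n : ℂ) * Complex.exp (Complex.I * (n : ℂ) * (θ : ℂ)) ≠ 0)
    (bc : BoundaryCondition) (I : Set ℝ) (hI : IsOpen I)
    (hLoc : IsLocalizedOn P bc
      (fun w L => boxOperator bc a (alloyPotential d fun n => ω n w) L) I)
    (β : ℝ) (hβ : β ∈ Set.Ioo (1 / 2 : ℝ) 1) (α : ℝ) (hα : α ∈ Set.Ioo (0 : ℝ) 1)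
    (E E' : ℝ) (hE : E ∈ I) (hE' : E' ∈ I) (hEE' : E ≠ E') (k : ℝ) (hk : 1 < k) :
    ∃ C : ℝ, 0 < C ∧ ∀ᶠ L : ℕ in atTop, ∀ l : ℕ,
      (L : ℝ) ^ α / k ≤ (l : ℝ) → (l : ℝ) ≤ k * (L : ℝ) ^ α →
        P.real {w |
          spectralTrace (Set.Icc (E - (L : ℝ)⁻¹) (E + (L : ℝ)⁻¹))
            (boxOperator bc a (alloyPotential d fun n => ω n w) l) ≠ 0 ∧
          spectralTrace (Set.Icc (E' - (L : ℝ)⁻¹) (E' + (L : ℝ)⁻¹))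
            (boxOperator bc a (alloyPotential d fun n => ω n w) l) ≠ 0}
        ≤ C * ((l : ℝ) ^ 2 / (L : ℝ) ^ (4 / 3 : ℝ)) * Real.exp (Real.log L ^ β) := by
  obtain ⟨M, hM, haM⟩ := ha
  obtain ⟨hdsa, Ct, μ, hCt, hμ, htail⟩ := exists_sum_tail_le d hd_decay
  have hdabs : (fun n => |d n|) = d := funext fun n => abs_of_nonneg (hd0 n)
  have hds : Summable d := by rwa [hdabs] at hdsa
  have hD : 0 < ∑' n, d n := by
    obtain ⟨n, hn⟩ := hd_ne
    exact hds.tsum_pos hd0 n (lt_of_le_of_ne (hd0 n) hn.symm)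
  obtain ⟨D, hDdef⟩ : ∃ D, D = ∑' n, d n := ⟨_, rfl⟩
  rw [← hDdef] at hD
  obtain ⟨c, N, hc, hconv⟩ := exists_abs_le_convOn d hd_ne hdsa hH2
  obtain ⟨g, Cc, τ₀, hCc, hτ₀, hCF⟩ := exists_measure_constrainedFrom_le P ω B S hω d hd_ne hdsa a M
    hM (fun n => (haM n).1) ((E + E') / 2)
  -- One exponent suffices: with `r ~ (log L) ^ 3`, the square root of `r` exceeds any multiple of
  -- `log L`.
  obtain ⟨K₀, hK₀⟩ := hLoc (1 / 2) (by norm_num) (by norm_num)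
  obtain ⟨s₁, hs₁, hsI⟩ := Metric.isOpen_iff.1 hI E hE
  obtain ⟨s₂, hs₂, hsI'⟩ := Metric.isOpen_iff.1 hI E' hE'
  obtain ⟨κ, hκdef⟩ : ∃ κ, κ = |E - E'| / 2 := ⟨_, rfl⟩
  have hκ : 0 < κ := hκdef ▸ half_pos (abs_pos.2 (sub_ne_zero.2 hEE'))
  obtain ⟨R, hR⟩ : ∃ R, R = D * S + 4 * M + |E| + |E'| + 3 := ⟨_, rfl⟩
  have hS0 : 0 ≤ S := by
    obtain ⟨w⟩ := nonempty_of_isProbabilityMeasure P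
    exact (abs_nonneg _).trans (hω.bdd 0 w)
  have hR0 : 0 < R := by rw [hR]; positivity
  obtain ⟨ρ, hρdef⟩ : ∃ ρ, ρ = 1 + M * (M + R) := ⟨_, rfl⟩
  have hρ : 0 < ρ := by rw [hρdef]; positivity
  obtain ⟨q, hq⟩ := exists_nat_ge (g * Real.log ρ + 3)
  -- `b > 1/2` makes `K ^ 2` larger than multiples of `log L`, and `b < β` makes `(2 q + 1) K` at
  -- most `(log L) ^ β`.
  obtain ⟨b, hb⟩ : ∃ b, b = (1 / 2 + β) / 2 := ⟨_, rfl⟩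
  have hb1 : 1 / 2 < b := by linarith [hβ.1]
  have hb0 : 0 < b := by linarith
  have hbβ : b < β := by linarith [hβ.1]
  have hbone : b < 1 := hbβ.trans hβ.2
  have hlog : Tendsto (fun L : ℕ => Real.log L) atTop atTop :=
    Real.tendsto_log_atTop.comp tendsto_natCast_atTop_atTop
  have hinv : Tendsto (fun L : ℕ => ((L : ℝ))⁻¹) atTop (nhds 0) :=
    tendsto_inv_atTop_zero.comp tendsto_natCast_atTop_atTop
  have ev : ∀ c₀ : ℝ, ∀ p : ℕ, ∀ᶠ L : ℕ in atTop,
      c₀ * (6 * ((⌈Real.log L ^ 3⌉₊ : ℕ) : ℝ) + 2) ^ p ≤ Real.exp (⌈Real.log L ^ b⌉₊ : ℕ) :=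
    fun c₀ p => hlog.eventually (eventually_ceil_pow_le_exp hb0 c₀ p)
  refine ⟨5, by norm_num, ?_⟩
  -- The bounds on `1/L` keep the supports of the two bumps inside `I` and the two energy windows
  -- apart; the remaining conditions compare `K`, `r` and `log L`.
  filter_upwards [eventually_ge_atTop 1,
    hinv.eventually (ge_mem_nhds (show 0 < min (min (s₁ / 4) (s₂ / 4)) (min (κ / 6) 1) by positivity)),
    ev ((2 * M + R) * ρ ^ 6) 1, ev ((2 * M + R) * (1 + R + M + M / κ) * ρ ^ 6) 1,
    ev (1152 * c * (B : ℝ) ^ 2 / D) (N + 11), ev (6 * Ct * c) N, ev (2 * Ct / D) 0, ev (2 / κ) 0,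
    ev 2 0, ev (6 * (2 * R + 4)) 0, ev (Cc ^ 2) 0, ev (τ₀⁻¹) 0,
    ev (k ^ 4 * R ^ 2 * (max K₀ 1 * k) ^ 2 + 5 * k ^ 2 * (max K₀ 1 * k) ^ 2) 0,
    hlog.eventually (eventually_mul_ceil_le hb0 hbβ (2 * q + 1)),
    hlog.eventually (eventually_mul_ceil_le hb0 hbone 2),
    hlog.eventually (eventually_mul_le_ceil_sq hb1 4),
    hlog.eventually (eventually_mul_le_sqrt_ceil 10),
    hlog.eventually (eventually_mul_ceil_le_ceil hb0 hbone (2 * g + 15)),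
    hlog.eventually (eventually_mul_ceil_le_ceil hb0 hbone ((2 * q + 1) / μ)),
    hlog.eventually (eventually_mul_ceil_le_exp k hα.1)]
    with L hL1 hLinv v1 v2 v3 v4 v5 v6 v7 v8 v9 v10 v11 v12 v13 v14 v15 v16 v17 v18
  intro l hl1 hl2
  simp only [pow_zero, mul_one, pow_one] at v1 v2 v4 v5 v6 v7 v8 v9 v10 v11
  rw [Real.rpow_one] at v13
  have hh0 : (0 : ℝ) < (L : ℝ)⁻¹ := inv_pos.2 (by exact_mod_cast hL1)
  have hh1 : (L : ℝ)⁻¹ ≤ s₁ / 4 := hLinv.trans ((min_le_left _ _).trans (min_le_left _ _))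
  have hh2 : (L : ℝ)⁻¹ ≤ s₂ / 4 := hLinv.trans ((min_le_left _ _).trans (min_le_right _ _))
  have hball : ∀ e s : ℝ, Metric.ball e s ⊆ I → (L : ℝ)⁻¹ ≤ s / 4 → 0 < s →
      tsupport (energyBump e (L : ℝ)⁻¹) ⊆ I := fun e s hs hhs hs0 =>
    (tsupport_energyBump_subset hh0).trans
      ((Metric.closedBall_subset_ball (by linarith only [hhs, hs0])).trans hs)
  refine measureReal_spectralTrace_le_of_scales P ω B S hω bc a d hd0 hds D hDdef hD c N hc hconv M R
    E E' κ _ _ ρ Ct μ Cc τ₀ (max K₀ 1) α β k g _ _ q L l hM haM hCt hμ (htail _) hCc hτ₀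
    (fun F τ => hCF F _ τ) (le_max_right _ _) (fun e he y => ?_) hκ (by rw [hκdef]; ring) hR.ge
    hρ hρdef hq hα hk hL1 rfl rfl (hLinv.trans ((min_le_right _ _).trans (min_le_left _ _)))
    (hLinv.trans ((min_le_right _ _).trans (min_le_right _ _))) v1 v2 v3 v4 v5 v6 v7 v8 v9 v10 v11
    v12 v13 v14 v15 v16 v17 v18 hl1 hl2
  refine (hK₀ l y (energyBump e _) (continuous_energyBump e _).measurable
    (abs_energyBump_le e _) ?_).trans (ENNReal.ofReal_le_ofReal (le_max_left _ _))
  rcases he with rfl | he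
  · exact hball _ s₁ hsI hh1 hs₁
  · rw [Set.mem_singleton_iff.1 he]
    exact hball _ s₂ hsI' hh2 hs₂

/-! ### Reduction to bounded couplings and a non-negative single-site potential -/

/-- The variable, clipped to the interval `[-S, S]` and multiplied by `σ`. -/
def clipScale (σ S t : ℝ) : ℝ := σ * max (-S) (min S t)

theorem measurable_clipScale (σ S : ℝ) : Measurable (clipScale σ S) := by
  unfold clipScale
  fun_prop

theorem clipScale_of_abs_le {σ S t : ℝ} (h : |t| ≤ S) : clipScale σ S t = σ * t := by
  rw [abs_le] at h
  unfold clipScale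
  rw [min_eq_right h.2, max_eq_right h.1]

theorem abs_clipScale_le {σ S : ℝ} (hσ : σ = 1 ∨ σ = -1) (hS : 0 ≤ S) (t : ℝ) :
    |clipScale σ S t| ≤ S := by
  have h1 : |max (-S) (min S t)| ≤ S :=
    abs_le.2 ⟨le_max_left _ _, max_le (by linarith) (min_le_left _ _)⟩
  unfold clipScale
  rcases hσ with rfl | rfl
  · simpa using h1
  · simpa using h1

/-- Independent variables with a common bounded, compactly supported density agree almost surely
with bounded variables, up to their signs. -/
theorem exists_boundedIndep_clipScale {Ω : Type*} [MeasurableSpace Ω] (P : Measure Ω)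
    [IsProbabilityMeasure P] (ω : ℤ → Ω → ℝ) (hω_meas : ∀ n, Measurable (ω n))
    (hω_indep : iIndepFun ω P) (ρ : ℝ → ℝ) (hρ_bdd : ∃ B : ℝ, ∀ t, ρ t ≤ B)
    (hρ_supp : HasCompactSupport ρ)
    (hω_law : ∀ n, P.map (ω n) = volume.withDensity fun t => ENNReal.ofReal (ρ t))
    (σ : ℝ) (hσ : σ = 1 ∨ σ = -1) :
    ∃ (B : NNReal) (S : ℝ), BoundedIndep P (fun n w => clipScale σ S (ω n w)) B S ∧
      ∀ᵐ w ∂P, ∀ n, |ω n w| ≤ S := by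
  obtain ⟨B₀, hB₀⟩ := hρ_bdd
  obtain ⟨S₀, hS₀⟩ := hρ_supp.isCompact.isBounded.subset_closedBall (0 : ℝ)
  set S := max S₀ 0 with hS
  have hS0 : 0 ≤ S := le_max_right _ _
  have hout : ∀ t, S < |t| → ρ t = 0 := by
    intro t ht
    by_contra hne
    have := hS₀ (subset_tsupport ρ hne)
    rw [Metric.mem_closedBall, Real.dist_eq, sub_zero] at this
    exact absurd (this.trans (le_max_left _ _)) (not_le.2 ht)
  have hms : MeasurableSet {t : ℝ | S < |t|} := measurableSet_lt measurable_const (by fun_prop)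
  have hae : ∀ n, ∀ᵐ w ∂P, |ω n w| ≤ S := by
    intro n
    have h1 : P.map (ω n) {t : ℝ | S < |t|} = 0 := by
      rw [hω_law, withDensity_apply _ hms, setLIntegral_congr_fun (g := fun _ => 0) hms]
      · simp
      · intro t ht
        simp only
        rw [hout t ht, ENNReal.ofReal_zero]
    rw [Measure.map_apply (hω_meas n) hms] at h1
    rw [ae_iff]
    refine measure_mono_null (fun w hw => ?_) h1
    exact not_le.1 hw
  -- The support of the density bounds the couplings only almost surely. Clipping changes them on a
  -- null set and makes the bound hold everywhere.
  refine ⟨B₀.toNNReal, S, ⟨fun n => (measurable_clipScale σ S).comp (hω_meas n),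
    hω_indep.comp (fun _ => clipScale σ S) fun _ => measurable_clipScale σ S, fun n s => ?_,
    fun n w => abs_clipScale_le hσ hS0 _⟩, ae_all_iff.2 hae⟩
  have hmul : (volume : Measure ℝ).map (fun t => σ * t) = volume := by
    rcases hσ with rfl | rfl
    · simp
    · simp [Measure.map_neg_eq_self]
  have h1 : P.map (fun w => clipScale σ S (ω n w)) = (P.map (ω n)).map fun t => σ * t := by
    rw [Measure.map_map (by fun_prop) (hω_meas n)]
    refine Measure.map_congr ?_
    filter_upwards [hae n] with w hw
    exact clipScale_of_abs_le hw
  have h2 : P.map (ω n) ≤ (B₀.toNNReal : ENNReal) • volume := by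
    rw [hω_law, ← withDensity_const]
    exact withDensity_mono (Eventually.of_forall fun t => ENNReal.ofReal_le_ofReal (hB₀ t))
  rw [h1]
  refine (Measure.map_mono h2 (by fun_prop) s).trans (le_of_eq ?_)
  rw [Measure.map_smul, hmul, Measure.smul_apply, smul_eq_mul]

theorem alloyPotential_clipScale (d w : ℤ → ℝ) (σ S : ℝ) (hσ : σ = 1 ∨ σ = -1)
    (hw : ∀ n, |w n| ≤ S) :
    alloyPotential (fun n => σ * d n) (fun n => clipScale σ S (w n)) = alloyPotential d w := by
  funext m
  refine tsum_congr fun n => ?_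
  simp only [clipScale_of_abs_le (hw _)]
  rcases hσ with rfl | rfl <;> ring

end

theorem mainTheorem6
    {Ω : Type*} [MeasurableSpace Ω] (P : Measure Ω) [IsProbabilityMeasure P]
    -- the i.i.d. couplings, with a bounded compactly supported density
    (ω : ℤ → Ω → ℝ) (hω_meas : ∀ n, Measurable (ω n)) (hω_indep : iIndepFun ω P)
    (ρ : ℝ → ℝ) (hρ_meas : Measurable ρ) (hρ_nonneg : ∀ t, 0 ≤ ρ t)
    (hρ_bdd : ∃ B : ℝ, ∀ t, ρ t ≤ B) (hρ_supp : HasCompactSupport ρ)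
    (hω_law : ∀ n, P.map (ω n) = volume.withDensity fun t => ENNReal.ofReal (ρ t))
    -- the deterministic off-diagonal coefficients
    (a : ℤ → ℝ) (ha : ∃ M : ℝ, 0 < M ∧ ∀ n, 1 / M ≤ |a n| ∧ |a n| ≤ M)
    -- the single-site potential: non-zero, exponentially decaying
    (d : ℤ → ℝ) (hd_ne : ∃ n, d n ≠ 0)
    (hd_decay : ∃ K lam : ℝ, 0 < K ∧ 0 < lam ∧ ∀ n : ℤ, |d n| ≤ K * Real.exp (-lam * |(n : ℝ)|))
    (hH1 : (∀ n, 0 ≤ d n) ∨ (∀ n, d n ≤ 0))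
    (hH2 : (Function.support d).Finite ∨
      ∀ θ ∈ Set.Ico (0 : ℝ) (2 * Real.pi),
        ∑' n : ℤ, (d n : ℂ) * Complex.exp (Complex.I * (n : ℂ) * (θ : ℂ)) ≠ 0)
    -- the boundary condition and the interval of localization
    (bc : BoundaryCondition) (I : Set ℝ) (hI : IsOpen I)
    (hLoc : IsLocalizedOn P bc
      (fun w L => boxOperator bc a (alloyPotential d fun n => ω n w) L) I)
    (β : ℝ) (hβ : β ∈ Set.Ioo (1 / 2 : ℝ) 1) (α : ℝ) (hα : α ∈ Set.Ioo (0 : ℝ) 1)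
    (E E' : ℝ) (hE : E ∈ I) (hE' : E' ∈ I) (hEE' : E ≠ E') (k : ℝ) (hk : 1 < k) :
    ∃ C : ℝ, 0 < C ∧ ∀ᶠ L : ℕ in atTop, ∀ l : ℕ,
      (L : ℝ) ^ α / k ≤ (l : ℝ) → (l : ℝ) ≤ k * (L : ℝ) ^ α →
        P.real {w |
          spectralTrace (Set.Icc (E - (L : ℝ)⁻¹) (E + (L : ℝ)⁻¹))
            (boxOperator bc a (alloyPotential d fun n => ω n w) l) ≠ 0 ∧
          spectralTrace (Set.Icc (E' - (L : ℝ)⁻¹) (E' + (L : ℝ)⁻¹))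
            (boxOperator bc a (alloyPotential d fun n => ω n w) l) ≠ 0}
        ≤ C * ((l : ℝ) ^ 2 / (L : ℝ) ^ (4 / 3 : ℝ)) * Real.exp (Real.log L ^ β) := by
  -- Changing the sign of both `d` and the couplings leaves the potential unchanged, so the sign of
  -- `d` may be taken non-negative.
  obtain ⟨σ, hσ, hσd⟩ : ∃ σ : ℝ, (σ = 1 ∨ σ = -1) ∧ ∀ n, 0 ≤ σ * d n := by
    rcases hH1 with h | h
    · exact ⟨1, Or.inl rfl, fun n => by simpa using h n⟩
    · exact ⟨-1, Or.inr rfl, fun n => by simpa using h n⟩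
  have hσ0 : σ ≠ 0 := by rcases hσ with rfl | rfl <;> norm_num
  have hσa : |σ| = 1 := by rcases hσ with rfl | rfl <;> simp
  obtain ⟨B, S, hω, hae⟩ := exists_boundedIndep_clipScale P ω hω_meas hω_indep ρ hρ_bdd hρ_supp
    hω_law σ hσ
  have hpot : ∀ᵐ w ∂P, alloyPotential (fun n => σ * d n) (fun n => clipScale σ S (ω n w))
      = alloyPotential d fun n => ω n w := by
    filter_upwards [hae] with w hw
    exact alloyPotential_clipScale d _ σ S hσ hw
  obtain ⟨C, hC, h⟩ := exists_measureReal_spectralTrace_le P _ B S hω a ha (fun n => σ * d n)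
    (hd_ne.imp fun n hn => mul_ne_zero hσ0 hn)
    (by simpa only [abs_mul, hσa, one_mul] using hd_decay) hσd
    (by
      rcases hH2 with h | h
      · exact Or.inl (h.subset fun n hn => right_ne_zero_of_mul hn)
      · refine Or.inr fun θ hθ => ?_
        have e : ∀ n : ℤ, ((σ * d n : ℝ) : ℂ) * Complex.exp (Complex.I * (n : ℂ) * (θ : ℂ))
            = (σ : ℂ) * ((d n : ℂ) * Complex.exp (Complex.I * (n : ℂ) * (θ : ℂ))) := fun n => by
          push_cast; ring
        simp only [e]
        rw [tsum_mul_left]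
        exact mul_ne_zero (by exact_mod_cast hσ0) (h θ hθ))
    bc I hI
    (by
      -- The potentials agree almost surely, so the expectations in the localization estimate are
      -- the same.
      intro ξ h1 h2
      obtain ⟨K, hK⟩ := hLoc ξ h1 h2
      refine ⟨K, fun L x f hf hf1 hfI => le_trans (le_of_eq ?_) (hK L x f hf hf1 hfI)⟩
      refine lintegral_congr_ae ?_
      filter_upwards [hpot] with w hw
      simp only [hw])
    β hβ α hα E E' hE hE' hEE' k hk
  refine ⟨C, hC, ?_⟩
  filter_upwards [h] with L hL l hl1 hl2
  refine le_trans (le_of_eq ?_) (hL l hl1 hl2)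
  refine measureReal_congr ?_
  filter_upwards [hpot] with w hw
  refine propext ?_
  change (_ ∧ _) ↔ (_ ∧ _)
  rw [hw]
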